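/- Throughout, functions are complex-valued and $\widehat f(\xi)=\int f(x)e^{-2\pi i\langle x,\xi\rangle}\,dx$, extended to $L^2$ by continuity. For a nonnegative integer $s$, $H^s(\mathbb R^2)$ is the Sobolev space with inner product $\langle f,g\rangle_{H^s}=\sum_{|a|\le s}\langle D^af,D^ag\rangle_{L^2}$ (weak derivatives). A family $(e_i)$ in a Hilbert space $\mathcal H$ is a frame if there are $0<A\le B<\infty$ with $A\|f\|^2\le\sum_i|\langle e_i,f\rangle|^2\le B\|f\|^2$ for all $f\in\mathcal H$. Put $A_j=\mathrm{diag}(2^j,2^{j/2})$, $\tilde A_j=\mathrm{diag}(2^{j/2},2^j)$, $S_k=\begin{pmatrix}1&k\\0&1\end{pmatrix}$, and let $$\Lambda=\{(j,k,m,\iota): \iota\in\{-1,0,1\},\ |\iota|j=j\ge 0,\ |k|\le|\iota|\lceil 2^{j/2}\rceil,\ m\in\mathbb Z^2\},$$ where $j,k$ are integers. For $\phi,\psi,\tilde\psi\in L^2(\mathbb R^2)$ and $c=(c_1,c_2)$ with $c_1,c_2>0$, the shearlet system $\mathcal{SH}(\phi,\psi,\tilde\psi,c)=(\psi_{j,k,m,\iota})_{(j,k,m,\iota)\in\Lambda}$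 consists of $$\psi_{j,k,m,0}=\phi(\cdot-c_1m),\quad \psi_{j,k,m,1}=2^{3j/4}\psi(S_kA_j\,\cdot-\mathrm{diag}(c_1,c_2)m),\quad \psi_{j,k,m,-1}=2^{3j/4}\tilde\psi(S_k^T\tilde A_j\,\cdot-\mathrm{diag}(c_2,c_1)m).$$ **Theorem.** Let $s\ge 0$ be an integer and let $\alpha_{\mathrm{sh}},\beta_{\mathrm{sh}}$ be real numbers with $\alpha_{\mathrm{sh}}-s>\beta_{\mathrm{sh}}>4$. Let $\phi^1,\psi^1\in L^2(\mathbb R)$ have weak derivatives in $L^2(\mathbb R)$ up to order $2s$, and suppose that there is a constant $C$ such that for all $0\le r\le 2s$ and almost every $\xi\in\mathbb R$, $$|\widehat{D^r\phi^1}(\xi)|\le C\min\{1,|\xi|^{-\beta_{\mathrm{sh}}}\},\qquad |\widehat{D^r\psi^1}(\xi)|\le C\min\{1,|\xi|^{\alpha_{\mathrm{sh}}}\}\min\{1,|\xi|^{-\beta_{\mathrm{sh}}}\}.$$ Let $\phi(x)=\phi^1(x_1)\phi^1(x_2)$, $\psi(x)=\psi^1(x_1)\phi^1(x_2)$, $\tilde\psi(x_1,x_2)=\psi(x_2,x_1)$,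 and let $\mu,\theta,\tilde\theta\in L^2(\mathbb R^2)$ be given by $$\widehat\mu=\widehat\phi,\qquad \widehat\theta(\xi)=\xi_1^s\,\widehat\psi(\xi),\qquad \widehat{\tilde\theta}(\xi)=\xi_2^s\,\widehat{\tilde\psi}(\xi).$$ Assume that there are $\bar c>0$ and $A>0$ such that for all $0<c_1,c_2\le\bar c$ the system $\mathcal{SH}(\mu,\theta,\tilde\theta,(c_1,c_2))$ is a frame for $L^2(\mathbb R^2)$ with lower frame bound $A$. Then there exists $\tilde c>0$ such that for every $0<c_0\le\tilde c$ the system $(\psi_{j,k,m,\iota})_{(j,k,m,\iota)\in\Lambda}=\mathcal{SH}(\phi,\psi,\tilde\psi,(c_0,c_0))$ lies in $H^s(\mathbb R^2)$ and $(2^{-js}\psi_{j,k,m,\iota})_{(j,k,m,\iota)\in\Lambda}$ is a frame for $H^s(\mathbb R^2)$; that is, there are $0<A'\le B'<\infty$ (which may depend on $c_0$) such that for all $f\in H^s(\mathbb R^2)$ $$A'\|f\|_{H^s}^2\le\sum_{(j,k,m,\iota)\in\Lambda}|\langle f,2^{-js}\psi_{j,k,m,\iota}\rangle_{H^s}|^2\le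 B'\|f\|_{H^s}^2.$$ -/

import Mathlib

open MeasureTheory FourierTransform LineDeriv
open scoped SchwartzMap ENNReal

namespace Shearlet

/-- The Euclidean plane `ℝ²`. -/
abbrev Plane : Type := EuclideanSpace ℝ (Fin 2)

/-- The Hilbert space `L²(ℝ)` of complex-valued functions. -/
abbrev L2Line : Type := Lp ℂ 2 (volume : Measure ℝ)

/-- The Hilbert space `L²(ℝ²)` of complex-valued functions. -/
abbrev L2Plane : Type := Lp ℂ 2 (volume : Measure Plane)

section Frames

variable {ι E : Type*} [NormedAddCommGroup E] [InnerProductSpace ℂ E]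

/-- `A ‖f‖² ≤ ∑ᵢ |⟨eᵢ, f⟩|² ≤ B ‖f‖²` for all `f`. The sum is taken in `[0, ∞]`, so that it is
meaningful without any summability assumption. -/
def HasFrameBounds (A B : ℝ) (e : ι → E) : Prop :=
  ∀ f : E,
    ENNReal.ofReal (A * ‖f‖ ^ 2) ≤ ∑' i, ENNReal.ofReal (‖inner ℂ (e i) f‖ ^ 2) ∧
    ∑' i, ENNReal.ofReal (‖inner ℂ (e i) f‖ ^ 2) ≤ ENNReal.ofReal (B * ‖f‖ ^ 2)

/-- The family `e` is a frame for the inner product space `E`. -/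
def IsFrame (e : ι → E) : Prop :=
  ∃ A B : ℝ, 0 < A ∧ A ≤ B ∧ HasFrameBounds A B e

end Frames

section WeakDerivatives

/-- `g = D^r f` on the line: the `r`-th distributional derivative of `f` is the function `g`. -/
def IsWeakDerivLine (r : ℕ) (f g : L2Line) : Prop :=
  (fun T : 𝓢'(ℝ, ℂ) => ∂_{(1 : ℝ)} T)^[r] (f : 𝓢'(ℝ, ℂ)) = (g : 𝓢'(ℝ, ℂ))

/-- `g = ∂₁^{a₁} ∂₂^{a₂} f` in the sense of distributions on the plane. -/
def IsWeakDerivPlane (a₁ a₂ : ℕ) (f g : L2Plane) : Prop :=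
  (fun T : 𝓢'(Plane, ℂ) => ∂_{(EuclideanSpace.single 0 1 : Plane)} T)^[a₁]
    ((fun T : 𝓢'(Plane, ℂ) => ∂_{(EuclideanSpace.single 1 1 : Plane)} T)^[a₂]
      (f : 𝓢'(Plane, ℂ))) = (g : 𝓢'(Plane, ℂ))

theorem iterate_lineDeriv_add {E : Type*} [NormedAddCommGroup E] [NormedSpace ℝ E] (v : E) (n : ℕ)
    (S T : 𝓢'(E, ℂ)) :
    (fun T : 𝓢'(E, ℂ) => ∂_{v} T)^[n] (S + T) =
      (fun T : 𝓢'(E, ℂ) => ∂_{v} T)^[n] S + (fun T : 𝓢'(E, ℂ) => ∂_{v} T)^[n] T := by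
  induction n generalizing S T with
  | zero => rfl
  | succ n ih =>
    simp only [Function.iterate_succ_apply]
    rw [lineDerivOp_add, ih]

theorem iterate_lineDeriv_smul {E : Type*} [NormedAddCommGroup E] [NormedSpace ℝ E] (v : E) (n : ℕ)
    (c : ℂ) (T : 𝓢'(E, ℂ)) :
    (fun T : 𝓢'(E, ℂ) => ∂_{v} T)^[n] (c • T) =
      c • (fun T : 𝓢'(E, ℂ) => ∂_{v} T)^[n] T := by
  induction n generalizing T with
  | zero => rfl
  | succ n ih =>
    simp only [Function.iterate_succ_apply]
    rw [lineDerivOp_smul, ih]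

theorem IsWeakDerivPlane.add {a₁ a₂ : ℕ} {f g f' g' : L2Plane} (h : IsWeakDerivPlane a₁ a₂ f g)
    (h' : IsWeakDerivPlane a₁ a₂ f' g') : IsWeakDerivPlane a₁ a₂ (f + f') (g + g') := by
  unfold IsWeakDerivPlane at *
  have key : ∀ u v : L2Plane, Lp.toTemperedDistribution (u + v) =
      (u : 𝓢'(Plane, ℂ)) + (v : 𝓢'(Plane, ℂ)) :=
    fun u v => map_add (Lp.toTemperedDistributionCLM ℂ (volume : Measure Plane) 2) u v
  rw [key, key, iterate_lineDeriv_add, iterate_lineDeriv_add, h, h']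

theorem IsWeakDerivPlane.smul {a₁ a₂ : ℕ} {f g : L2Plane} (c : ℂ) (h : IsWeakDerivPlane a₁ a₂ f g) :
    IsWeakDerivPlane a₁ a₂ (c • f) (c • g) := by
  unfold IsWeakDerivPlane at *
  have key : ∀ u : L2Plane, Lp.toTemperedDistribution (c • u) = c • (u : 𝓢'(Plane, ℂ)) :=
    fun u => map_smul (Lp.toTemperedDistributionCLM ℂ (volume : Measure Plane) 2) c u
  rw [key, key, iterate_lineDeriv_smul, iterate_lineDeriv_smul, h]

end WeakDerivatives

section Sobolev

/-- The multi-indices `a = (a₁, a₂)` with `|a| = a₁ + a₂ ≤ s`. -/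
abbrev MultiIndex (s : ℕ) : Type :=
  {a : Fin (s + 1) × Fin (s + 1) // (a.1 : ℕ) + (a.2 : ℕ) ≤ s}

/-- The multi-index `(0, 0)`. -/
def MultiIndex.origin (s : ℕ) : MultiIndex s := ⟨(0, 0), by simp⟩

/-- The Sobolev space `H^s(ℝ²)`, `s` a nonnegative integer. A function `f ∈ L²(ℝ²)` all of whose
weak derivatives `D^a f`, `|a| ≤ s`, lie in `L²(ℝ²)` is represented by the (unique) tuple
`(D^a f)_{|a| ≤ s}`, an element of the Hilbert sum of copies of `L²(ℝ²)`. The inherited inner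
product is the usual one, `⟨f, g⟩_{H^s} = ∑_{|a| ≤ s} ⟨D^a f, D^a g⟩_{L²}`. -/
noncomputable def SobolevSpace (s : ℕ) : Submodule ℂ (PiLp 2 fun _ : MultiIndex s => L2Plane) where
  carrier := {F | ∀ a : MultiIndex s,
    IsWeakDerivPlane a.1.1 a.1.2 (F (MultiIndex.origin s)) (F a)}
  zero_mem' := by
    intro a
    have h := IsWeakDerivPlane.smul (a₁ := 0) (a₂ := 0) (f := 0) (g := 0) 0 rfl
    have key : (Lp.toTemperedDistribution (0 : L2Plane) : 𝓢'(Plane, ℂ)) = 0 :=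
      map_zero (Lp.toTemperedDistributionCLM ℂ (volume : Measure Plane) 2)
    have z : ∀ (v : Plane) (n : ℕ), (fun T : 𝓢'(Plane, ℂ) => ∂_{v} T)^[n] 0 = 0 := by
      intro v n
      exact Function.iterate_fixed (lineDerivOp_zero v) n
    change IsWeakDerivPlane _ _ (0 : L2Plane) (0 : L2Plane)
    unfold IsWeakDerivPlane
    rw [key, z, z]
  add_mem' := fun hF hG a => (hF a).add (hG a)
  smul_mem' := fun c _ hF a => (hF a).smul c

/-- The function `f ∈ L²(ℝ²)` underlying an element of `H^s(ℝ²)`. -/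
noncomputable def SobolevSpace.toL2 {s : ℕ} (F : SobolevSpace s) : L2Plane :=
  (F : PiLp 2 fun _ : MultiIndex s => L2Plane) (MultiIndex.origin s)

end Sobolev

section Composition

/-- The map `x ↦ M x - b` of the plane. -/
noncomputable def affineMap (M : Matrix (Fin 2) (Fin 2) ℝ) (b : Plane) (x : Plane) : Plane :=
  Matrix.toEuclideanLin M x - b

theorem memLp_comp_affineMap (M : Matrix (Fin 2) (Fin 2) ℝ) (hM : M.det ≠ 0) (b : Plane)
    (f : L2Plane) : MemLp (fun x => f (affineMap M b x)) 2 (volume : Measure Plane) := by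
  have hdet : LinearMap.det (Matrix.toEuclideanLin M) ≠ 0 := by
    simpa using hM
  have h1 : MemLp (fun y => f (y - b)) 2 (volume : Measure Plane) :=
    (Lp.memLp f).comp_measurePreserving (measurePreserving_sub_right volume b)
  have hmap : Measure.map (Matrix.toEuclideanLin M) (volume : Measure Plane) =
      ENNReal.ofReal |(LinearMap.det (Matrix.toEuclideanLin M))⁻¹| • volume :=
    Measure.map_linearMap_addHaar_eq_smul_addHaar _ hdet
  have h2 : MemLp (fun y => f (y - b)) 2 (Measure.map (Matrix.toEuclideanLin M) volume) := by
    rw [hmap]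
    exact h1.smul_measure ENNReal.ofReal_ne_top
  have hc : Continuous (Matrix.toEuclideanLin M) := LinearMap.continuous_of_finiteDimensional _
  exact (memLp_map_measure_iff h2.1 hc.aemeasurable).1 h2

/-- The element `x ↦ f (M x - b)` of `L²(ℝ²)`, for an invertible matrix `M`. -/
noncomputable def affineComp (M : Matrix (Fin 2) (Fin 2) ℝ) (hM : M.det ≠ 0) (b : Plane)
    (f : L2Plane) : L2Plane :=
  (memLp_comp_affineMap M hM b f).toLp _

/-- The function `x ↦ f (x₂, x₁)`. -/
noncomputable def swap (f : L2Plane) : L2Plane :=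
  affineComp !![0, 1; 1, 0] (by simp [Matrix.det_fin_two]) 0 f

theorem memLp_tensor (f g : L2Line) :
    MemLp (fun x : Plane => f (x 0) * g (x 1)) 2 (volume : Measure Plane) := by
  have hprod : MemLp (fun p : ℝ × ℝ => f p.1 * g p.2) 2
      ((volume : Measure ℝ).prod (volume : Measure ℝ)) := by
    have hm : AEStronglyMeasurable (fun p : ℝ × ℝ => f p.1 * g p.2)
        ((volume : Measure ℝ).prod (volume : Measure ℝ)) :=
      (Lp.aestronglyMeasurable f).comp_fst.mul (Lp.aestronglyMeasurable g).comp_snd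
    rw [memLp_two_iff_integrable_sq_norm hm]
    have hf := (memLp_two_iff_integrable_sq_norm (Lp.aestronglyMeasurable f)).1 (Lp.memLp f)
    have hg := (memLp_two_iff_integrable_sq_norm (Lp.aestronglyMeasurable g)).1 (Lp.memLp g)
    simpa [mul_pow] using hf.mul_prod hg
  have mp : MeasurePreserving (fun x : Plane => (x 0, x 1)) volume
      ((volume : Measure ℝ).prod (volume : Measure ℝ)) :=
    (volume_preserving_finTwoArrow ℝ).comp (PiLp.volume_preserving_ofLp (Fin 2))
  exact hprod.comp_measurePreserving mp

/-- The tensor product `(f ⊗ g)(x) = f(x₁) g(x₂)`. -/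
noncomputable def tensor (f g : L2Line) : L2Plane :=
  (memLp_tensor f g).toLp _

end Composition

section System

/-- `A_j = diag(2^j, 2^{j/2})`. -/
noncomputable def scaling (j : ℕ) : Matrix (Fin 2) (Fin 2) ℝ :=
  !![(2 : ℝ) ^ j, 0; 0, (2 : ℝ) ^ ((j : ℝ) / 2)]

/-- `Ã_j = diag(2^{j/2}, 2^j)`. -/
noncomputable def scaling' (j : ℕ) : Matrix (Fin 2) (Fin 2) ℝ :=
  !![(2 : ℝ) ^ ((j : ℝ) / 2), 0; 0, (2 : ℝ) ^ j]

/-- The shear matrix `S_k`. -/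
def shear (k : ℤ) : Matrix (Fin 2) (Fin 2) ℝ := !![1, (k : ℝ); 0, 1]

theorem det_shear_mul_scaling (k : ℤ) (j : ℕ) : (shear k * scaling j).det ≠ 0 := by
  have h : (2 : ℝ) ^ ((j : ℝ) / 2) ≠ 0 := (Real.rpow_pos_of_pos two_pos _).ne'
  simp [shear, scaling, Matrix.det_fin_two, h]

theorem det_shear_transpose_mul_scaling' (k : ℤ) (j : ℕ) :
    ((shear k).transpose * scaling' j).det ≠ 0 := by
  have h : (2 : ℝ) ^ ((j : ℝ) / 2) ≠ 0 := (Real.rpow_pos_of_pos two_pos _).ne'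
  simp [shear, scaling', Matrix.det_fin_two, h]

/-- The point `diag(a, b) m` of the plane, for `m ∈ ℤ²`. -/
noncomputable def latticePoint (a b : ℝ) (m : ℤ × ℤ) : Plane := !₂[a * (m.1 : ℝ), b * (m.2 : ℝ)]

/-- The index set `Λ` of all `(j, k, m, ι)` with `ι ∈ {-1, 0, 1}`, `|ι| j = j ≥ 0`,
`|k| ≤ |ι| ⌈2^{j/2}⌉` and `m ∈ ℤ²`. -/
structure Index where
  j : ℕ
  k : ℤ
  m : ℤ × ℤ
  ι : SignType
  abs_mul_j : |(ι : ℤ)| * (j : ℤ) = j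
  abs_k_le : |k| ≤ |(ι : ℤ)| * ⌈(2 : ℝ) ^ ((j : ℝ) / 2)⌉

/-- The cone-adapted shearlet system `(ψ_{j,k,m,ι})_{(j,k,m,ι) ∈ Λ}` with generators `φ, ψ, ψ'`
and sampling constants `c₁, c₂`. -/
noncomputable def system (φ ψ ψ' : L2Plane) (c₁ c₂ : ℝ) (l : Index) : L2Plane :=
  match l.ι with
  | SignType.zero => affineComp 1 (by simp) (latticePoint c₁ c₁ l.m) φ
  | SignType.pos =>
      (((2 : ℝ) ^ (3 * (l.j : ℝ) / 4) : ℝ) : ℂ) •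
        affineComp (shear l.k * scaling l.j) (det_shear_mul_scaling l.k l.j)
          (latticePoint c₁ c₂ l.m) ψ
  | SignType.neg =>
      (((2 : ℝ) ^ (3 * (l.j : ℝ) / 4) : ℝ) : ℂ) •
        affineComp ((shear l.k).transpose * scaling' l.j) (det_shear_transpose_mul_scaling' l.k l.j)
          (latticePoint c₂ c₁ l.m) ψ'

end System

end Shearlet

/-! By Plancherel, `f ↦ G = √w · f̂`, where `w` is the Fourier weight `sobolevWeight` of the `H^s`
norm, is an isometry from `H^s` into `L²`. Let `b = (j, k, ι)` be a generator with matrix `M`, and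
let `F_ι` be the Fourier transform of the corresponding `φ`, `ψ` or `ψ'`. The coefficients of `f`
against its rescaled translates are Fourier coefficients of `|det M|^{-1/2} q_b G`, where `q_b(ξ) =
2^{-js} √w(ξ) conj (F_ι(M⁻ᵀξ))` is `sobolevProfile`. Periodization and Parseval on the torus show
that their square sum over `m` is `c⁻² ∫ |q_b|² |G|²`, up to the overlap of `q_b G` with its
translates by nonzero vectors of `Mᵀ c⁻¹ ℤ²` (`lattice_parseval_sandwich`).

The overlap is bounded independently of `c`. The profiles satisfy `|q_b| ≤ C · majorant · planeBump`
at `M⁻ᵀξ`. Peetre's inequality replaces a product of two translated bumps by a bump at `c⁻¹k`, and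
summing over `k ≠ 0` gains `c²`, which cancels the density `c⁻²` (`overlap_le`). One factor
`majorant` survives, and its vanishing moments make it summable over all scales and shears
(`tsum_majorant_le`). Hence the full coefficient sum differs from `c⁻² ∫ (∑_b |q_b|²) |G|²` by at
most `E ‖f‖²` (`tsum_generatorSum_bounds`). The upper frame bound follows; the lower one follows for
small `c` once `∑_b |q_b|² ≥ L > 0` almost everywhere.

This last bound comes from the auxiliary frame. If `f̂` is the indicator of a subset of a small
ball, all overlaps vanish, and the lower frame inequality localizes to a lower bound on the Calderón
sum of `μ, θ, θ'` (`calderon_lower_bound`). Since `(2^{-j}|ξ_i|)^s ≤ 2^{-js} √w(ξ)`, that sum is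
dominated by `∑_b |q_b|²`. In the other direction, `|ξ_i| ≤ 2 · 2^j (|η₁| + |η₂|)` for `η = M⁻ᵀξ`,
so the factor `2^{-js} √w` costs only `s` powers of `(1 + |η₁|)(1 + |η₂|)`, absorbed by the decay of
the `s`-th derivatives of the generators (`exists_line_symbol`). -/

namespace Shearlet

/-! ### Fourier transform on `L²` and on tempered distributions -/

section Fourier

variable {E : Type*} [NormedAddCommGroup E] [InnerProductSpace ℝ E] [FiniteDimensional ℝ E]
  [MeasurableSpace E] [BorelSpace E]

theorem ae_eq_of_forall_integral_schwartz_smul_eq {f g : E → ℂ} (hf : LocallyIntegrable f volume)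
    (hg : LocallyIntegrable g volume)
    (h : ∀ S : 𝓢(E, ℂ), ∫ x, S x • f x = ∫ x, S x • g x) : f =ᵐ[volume] g := by
  refine ae_eq_of_integral_contDiff_smul_eq hf hg fun u u_smooth u_cpt => ?_
  have h₁ : HasCompactSupport (Complex.ofRealCLM ∘ u) := u_cpt.comp_left rfl
  have h₂ : ContDiff ℝ (⊤ : ℕ∞) (Complex.ofRealCLM ∘ u) := by fun_prop
  simpa using h (h₁.toSchwartzMap h₂)

/-- Passes from an identity between distributions to an almost everywhere identity between `L²`
functions; this is how weak derivatives become Fourier multipliers. -/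
theorem smulLeftCLM_toTemperedDistribution_eq_iff {m : E → ℂ} (hm : m.HasTemperateGrowth)
    (f g : Lp ℂ 2 (volume : Measure E)) :
    TemperedDistribution.smulLeftCLM ℂ m (f : 𝓢'(E, ℂ)) = (g : 𝓢'(E, ℂ)) ↔
      g =ᵐ[volume] fun x => m x * f x := by
  constructor
  · intro h
    refine ae_eq_of_forall_integral_schwartz_smul_eq
      ((Lp.memLp g).locallyIntegrable (by norm_num)) ?_ fun S => ?_
    · have := ((Lp.memLp f).locallyIntegrable (by norm_num)).continuous_smul hm.1.continuous
      simpa [smul_eq_mul] using this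
    · have h' := congrArg (fun T : 𝓢'(E, ℂ) => T S) h
      simp only [TemperedDistribution.smulLeftCLM_apply_apply,
        Lp.toTemperedDistribution_apply] at h'
      rw [← h']
      refine integral_congr_ae (ae_of_all _ fun x => ?_)
      simp [hm]
      ring
  · intro h
    ext S
    simp only [TemperedDistribution.smulLeftCLM_apply_apply, Lp.toTemperedDistribution_apply]
    refine integral_congr_ae ?_
    filter_upwards [h] with x hx
    rw [hx]
    simp [hm]
    ring

theorem fourier_iterate_lineDeriv (v : E) (n : ℕ) (T : 𝓢'(E, ℂ)) :
    𝓕 ((fun T : 𝓢'(E, ℂ) => ∂_{v} T)^[n] T) =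
      TemperedDistribution.smulLeftCLM ℂ
        (fun ξ : E => (2 * Real.pi * Complex.I * (inner ℝ ξ v : ℝ)) ^ n) (𝓕 T) := by
  have hlin : (fun ξ : E => ((inner ℝ ξ v : ℝ) : ℂ)).HasTemperateGrowth := by fun_prop
  have hlin' : (fun ξ : E => 2 * Real.pi * Complex.I * ((inner ℝ ξ v : ℝ) : ℂ)).HasTemperateGrowth := by
    fun_prop
  induction n with
  | zero => simp
  | succ n ih =>
    rw [Function.iterate_succ_apply', TemperedDistribution.fourier_lineDerivOp_eq, ih]
    have h2 : (fun ξ : E => (2 * Real.pi * Complex.I * ((inner ℝ ξ v : ℝ) : ℂ)) ^ n).HasTemperateGrowth := by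
      fun_prop
    rw [TemperedDistribution.smulLeftCLM_smulLeftCLM_apply h2 hlin]
    rw [← smul_apply, ← TemperedDistribution.smulLeftCLM_smul (h2.mul hlin)]
    congr 2
    ext ξ
    simp
    ring

/-- The `L²` transform is only an extension by continuity, so it is compared with the integral by
testing: in both cases the inverse transform can be moved onto the Schwartz function. -/
theorem fourierInv_toLp_ae_eq {F : E → ℂ} (h1 : Integrable F volume) (h2 : MemLp F 2 volume) :
    (𝓕⁻ (h2.toLp F) : Lp ℂ 2 (volume : Measure E)) =ᵐ[volume] 𝓕⁻ F := by
  refine ae_eq_of_forall_integral_schwartz_smul_eq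
    ((Lp.memLp _).locallyIntegrable (by norm_num)) ?_ fun S => ?_
  · refine Continuous.locallyIntegrable ?_
    rw [Real.fourierInv_eq_fourier_comp_neg]
    exact VectorFourier.fourierIntegral_continuous Real.continuous_fourierChar
      (by exact (innerSL ℝ).continuous₂) h1.comp_neg
  · rw [← Lp.toTemperedDistribution_apply, ← Lp.fourierInv_toTemperedDistribution_eq,
      TemperedDistribution.fourierInv_apply, Lp.toTemperedDistribution_apply]
    have e1 : ∫ x, (𝓕⁻ S) x • (h2.toLp F) x = ∫ x, (𝓕⁻ S) x • F x := by
      refine integral_congr_ae ?_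
      filter_upwards [h2.coeFn_toLp] with x hx
      rw [hx]
    rw [e1]
    have key := VectorFourier.integral_fourierIntegral_smul_eq_flip (μ := volume) (ν := volume)
      (L := -innerₗ E) (f := S) (g := F) Real.continuous_fourierChar
      (by exact (innerSL ℝ).continuous₂.neg) S.integrable h1
    have flip_eq : (-innerₗ E).flip = -innerₗ E := by
      ext x y
      simp [real_inner_comm]
    rw [flip_eq] at key
    rw [SchwartzMap.fourierInv_coe]
    exact key

end Fourier

/-! ### Weak derivatives as Fourier multipliers -/

section WeakDerivatives

theorem isWeakDerivLine_iff (r : ℕ) (f g : L2Line) :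
    IsWeakDerivLine r f g ↔ (𝓕 g : L2Line) =ᵐ[volume]
      fun ξ : ℝ => (2 * Real.pi * Complex.I * (ξ : ℂ)) ^ r * (𝓕 f : L2Line) ξ := by
  have hm : (fun ξ : ℝ => (2 * Real.pi * Complex.I * (inner ℝ ξ (1 : ℝ) : ℝ)) ^ r).HasTemperateGrowth := by
    have : (fun ξ : ℝ => 2 * Real.pi * Complex.I * ((inner ℝ ξ (1 : ℝ) : ℝ) : ℂ)).HasTemperateGrowth := by
      fun_prop
    fun_prop
  have := smulLeftCLM_toTemperedDistribution_eq_iff hm (𝓕 f : L2Line) (𝓕 g)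
  simp only [← Lp.fourier_toTemperedDistribution_eq, ← fourier_iterate_lineDeriv] at this
  simp only [RCLike.inner_apply', conj_trivial, mul_one] at this
  rw [← this, IsWeakDerivLine]
  exact (FourierTransform.fourierEquiv ℂ 𝓢'(ℝ, ℂ)).injective.eq_iff.symm

/-- The Fourier symbol `(2πiξ₁)^{a₁} (2πiξ₂)^{a₂}` of `∂₁^{a₁} ∂₂^{a₂}`. -/
noncomputable def derivSymbol (a₁ a₂ : ℕ) (ξ : Plane) : ℂ :=
  (2 * Real.pi * Complex.I * (ξ 0 : ℝ)) ^ a₁ * (2 * Real.pi * Complex.I * (ξ 1 : ℝ)) ^ a₂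

theorem isWeakDerivPlane_iff (a₁ a₂ : ℕ) (f g : L2Plane) :
    IsWeakDerivPlane a₁ a₂ f g ↔ (𝓕 g : L2Plane) =ᵐ[volume]
      fun ξ => derivSymbol a₁ a₂ ξ * (𝓕 f : L2Plane) ξ := by
  have hm : ∀ (v : Plane) (r : ℕ),
      (fun ξ : Plane => (2 * Real.pi * Complex.I * (inner ℝ ξ v : ℝ)) ^ r).HasTemperateGrowth := by
    intro v r
    have : (fun ξ : Plane => 2 * Real.pi * Complex.I * ((inner ℝ ξ v : ℝ) : ℂ)).HasTemperateGrowth := by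
      fun_prop
    fun_prop
  have := smulLeftCLM_toTemperedDistribution_eq_iff
    ((hm (EuclideanSpace.single 1 1) a₂).mul (hm (EuclideanSpace.single 0 1) a₁))
    (𝓕 f : L2Plane) (𝓕 g)
  rw [← TemperedDistribution.smulLeftCLM_smulLeftCLM_apply (hm _ _) (hm _ _)] at this
  simp only [← Lp.fourier_toTemperedDistribution_eq, ← fourier_iterate_lineDeriv] at this
  have e : ∀ ξ : Plane, derivSymbol a₁ a₂ ξ = ((fun ξ : Plane => (2 * Real.pi * Complex.I *
      (inner ℝ ξ (EuclideanSpace.single 1 1) : ℝ)) ^ a₂) * (fun ξ : Plane => (2 * Real.pi *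
      Complex.I * (inner ℝ ξ (EuclideanSpace.single 0 1) : ℝ)) ^ a₁)) ξ := by
    intro ξ
    simp [derivSymbol, EuclideanSpace.inner_single_right, mul_comm]
  simp only [e]
  rw [← this, IsWeakDerivPlane]
  exact (FourierTransform.fourierEquiv ℂ 𝓢'(Plane, ℂ)).injective.eq_iff.symm

end WeakDerivatives

/-! ### Product structure and linear changes of variables in the plane -/

section PlaneMeasure

/-- The plane as a product of two lines. -/
noncomputable def planeProd : Plane ≃ᵐ ℝ × ℝ :=
  (MeasurableEquiv.toLp 2 (Fin 2 → ℝ)).symm.trans MeasurableEquiv.finTwoArrow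

theorem measurePreserving_planeProd :
    MeasurePreserving planeProd volume ((volume : Measure ℝ).prod (volume : Measure ℝ)) :=
  (volume_preserving_finTwoArrow ℝ).comp (PiLp.volume_preserving_ofLp (Fin 2))

theorem quasiMeasurePreserving_coord (i : Fin 2) :
    Measure.QuasiMeasurePreserving (fun x : Plane => x i) volume volume := by
  fin_cases i
  · exact Measure.quasiMeasurePreserving_fst.comp measurePreserving_planeProd.quasiMeasurePreserving
  · exact Measure.quasiMeasurePreserving_snd.comp measurePreserving_planeProd.quasiMeasurePreserving

theorem integral_plane_mul (u v : ℝ → ℂ) :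
    ∫ x : Plane, u (x 0) * v (x 1) = (∫ t, u t) * ∫ t, v t := by
  rw [← integral_prod_mul]
  exact measurePreserving_planeProd.integral_comp planeProd.measurableEmbedding
    (fun p : ℝ × ℝ => u p.1 * v p.2)

theorem integrable_plane_mul {u v : ℝ → ℂ} (hu : Integrable u) (hv : Integrable v) :
    Integrable (fun x : Plane => u (x 0) * v (x 1)) :=
  (measurePreserving_planeProd.integrable_comp_emb planeProd.measurableEmbedding).2
    (hu.mul_prod hv)

theorem inner_plane (x y : Plane) : inner ℝ x y = x 0 * y 0 + x 1 * y 1 := by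
  simp [PiLp.inner_apply, Fin.sum_univ_two, mul_comm]

theorem toEuclideanLin_apply_zero (M : Matrix (Fin 2) (Fin 2) ℝ) (x : Plane) :
    (Matrix.toEuclideanLin M x) 0 = M 0 0 * x 0 + M 0 1 * x 1 := by
  simp [Matrix.toLpLin_apply]

theorem toEuclideanLin_apply_one (M : Matrix (Fin 2) (Fin 2) ℝ) (x : Plane) :
    (Matrix.toEuclideanLin M x) 1 = M 1 0 * x 0 + M 1 1 * x 1 := by
  simp [Matrix.toLpLin_apply]

theorem toEuclideanLin_mul_apply (M N : Matrix (Fin 2) (Fin 2) ℝ) (x : Plane) :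
    Matrix.toEuclideanLin (M * N) x = Matrix.toEuclideanLin M (Matrix.toEuclideanLin N x) := by
  simp [Matrix.toLpLin_apply]

theorem inner_toEuclideanLin (M : Matrix (Fin 2) (Fin 2) ℝ) (x y : Plane) :
    inner ℝ x (Matrix.toEuclideanLin M y) = inner ℝ (Matrix.toEuclideanLin M.transpose x) y := by
  simp only [inner_plane, toEuclideanLin_apply_zero, toEuclideanLin_apply_one,
    Matrix.transpose_apply]
  ring

variable {M : Matrix (Fin 2) (Fin 2) ℝ}

theorem toEuclideanLin_cancel_inv (hM : M.det ≠ 0) (x : Plane) :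
    Matrix.toEuclideanLin M⁻¹ (Matrix.toEuclideanLin M x) = x := by
  rw [← toEuclideanLin_mul_apply, Matrix.nonsing_inv_mul _ hM.isUnit]
  simp

theorem continuous_toEuclideanLin (M : Matrix (Fin 2) (Fin 2) ℝ) :
    Continuous (Matrix.toEuclideanLin M) :=
  LinearMap.continuous_of_finiteDimensional _

theorem measurableEmbedding_toEuclideanLin (hM : M.det ≠ 0) :
    MeasurableEmbedding (Matrix.toEuclideanLin M) :=
  (continuous_toEuclideanLin M).measurableEmbedding
    (Function.LeftInverse.injective (toEuclideanLin_cancel_inv hM))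

theorem map_toEuclideanLin_volume (hM : M.det ≠ 0) :
    Measure.map (Matrix.toEuclideanLin M) (volume : Measure Plane) =
      ENNReal.ofReal |M.det|⁻¹ • volume := by
  have hdet : LinearMap.det (Matrix.toEuclideanLin M) = M.det := by
    simp
  rw [← abs_inv, ← hdet]
  exact Measure.map_linearMap_addHaar_eq_smul_addHaar _ (hdet ▸ hM)

theorem quasiMeasurePreserving_toEuclideanLin (hM : M.det ≠ 0) :
    Measure.QuasiMeasurePreserving (Matrix.toEuclideanLin M) (volume : Measure Plane) volume := by
  refine ⟨(continuous_toEuclideanLin M).measurable, ?_⟩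
  rw [map_toEuclideanLin_volume hM]
  exact Measure.smul_absolutelyContinuous

theorem integral_comp_toEuclideanLin (hM : M.det ≠ 0) (g : Plane → ℂ) :
    ∫ x, g (Matrix.toEuclideanLin M x) = |M.det|⁻¹ • ∫ x, g x := by
  rw [← (measurableEmbedding_toEuclideanLin hM).integral_map, map_toEuclideanLin_volume hM,
    integral_smul_measure, ENNReal.toReal_ofReal (by positivity)]

theorem lintegral_comp_toEuclideanLin (hM : M.det ≠ 0) (g : Plane → ℝ≥0∞) :
    ∫⁻ x, g (Matrix.toEuclideanLin M x) = ENNReal.ofReal |M.det|⁻¹ * ∫⁻ x, g x := by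
  rw [← (measurableEmbedding_toEuclideanLin hM).lintegral_map, map_toEuclideanLin_volume hM,
    lintegral_smul_measure, smul_eq_mul]

theorem integrable_comp_toEuclideanLin (hM : M.det ≠ 0) {g : Plane → ℂ} (hg : Integrable g) :
    Integrable (fun x => g (Matrix.toEuclideanLin M x)) := by
  have := (measurableEmbedding_toEuclideanLin hM).integrable_map_iff (g := g) (μ := volume)
  rw [map_toEuclideanLin_volume hM] at this
  exact this.1 (hg.smul_measure ENNReal.ofReal_ne_top)

theorem memLp_comp_toEuclideanLin (hM : M.det ≠ 0) {g : Plane → ℂ} {p : ℝ≥0∞} (hg : MemLp g p) :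
    MemLp (fun x => g (Matrix.toEuclideanLin M x)) p := by
  have := (measurableEmbedding_toEuclideanLin hM).memLp_map_measure_iff (g := g) (p := p)
    (μ := volume)
  rw [map_toEuclideanLin_volume hM] at this
  exact this.1 (hg.smul_measure ENNReal.ofReal_ne_top)

end PlaneMeasure

/-! ### Fourier transforms of tensor products and affine compositions -/

section FourierOfGenerators

theorem ae_eq_fourierInv {E : Type*} [NormedAddCommGroup E] [InnerProductSpace ℝ E]
    [FiniteDimensional ℝ E] [MeasurableSpace E] [BorelSpace E]
    {f : Lp ℂ 2 (volume : Measure E)} {F : E → ℂ} (hF : Integrable F)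
    (hf : (𝓕 f : Lp ℂ 2 (volume : Measure E)) =ᵐ[volume] F) : f =ᵐ[volume] 𝓕⁻ F := by
  have h2 : MemLp F 2 volume := (memLp_congr_ae hf).1 (Lp.memLp _)
  have e : h2.toLp F = (𝓕 f : Lp ℂ 2 (volume : Measure E)) := by
    rw [← Lp.toLp_coeFn (𝓕 f : Lp ℂ 2 (volume : Measure E)) (Lp.memLp _)]
    exact (MemLp.toLp_eq_toLp_iff _ _).2 hf.symm
  have := fourierInv_toLp_ae_eq hF h2
  rwa [e, FourierTransform.fourierInv_fourier_eq] at this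

theorem fourier_ae_eq {E : Type*} [NormedAddCommGroup E] [InnerProductSpace ℝ E]
    [FiniteDimensional ℝ E] [MeasurableSpace E] [BorelSpace E]
    {f : Lp ℂ 2 (volume : Measure E)} {F : E → ℂ} (hF : Integrable F) (h2 : MemLp F 2 volume)
    (hf : f =ᵐ[volume] 𝓕⁻ F) : (𝓕 f : Lp ℂ 2 (volume : Measure E)) =ᵐ[volume] F := by
  have e : f = 𝓕⁻ (h2.toLp F) := Lp.ext (hf.trans (fourierInv_toLp_ae_eq hF h2).symm)
  rw [e, FourierTransform.fourier_fourierInv_eq]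
  exact h2.coeFn_toLp

theorem fourier_tensor {f g : L2Line} {p q : ℝ → ℂ} (hp : Integrable p) (hq : Integrable q)
    (hf : (𝓕 f : L2Line) =ᵐ[volume] p) (hg : (𝓕 g : L2Line) =ᵐ[volume] q) :
    (𝓕 (tensor f g) : L2Plane) =ᵐ[volume] fun ξ => p (ξ 0) * q (ξ 1) := by
  have h2 : MemLp (fun ξ : Plane => p (ξ 0) * q (ξ 1)) 2 volume := by
    refine (memLp_congr_ae ?_).1 (memLp_tensor (𝓕 f) (𝓕 g))
    filter_upwards [(quasiMeasurePreserving_coord 0).ae hf,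
      (quasiMeasurePreserving_coord 1).ae hg] with x hx hy
    rw [hx, hy]
  refine fourier_ae_eq (integrable_plane_mul hp hq) h2 ?_
  filter_upwards [(memLp_tensor f g).coeFn_toLp,
    (quasiMeasurePreserving_coord 0).ae (ae_eq_fourierInv hp hf),
    (quasiMeasurePreserving_coord 1).ae (ae_eq_fourierInv hq hg)] with x h hx hy
  rw [tensor, h, hx, hy, Real.fourierInv_eq, Real.fourierInv_eq, Real.fourierInv_eq,
    ← integral_plane_mul]
  refine integral_congr_ae (ae_of_all _ fun ξ => ?_)
  simp only [inner_plane, RCLike.inner_apply', conj_trivial, Circle.smul_def, smul_eq_mul,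
    AddChar.map_add_eq_mul, Circle.coe_mul]
  ring

/-- The substitution is carried out in the inverse Fourier integral of `F`, which converges
absolutely, because `f` is only an `L²` class and need not be integrable. -/
theorem fourier_affineComp {M : Matrix (Fin 2) (Fin 2) ℝ} (hM : M.det ≠ 0) (b : Plane)
    {f : L2Plane} {F : Plane → ℂ} (hF : Integrable F)
    (hf : (𝓕 f : L2Plane) =ᵐ[volume] F) :
    (𝓕 (affineComp M hM b f) : L2Plane) =ᵐ[volume] fun ξ =>
      (|M.det|⁻¹ : ℝ) * (Real.fourierChar (-inner ℝ (Matrix.toEuclideanLin (M⁻¹).transpose ξ) b) : ℂ) *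
        F (Matrix.toEuclideanLin (M⁻¹).transpose ξ) := by
  have hM' : (M⁻¹).transpose.det ≠ 0 := by
    simpa [Matrix.det_nonsing_inv] using hM
  have h2 : MemLp F 2 volume := (memLp_congr_ae hf).1 (Lp.memLp _)
  set H : Plane → ℂ := fun η => (|M.det|⁻¹ : ℝ) * (Real.fourierChar (-inner ℝ η b) : ℂ) * F η with hH
  have hc : AEStronglyMeasurable (fun η : Plane => ((|M.det|⁻¹ : ℝ) : ℂ) *
      (Real.fourierChar (-inner ℝ η b) : ℂ)) volume := by
    refine Continuous.aestronglyMeasurable ?_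
    exact continuous_const.mul (continuous_subtype_val.comp (Real.continuous_fourierChar.comp
      (by fun_prop)))
  have hb : ∀ η : Plane, ‖((|M.det|⁻¹ : ℝ) : ℂ) * (Real.fourierChar (-inner ℝ η b) : ℂ)‖ ≤
      |M.det|⁻¹ := by
    intro η
    rw [norm_mul, Circle.norm_coe]
    simp
  have H1 : Integrable H := hF.bdd_mul hc (ae_of_all _ hb)
  have H2 : MemLp H 2 volume :=
    h2.of_le_mul (hc.mul h2.1) (ae_of_all _ fun η => (norm_mul_le _ _).trans
      (mul_le_mul_of_nonneg_right (hb η) (norm_nonneg _)))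
  refine fourier_ae_eq (integrable_comp_toEuclideanLin hM' H1) (memLp_comp_toEuclideanLin hM' H2) ?_
  have hq : Measure.QuasiMeasurePreserving (affineMap M b) (volume : Measure Plane) volume :=
    (measurePreserving_sub_right volume b).quasiMeasurePreserving.comp
      (quasiMeasurePreserving_toEuclideanLin hM)
  filter_upwards [(memLp_comp_affineMap M hM b f).coeFn_toLp,
    hq.ae (ae_eq_fourierInv hF hf)] with x h hx
  rw [affineComp, h, hx, Real.fourierInv_eq, Real.fourierInv_eq]
  have key := integral_comp_toEuclideanLin hM'
    (fun η => Real.fourierChar (inner ℝ (Matrix.toEuclideanLin M.transpose η) x) • H η)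
  have canc : ∀ ξ : Plane, Matrix.toEuclideanLin M.transpose
      (Matrix.toEuclideanLin (M⁻¹).transpose ξ) = ξ := by
    intro ξ
    rw [← toEuclideanLin_mul_apply, ← Matrix.transpose_mul, Matrix.nonsing_inv_mul _ hM.isUnit]
    simp
  simp only [canc] at key
  rw [key, ← integral_smul]
  refine integral_congr_ae (ae_of_all _ fun ξ => ?_)
  have hd : ((|M.det| : ℝ) : ℂ) ≠ 0 := by simpa using hM
  have split : inner ℝ ξ (affineMap M b x) =
      inner ℝ (Matrix.toEuclideanLin M.transpose ξ) x + -inner ℝ ξ b := by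
    rw [affineMap, inner_sub_right, inner_toEuclideanLin, sub_eq_add_neg]
  simp only [split, AddChar.map_add_eq_mul, Circle.smul_def, Circle.coe_mul, hH, smul_eq_mul, Complex.real_smul,
    Matrix.det_transpose, Matrix.det_nonsing_inv, Ring.inverse_eq_inv', abs_inv, inv_inv]
  push_cast
  field_simp

end FourierOfGenerators

/-! ### Periodization over the integer lattice -/

section Periodization

/-- Expand the square and index the products by the difference `k`; the diagonal is `k = 0`. -/
theorem tsum_enorm_sq_eq {G : Type*} [AddCommGroup G] [DecidableEq G] (a : G → ℂ) :
    (∑' n, ‖a n‖ₑ) ^ 2 = ∑' n, ‖a n‖ₑ ^ 2 +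
      ∑' n, ∑' k, (if k = 0 then 0 else ‖a n‖ₑ * ‖a (n + k)‖ₑ) := by
  rw [sq, ← ENNReal.tsum_mul_right, ← ENNReal.tsum_add]
  congr 1
  ext n
  rw [← (Equiv.addLeft n).tsum_eq (fun k => ‖a k‖ₑ), ← ENNReal.tsum_mul_left,
    ENNReal.tsum_eq_add_tsum_ite 0]
  simp only [Equiv.coe_addLeft, add_zero, sq]
  congr!

/-- With `S = ∑ a n`, one has `Re (a n · conj S) = |a n|² + Re (a n · conj (S - a n))`, and `|S - a
n|` is at most the sum of the other absolute values. Summing over `n` leaves exactly the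
off-diagonal products as error. -/
theorem tsum_enorm_sq_le {G : Type*} [AddCommGroup G] [DecidableEq G] {a : G → ℂ} (ha : Summable fun n => ‖a n‖) :
    ∑' n, ‖a n‖ₑ ^ 2 ≤ ‖∑' n, a n‖ₑ ^ 2 +
      ∑' n, ∑' k, (if k = 0 then 0 else ‖a n‖ₑ * ‖a (n + k)‖ₑ) := by
  set S := ∑' n, a n with hS
  set T := ∑' n, ‖a n‖ with hT
  have ha' : Summable a := ha.of_norm
  have le_T : ∀ n, ‖a n‖ ≤ T := fun n => ha.le_tsum n fun _ _ => norm_nonneg _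
  have off : ∀ n, ‖S - a n‖ ≤ T - ‖a n‖ := by
    intro n
    have e1 : S = a n + ∑' k, if k = n then 0 else a k := ha'.tsum_eq_add_tsum_ite n
    have e2 : T = ‖a n‖ + ∑' k, if k = n then 0 else ‖a k‖ := ha.tsum_eq_add_tsum_ite n
    have e3 : Summable fun k => ‖if k = n then 0 else a k‖ := by
      refine ha.of_nonneg_of_le (fun _ => norm_nonneg _) fun k => ?_
      split_ifs <;> simp
    rw [e1, e2, add_sub_cancel_left, add_sub_cancel_left]
    refine (norm_tsum_le_tsum_norm e3).trans (le_of_eq ?_)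
    congr 1
    ext k
    split_ifs <;> simp
  have sumOff : Summable fun n => ‖a n‖ * (T - ‖a n‖) := by
    refine (ha.mul_right T).of_nonneg_of_le
      (fun n => mul_nonneg (norm_nonneg _) (sub_nonneg.2 (le_T n))) fun n => ?_
    have := norm_nonneg (a n)
    nlinarith
  have sumSq : Summable fun n => ‖a n‖ ^ 2 := by
    refine (ha.mul_right T).of_nonneg_of_le (fun n => by positivity) fun n => ?_
    have := norm_nonneg (a n)
    have := le_T n
    nlinarith
  have hmul : HasSum (fun n => (a n * starRingEnd ℂ S).re) ((S * starRingEnd ℂ S).re) :=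
    Complex.hasSum_re (ha'.hasSum.mul_right _)
  have main : ∑' n, ‖a n‖ ^ 2 ≤ ‖S‖ ^ 2 + ∑' n, ‖a n‖ * (T - ‖a n‖) := by
    have e : (S * starRingEnd ℂ S).re = ‖S‖ ^ 2 := by
      rw [Complex.mul_conj, Complex.normSq_eq_norm_sq]
      norm_cast
    rw [← e, ← hmul.tsum_eq, ← hmul.summable.tsum_add sumOff]
    refine sumSq.tsum_le_tsum (fun n => ?_) (hmul.summable.add sumOff)
    have e1 : (a n * starRingEnd ℂ S).re =
        ‖a n‖ ^ 2 + (a n * starRingEnd ℂ (S - a n)).re := by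
      have : ‖a n‖ ^ 2 = (a n * starRingEnd ℂ (a n)).re := by
        rw [Complex.mul_conj, Complex.normSq_eq_norm_sq]
        norm_cast
      rw [this, ← Complex.add_re, ← mul_add, ← map_add]
      congr 3
      ring
    have e2 : |(a n * starRingEnd ℂ (S - a n)).re| ≤ ‖a n‖ * (T - ‖a n‖) := by
      refine (Complex.abs_re_le_norm _).trans ?_
      rw [norm_mul, RCLike.norm_conj]
      exact mul_le_mul_of_nonneg_left (off n) (norm_nonneg _)
    have := neg_le_of_abs_le e2
    linarith
  have hOff : ∀ n, ENNReal.ofReal (‖a n‖ * (T - ‖a n‖)) =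
      ∑' k, (if k = 0 then 0 else ‖a n‖ₑ * ‖a (n + k)‖ₑ) := by
    intro n
    have hT' : ENNReal.ofReal T = ∑' k, ‖a (n + k)‖ₑ := by
      rw [hT, ENNReal.ofReal_tsum_of_nonneg (fun _ => norm_nonneg _) ha,
        ← (Equiv.addLeft n).tsum_eq (fun k => ENNReal.ofReal ‖a k‖)]
      simp
    rw [ENNReal.tsum_eq_add_tsum_ite 0] at hT'
    have hne : ‖a (n + 0)‖ₑ ≠ ∞ := enorm_ne_top
    rw [ENNReal.ofReal_mul (norm_nonneg _), ENNReal.ofReal_sub _ (norm_nonneg _), hT',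
      ofReal_norm, add_zero, ENNReal.add_sub_cancel_left enorm_ne_top, ← ENNReal.tsum_mul_left]
    congr 1
    ext k
    split_ifs <;> simp
  have := ENNReal.ofReal_le_ofReal main
  rw [ENNReal.ofReal_add (by positivity) (tsum_nonneg fun n =>
      mul_nonneg (norm_nonneg _) (sub_nonneg.2 (le_T n))),
    ENNReal.ofReal_tsum_of_nonneg (fun _ => by positivity) sumSq,
    ENNReal.ofReal_tsum_of_nonneg
      (fun n => mul_nonneg (norm_nonneg _) (sub_nonneg.2 (le_T n))) sumOff] at this
  simp only [hOff, ENNReal.ofReal_pow (norm_nonneg _), ofReal_norm] at this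
  exact this

variable {d : Type*}

/-- The half-open unit cube with lower corner `a`. -/
def unitCube (a : d → ℝ) : Set (d → ℝ) := {x | ∀ i, x i ∈ Set.Ioc (a i) (a i + 1)}

/-- An integer vector as a real vector. -/
def intVec (n : d → ℤ) : d → ℝ := fun i => (n i : ℝ)

theorem measurableSet_unitCube [Finite d] (a : d → ℝ) : MeasurableSet (unitCube a) :=
  MeasurableSet.univ_pi' fun _ => measurableSet_Ioc

/-- The cubes are open at the lower end, hence the ceiling minus one instead of the floor. -/
theorem mem_unitCube_intVec_iff (n : d → ℤ) (x : d → ℝ) :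
    x ∈ unitCube (intVec n) ↔ n = fun i => ⌈x i⌉ - 1 := by
  simp only [unitCube, intVec, Set.mem_ofPred_eq, Set.mem_Ioc, funext_iff]
  refine forall_congr' fun i => ?_
  rw [eq_sub_iff_add_eq, eq_comm, Int.ceil_eq_iff]
  push_cast
  simp

theorem iUnion_unitCube : ⋃ n : d → ℤ, unitCube (intVec n) = Set.univ := by
  refine Set.eq_univ_of_forall fun x => Set.mem_iUnion.2 ⟨_, (mem_unitCube_intVec_iff _ x).2 rfl⟩

theorem pairwise_disjoint_unitCube :
    Pairwise (Function.onFun Disjoint fun n : d → ℤ => unitCube (intVec n)) := by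
  intro n m hnm
  refine Set.disjoint_left.2 fun x hx hx' => hnm ?_
  rw [(mem_unitCube_intVec_iff _ _).1 hx, (mem_unitCube_intVec_iff _ _).1 hx']

theorem preimage_add_unitCube (n : d → ℤ) :
    (fun x => x + intVec n) ⁻¹' unitCube (intVec n) = unitCube 0 := by
  ext x
  simp only [unitCube, intVec, Set.mem_preimage, Set.mem_ofPred_eq, Set.mem_Ioc, Pi.add_apply,
    Pi.zero_apply]
  refine forall_congr' fun i => ?_
  constructor <;> rintro ⟨h, h'⟩ <;> constructor <;> linarith

theorem lintegral_eq_lintegral_unitCube_tsum [Fintype d] {g : (d → ℝ) → ℝ≥0∞} (hg : Measurable g) :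
    ∫⁻ x, g x = ∫⁻ x in unitCube 0, ∑' n : d → ℤ, g (x + intVec n) := by
  rw [lintegral_tsum (f := fun (n : d → ℤ) x => g (x + intVec n))
    fun n => (hg.comp (measurable_add_const _)).aemeasurable, ← setLIntegral_univ, ← iUnion_unitCube, lintegral_iUnion (fun n => measurableSet_unitCube _)
      pairwise_disjoint_unitCube]
  congr 1
  ext n
  rw [← preimage_add_unitCube n]
  exact ((measurePreserving_add_right volume (intVec n)).setLIntegral_comp_preimage
    (measurableSet_unitCube _) hg).symm

theorem integral_eq_integral_unitCube_tsum [Fintype d] {g : (d → ℝ) → ℂ} (hg : Integrable g) :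
    ∫ x, g x = ∫ x in unitCube 0, ∑' n : d → ℤ, g (x + intVec n) := by
  have hn : ∀ n : d → ℤ, ∫ x in unitCube (intVec n), g x = ∫ x in unitCube 0, g (x + intVec n) := by
    intro n
    rw [← preimage_add_unitCube n]
    exact ((measurePreserving_add_right volume (intVec n)).setIntegral_preimage_emb
      (measurableEmbedding_addRight _) _ _).symm
  have hen : ∀ n : d → ℤ, ∫⁻ x in unitCube (intVec n), ‖g x‖ₑ =
      ∫⁻ x in unitCube 0, ‖g (x + intVec n)‖ₑ := by
    intro n
    rw [← preimage_add_unitCube n]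
    exact ((measurePreserving_add_right volume (intVec n)).setLIntegral_comp_preimage_emb
      (measurableEmbedding_addRight _) _ _).symm
  rw [integral_tsum]
  · simp only [← hn]
    rw [← setIntegral_univ, ← iUnion_unitCube]
    exact integral_iUnion (fun n => measurableSet_unitCube _) pairwise_disjoint_unitCube
      hg.integrableOn
  · intro n
    exact (hg.comp_add_right _).aestronglyMeasurable.restrict
  · simp only [← hen]
    rw [← lintegral_iUnion (fun n => measurableSet_unitCube _) pairwise_disjoint_unitCube,
      iUnion_unitCube, setLIntegral_univ]
    exact hg.2.ne


end Periodization

/-! ### Parseval's identity on the torus with overlap error -/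

section Parseval

/-- The normalised Haar measure on `ℝ / ℤ`. -/
noncomputable local instance unitAddCircleMeasureSpace : MeasureSpace UnitAddCircle :=
  ⟨AddCircle.haarAddCircle⟩

variable {d : Type*} [Fintype d]

theorem mFourier_coe (m : d → ℤ) (x : d → ℝ) :
    UnitAddTorus.mFourier m (fun i => (x i : UnitAddCircle)) =
      (Real.fourierChar (∑ i, (m i : ℝ) * x i) : ℂ) := by
  simp only [UnitAddTorus.mFourier, ContinuousMap.coe_mk, fourier_coe_apply,
    Real.fourierChar_apply, ← Complex.exp_sum]
  congr 1
  push_cast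
  rw [Finset.mul_sum, Finset.sum_mul]
  refine Finset.sum_congr rfl fun i _ => ?_
  simp
  ring

theorem tsum_enorm_integral_unitCube_sq {H : (d → ℝ) → ℂ}
    (hH : MemLp H 2 (volume.restrict (unitCube 0))) :
    ∑' m : d → ℤ, ‖∫ x in unitCube 0, (Real.fourierChar (∑ i, (m i : ℝ) * x i) : ℂ) * H x‖ₑ ^ 2 =
      ∫⁻ x in unitCube 0, ‖H x‖ₑ ^ 2 := by
  set e := UnitAddTorus.measurableEquivPiIoc (0 : d → ℝ) with he
  set F : UnitAddTorus d → ℂ := fun t => H (e t).1 with hF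
  have F_coe : ∀ x ∈ unitCube (0 : d → ℝ), F (fun i => (x i : UnitAddCircle)) = H x := by
    intro x hx
    have : e.symm ⟨x, hx⟩ = fun i => (x i : UnitAddCircle) := rfl
    rw [← this, hF]
    simp
  have hmap : MeasurePreserving (fun t => (e t).1 : UnitAddTorus d → d → ℝ) volume
      (volume.restrict (unitCube 0)) := by
    have h2 : MeasurePreserving (Subtype.val : unitCube (0 : d → ℝ) → d → ℝ)
        (Measure.comap Subtype.val volume) (volume.restrict (unitCube 0)) :=
      ⟨measurable_subtype_coe, map_comap_subtype_coe (measurableSet_unitCube _) _⟩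
    exact h2.comp (UnitAddTorus.measurePreserving_equivPiIoc 0)
  have F2 : MemLp F 2 volume := hH.comp_measurePreserving hmap
  have key := UnitAddTorus.hasSum_sq_mFourierCoeff (F2.toLp F)
  -- The torus coefficient of index `n` pairs with the character of index `-n`; the sign is removed
  -- below by reindexing the sum.
  have coeff : ∀ m : d → ℤ, UnitAddTorus.mFourierCoeff (F2.toLp F) (-m) =
      ∫ x in unitCube 0, (Real.fourierChar (∑ i, (m i : ℝ) * x i) : ℂ) * H x := by
    intro m
    have h1 : UnitAddTorus.mFourierCoeff (F2.toLp F) (-m) = UnitAddTorus.mFourierCoeff F (-m) := by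
      refine integral_congr_ae ?_
      filter_upwards [F2.coeFn_toLp] with t ht
      rw [ht]
    rw [h1, UnitAddTorus.mFourierCoeff_eq_integral F (-m) 0]
    refine setIntegral_congr_fun (measurableSet_unitCube 0) fun x hx => ?_
    simp only [neg_neg, mFourier_coe, F_coe x hx, smul_eq_mul]
  have h3 := congrArg ENNReal.ofReal key.tsum_eq
  rw [ENNReal.ofReal_tsum_of_nonneg (fun _ => by positivity) key.summable,
    ← (Equiv.neg (d → ℤ)).tsum_eq] at h3
  simp only [Equiv.neg_apply, coeff, ENNReal.ofReal_pow (norm_nonneg _), ofReal_norm] at h3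
  rw [h3, ofReal_integral_eq_lintegral_ofReal
    ((memLp_two_iff_integrable_sq_norm (Lp.aestronglyMeasurable _)).1 (Lp.memLp _))
    (ae_of_all _ fun _ => by positivity)]
  simp only [ENNReal.ofReal_pow (norm_nonneg _), ofReal_norm]
  have h4 : ∫⁻ t, ‖(F2.toLp F) t‖ₑ ^ 2 = ∫⁻ t, ‖F t‖ₑ ^ 2 := by
    refine lintegral_congr_ae ?_
    filter_upwards [F2.coeFn_toLp] with t ht
    rw [ht]
  rw [h4]
  exact (UnitAddTorus.lintegral_preimage (fun t => ‖F t‖ₑ ^ 2) 0).trans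
    (setLIntegral_congr_fun (measurableSet_unitCube 0) fun x hx => by simp only [F_coe x hx])

theorem fourierChar_intVec_add (m n : d → ℤ) (x : d → ℝ) :
    Real.fourierChar (∑ i, (m i : ℝ) * (x + intVec n) i) =
      Real.fourierChar (∑ i, (m i : ℝ) * x i) := by
  have h : ∑ i, (m i : ℝ) * (x + intVec n) i =
      ∑ i, (m i : ℝ) * x i + ((∑ i, m i * n i : ℤ) : ℝ) := by
    push_cast
    rw [← Finset.sum_add_distrib]
    refine Finset.sum_congr rfl fun i _ => ?_
    simp [intVec]
    ring
  have h1 : Real.fourierChar (((∑ i, m i * n i : ℤ) : ℝ)) = 1 := by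
    ext
    rw [Real.fourierChar_apply, Circle.coe_one, Complex.exp_eq_one_iff]
    exact ⟨∑ i, m i * n i, by push_cast; ring⟩
  rw [h, AddChar.map_add_eq_mul, h1, mul_one]

/-- The coefficients of `h` against the characters of `ℝ^d / ℤ^d` have square sum `∫ |h|²`, up to
the interaction of `h` with its translates by nonzero lattice vectors. -/
theorem tsum_enorm_integral_sq_sandwich [DecidableEq d] {h : (d → ℝ) → ℂ} (hm : Measurable h) (h1 : Integrable h)
    (h2 : ∫⁻ x, ‖h x‖ₑ ^ 2 ≠ ∞) :
    ∑' m : d → ℤ, ‖∫ x, (Real.fourierChar (∑ i, (m i : ℝ) * x i) : ℂ) * h x‖ₑ ^ 2 ≤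
      (∫⁻ x, ‖h x‖ₑ ^ 2) + ∫⁻ x, ∑' k : d → ℤ,
        (if k = 0 then 0 else ‖h x‖ₑ * ‖h (x + intVec k)‖ₑ) ∧
    (∫⁻ x, ‖h x‖ₑ ^ 2) ≤
      ∑' m : d → ℤ, ‖∫ x, (Real.fourierChar (∑ i, (m i : ℝ) * x i) : ℂ) * h x‖ₑ ^ 2 +
      ∫⁻ x, ∑' k : d → ℤ,
        (if k = 0 then 0 else ‖h x‖ₑ * ‖h (x + intVec k)‖ₑ) := by
  set U := ∫⁻ x, ‖h x‖ₑ ^ 2 with hU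
  set R := ∫⁻ x, ∑' k : d → ℤ, (if k = 0 then 0 else ‖h x‖ₑ * ‖h (x + intVec k)‖ₑ) with hR
  -- An infinite overlap makes both inequalities trivial; a finite one makes the periodization `H`
  -- square integrable on the unit cube.
  by_cases hRtop : R = ∞
  · simp only [hRtop, add_top, le_top, and_self]
  have mU : Measurable fun x => ‖h x‖ₑ ^ 2 := hm.enorm.pow_const 2
  have mR : Measurable fun x => ∑' k : d → ℤ,
      (if k = 0 then 0 else ‖h x‖ₑ * ‖h (x + intVec k)‖ₑ) := by
    refine Measurable.tsum fun k => ?_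
    split_ifs
    · exact measurable_const
    · exact hm.enorm.mul (hm.comp (measurable_add_const _)).enorm
  have mtsum : ∀ {g : (d → ℝ) → ℝ≥0∞}, Measurable g →
      Measurable fun x => ∑' n : d → ℤ, g (x + intVec n) := fun hg =>
    Measurable.tsum fun n => hg.comp (measurable_add_const _)
  have hadd : ∀ (x : d → ℝ) (n k : d → ℤ), x + intVec n + intVec k = x + intVec (n + k) := by
    intro x n k
    ext i
    simp [intVec, add_assoc]
  set H : (d → ℝ) → ℂ := fun x => ∑' n : d → ℤ, h (x + intVec n) with hH
  have eU : U = ∫⁻ x in unitCube 0, ∑' n : d → ℤ, ‖h (x + intVec n)‖ₑ ^ 2 :=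
    lintegral_eq_lintegral_unitCube_tsum mU
  have eR : R = ∫⁻ x in unitCube 0, ∑' n : d → ℤ, ∑' k : d → ℤ,
      (if k = 0 then 0 else ‖h (x + intVec n)‖ₑ * ‖h (x + intVec (n + k))‖ₑ) := by
    have := lintegral_eq_lintegral_unitCube_tsum mR
    simp only [hadd] at this
    exact this
  -- Diagonal and overlap together are the integral of the squared periodization of `|h|`, which
  -- dominates `|H|²`.
  have eUR : U + R = ∫⁻ x in unitCube 0, (∑' n : d → ℤ, ‖h (x + intVec n)‖ₑ) ^ 2 := by
    have := mtsum mU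
    rw [eU, eR, ← lintegral_add_left this]
    refine lintegral_congr fun x => ?_
    rw [tsum_enorm_sq_eq]
  have summ : ∀ᵐ x ∂(volume.restrict (unitCube (0 : d → ℝ))),
      Summable fun n : d → ℤ => ‖h (x + intVec n)‖ := by
    have hfin : ∫⁻ x in unitCube 0, ∑' n : d → ℤ, ‖h (x + intVec n)‖ₑ ≠ ∞ := by
      rw [← lintegral_eq_lintegral_unitCube_tsum hm.enorm]
      exact h1.2.ne
    filter_upwards [ae_lt_top (mtsum hm.enorm) hfin] with x hx
    have := ENNReal.summable_toReal hx.ne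
    simpa using this
  have mH : AEStronglyMeasurable H (volume.restrict (unitCube 0)) := by
    refine aestronglyMeasurable_of_tendsto_ae (Filter.atTop : Filter (Finset (d → ℤ)))
      (f := fun s x => ∑ n ∈ s, h (x + intVec n)) (fun s => ?_) ?_
    · exact (Finset.measurable_sum s fun n _ =>
        hm.comp (measurable_add_const _)).aestronglyMeasurable
    · filter_upwards [summ] with x hx
      exact hx.of_norm.hasSum
  have hH2 : MemLp H 2 (volume.restrict (unitCube 0)) := by
    refine ⟨mH, ?_⟩
    rw [eLpNorm_lt_top_iff_lintegral_rpow_enorm_lt_top (by norm_num) (by norm_num)]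
    refine lt_of_le_of_lt ?_ (ENNReal.add_lt_top.2 ⟨h2.lt_top, lt_top_iff_ne_top.2 hRtop⟩)
    rw [eUR]
    refine lintegral_mono fun x => ?_
    simp only [ENNReal.toReal_ofNat, ENNReal.rpow_ofNat]
    gcongr
    exact enorm_tsum_le_tsum_enorm
  -- The characters are invariant under integer translations, so the integrals over the whole space
  -- fold to the Fourier coefficients of `H`.
  have eS : ∑' m : d → ℤ, ‖∫ x, (Real.fourierChar (∑ i, (m i : ℝ) * x i) : ℂ) * h x‖ₑ ^ 2 =
      ∫⁻ x in unitCube 0, ‖H x‖ₑ ^ 2 := by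
    rw [← tsum_enorm_integral_unitCube_sq hH2]
    congr 1
    ext m
    have hc : Continuous fun x : d → ℝ => (Real.fourierChar (∑ i, (m i : ℝ) * x i) : ℂ) :=
      continuous_subtype_val.comp (Real.continuous_fourierChar.comp (by fun_prop))
    rw [integral_eq_integral_unitCube_tsum]
    · simp only [fourierChar_intVec_add, tsum_mul_left, hH]
    · exact h1.bdd_mul (c := 1) hc.aestronglyMeasurable (ae_of_all _ fun x => (Circle.norm_coe _).le)
  rw [eS]
  constructor
  · refine le_of_le_of_eq ?_ eUR.symm
    refine lintegral_mono fun x => ?_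
    dsimp only
    gcongr
    exact enorm_tsum_le_tsum_enorm
  · rw [eU, eR, ← lintegral_add_left' (mH.enorm.pow_const 2)]
    refine lintegral_mono_ae ?_
    filter_upwards [summ] with x hx
    exact tsum_enorm_sq_le hx

end Parseval

/-! ### Parseval for general lattices -/

section LatticeSums

theorem lintegral_comp_ofLp (g : Plane → ℝ≥0∞) :
    ∫⁻ y : Fin 2 → ℝ, g (WithLp.toLp 2 y) = ∫⁻ x, g x :=
  (PiLp.volume_preserving_toLp (Fin 2)).lintegral_comp_emb
    (MeasurableEquiv.toLp 2 (Fin 2 → ℝ)).measurableEmbedding g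

theorem integral_comp_ofLp (g : Plane → ℂ) :
    ∫ y : Fin 2 → ℝ, g (WithLp.toLp 2 y) = ∫ x, g x :=
  (PiLp.volume_preserving_toLp (Fin 2)).integral_comp
    (MeasurableEquiv.toLp 2 (Fin 2 → ℝ)).measurableEmbedding g

/-- Substitute `ξ = N y` to reach the integer lattice. Integrals acquire `|det N|⁻¹` and squared
coefficients `|det N|⁻²`, so one factor `|det N|` remains after clearing denominators. -/
theorem lattice_parseval_sandwich_of_matrix {N : Matrix (Fin 2) (Fin 2) ℝ} (hN : N.det ≠ 0)
    {h : Plane → ℂ} (hm : Measurable h) (h1 : Integrable h) (h2 : ∫⁻ x, ‖h x‖ₑ ^ 2 ≠ ∞) :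
    ∑' m : ℤ × ℤ, ‖∫ ξ, (Real.fourierChar (inner ℝ (Matrix.toEuclideanLin N⁻¹ ξ)
        (latticePoint 1 1 m)) : ℂ) * h ξ‖ₑ ^ 2 ≤
      ENNReal.ofReal |N.det| * ((∫⁻ ξ, ‖h ξ‖ₑ ^ 2) + ∫⁻ ξ, ∑' k : ℤ × ℤ,
        (if k = 0 then 0 else ‖h ξ‖ₑ *
          ‖h (ξ + Matrix.toEuclideanLin N (latticePoint 1 1 k))‖ₑ)) ∧
    ENNReal.ofReal |N.det| * (∫⁻ ξ, ‖h ξ‖ₑ ^ 2) ≤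
      ∑' m : ℤ × ℤ, ‖∫ ξ, (Real.fourierChar (inner ℝ (Matrix.toEuclideanLin N⁻¹ ξ)
        (latticePoint 1 1 m)) : ℂ) * h ξ‖ₑ ^ 2 +
      ENNReal.ofReal |N.det| * ∫⁻ ξ, ∑' k : ℤ × ℤ,
        (if k = 0 then 0 else ‖h ξ‖ₑ *
          ‖h (ξ + Matrix.toEuclideanLin N (latticePoint 1 1 k))‖ₑ) := by
  set D := ENNReal.ofReal |N.det| with hD
  have D0 : D ≠ 0 := by simpa [hD] using hN
  have Dt : D ≠ ∞ := ENNReal.ofReal_ne_top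
  have Dinv : ENNReal.ofReal |N.det|⁻¹ = D⁻¹ := ENNReal.ofReal_inv_of_pos (abs_pos.2 hN)
  set g : (Fin 2 → ℝ) → ℂ := fun y => h (Matrix.toEuclideanLin N (WithLp.toLp 2 y)) with hg
  have mg : Measurable g :=
    hm.comp ((continuous_toEuclideanLin N).measurable.comp (MeasurableEquiv.toLp 2 _).measurable)
  have g1 : Integrable g :=
    ((PiLp.volume_preserving_toLp (Fin 2)).integrable_comp_emb
      (MeasurableEquiv.toLp 2 (Fin 2 → ℝ)).measurableEmbedding).2
      (integrable_comp_toEuclideanLin hN h1)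
  have eU : ∫⁻ y, ‖g y‖ₑ ^ 2 = D⁻¹ * ∫⁻ ξ, ‖h ξ‖ₑ ^ 2 := by
    rw [← Dinv, ← lintegral_comp_toEuclideanLin hN, ← lintegral_comp_ofLp]
  have eR : ∫⁻ y, ∑' k : Fin 2 → ℤ, (if k = 0 then 0 else ‖g y‖ₑ * ‖g (y + intVec k)‖ₑ) =
      D⁻¹ * ∫⁻ ξ, ∑' k : ℤ × ℤ, (if k = 0 then 0 else ‖h ξ‖ₑ *
          ‖h (ξ + Matrix.toEuclideanLin N (latticePoint 1 1 k))‖ₑ) := by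
    rw [← Dinv, ← lintegral_comp_toEuclideanLin hN, ← lintegral_comp_ofLp]
    refine lintegral_congr fun y => ?_
    rw [← (finTwoArrowEquiv ℤ).tsum_eq]
    congr 1
    ext k
    have e1 : finTwoArrowEquiv ℤ k = 0 ↔ k = 0 := by
      simp [finTwoArrowEquiv, Prod.ext_iff, funext_iff, Fin.forall_fin_two]
    have e2 : WithLp.toLp 2 (y + intVec k) =
        WithLp.toLp 2 y + latticePoint 1 1 (finTwoArrowEquiv ℤ k) := by
      ext i
      fin_cases i <;> simp [intVec, latticePoint, finTwoArrowEquiv]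
    simp only [e1, hg, e2, map_add]
  have eS : ∑' m : Fin 2 → ℤ, ‖∫ y, (Real.fourierChar (∑ i, (m i : ℝ) * y i) : ℂ) * g y‖ₑ ^ 2 =
      D⁻¹ ^ 2 * ∑' m : ℤ × ℤ, ‖∫ ξ, (Real.fourierChar (inner ℝ (Matrix.toEuclideanLin N⁻¹ ξ)
        (latticePoint 1 1 m)) : ℂ) * h ξ‖ₑ ^ 2 := by
    rw [← (finTwoArrowEquiv ℤ).tsum_eq, ← ENNReal.tsum_mul_left]
    congr 1
    ext m
    rw [← Dinv, ← mul_pow]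
    congr 1
    have := integral_comp_toEuclideanLin hN (fun ξ => (Real.fourierChar
      (inner ℝ (Matrix.toEuclideanLin N⁻¹ ξ) (latticePoint 1 1 (finTwoArrowEquiv ℤ m))) : ℂ) * h ξ)
    rw [← integral_comp_ofLp] at this
    simp only [toEuclideanLin_cancel_inv hN] at this
    have e : ∀ y : Fin 2 → ℝ, inner ℝ (WithLp.toLp 2 y) (latticePoint 1 1 (finTwoArrowEquiv ℤ m)) =
        ∑ i, (m i : ℝ) * y i := by
      intro y
      rw [inner_plane]
      simp [latticePoint, finTwoArrowEquiv, Fin.sum_univ_two, mul_comm]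
    simp only [e] at this ⊢
    rw [this, enorm_smul]
    congr 1
    rw [Real.enorm_eq_ofReal (by positivity)]
  have key := tsum_enorm_integral_sq_sandwich mg g1 (by
    rw [eU]
    exact ENNReal.mul_ne_top (ENNReal.inv_ne_top.2 D0) h2)
  rw [eU, eR, eS] at key
  have c1 : ∀ x : ℝ≥0∞, D ^ 2 * (D⁻¹ ^ 2 * x) = x := by
    intro x
    rw [← mul_assoc, ← mul_pow, ENNReal.mul_inv_cancel D0 Dt, one_pow, one_mul]
  have c2 : ∀ x : ℝ≥0∞, D ^ 2 * (D⁻¹ * x) = D * x := by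
    intro x
    rw [sq, mul_assoc, ← mul_assoc D D⁻¹, ENNReal.mul_inv_cancel D0 Dt, one_mul]
  constructor
  · have := mul_le_mul_right key.1 (D ^ 2)
    rwa [c1, ← mul_add, c2] at this
  · have := mul_le_mul_right key.2 (D ^ 2)
    rwa [mul_add, c1, c2, c2] at this

/-- Square sum over the lattice `c ℤ²` of the coefficients of `h` against the dilated characters
`ξ ↦ e(⟨M⁻ᵀξ, cm⟩)`. -/
noncomputable def latticeSum (M : Matrix (Fin 2) (Fin 2) ℝ) (c : ℝ) (h : Plane → ℂ) : ℝ≥0∞ :=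
  ∑' m : ℤ × ℤ, ‖∫ ξ, (Real.fourierChar (inner ℝ (Matrix.toEuclideanLin (M⁻¹).transpose ξ)
    (latticePoint c c m)) : ℂ) * h ξ‖ₑ ^ 2

/-- The interaction of `h` with its translates by the lattice dual to `M⁻¹ c ℤ²`. -/
noncomputable def latticeOverlap (M : Matrix (Fin 2) (Fin 2) ℝ) (c : ℝ) (h : Plane → ℂ) : ℝ≥0∞ :=
  ∫⁻ ξ, ∑' k : ℤ × ℤ, (if k = 0 then 0 else ‖h ξ‖ₑ *
    ‖h (ξ + Matrix.toEuclideanLin M.transpose (latticePoint c⁻¹ c⁻¹ k))‖ₑ)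

/-- The general case with `N = c⁻¹ Mᵀ`, whose columns span the lattice dual to `M⁻¹ c ℤ²`. -/
theorem lattice_parseval_sandwich {M : Matrix (Fin 2) (Fin 2) ℝ} (hM : M.det ≠ 0) {c : ℝ}
    (hc : 0 < c) {h : Plane → ℂ} (hm : Measurable h) (h1 : Integrable h)
    (h2 : ∫⁻ x, ‖h x‖ₑ ^ 2 ≠ ∞) :
    latticeSum M c h ≤
      ENNReal.ofReal (|M.det| * (c ^ 2)⁻¹) * ((∫⁻ ξ, ‖h ξ‖ₑ ^ 2) + latticeOverlap M c h) ∧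
    ENNReal.ofReal (|M.det| * (c ^ 2)⁻¹) * (∫⁻ ξ, ‖h ξ‖ₑ ^ 2) ≤
      latticeSum M c h + ENNReal.ofReal (|M.det| * (c ^ 2)⁻¹) * latticeOverlap M c h := by
  have hdet : (c⁻¹ • M.transpose).det = M.det * (c ^ 2)⁻¹ := by
    rw [Matrix.det_smul, Matrix.det_transpose]
    simp [mul_comm]
  have hN : (c⁻¹ • M.transpose).det ≠ 0 := by
    rw [hdet]
    positivity
  have key := lattice_parseval_sandwich_of_matrix hN hm h1 h2
  have e1 : ∀ k : ℤ × ℤ, Matrix.toEuclideanLin (c⁻¹ • M.transpose) (latticePoint 1 1 k) =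
      Matrix.toEuclideanLin M.transpose (latticePoint c⁻¹ c⁻¹ k) := by
    intro k
    have : latticePoint c⁻¹ c⁻¹ k = c⁻¹ • latticePoint 1 1 k := by
      ext i
      fin_cases i <;> simp [latticePoint]
    rw [this, map_smul, map_smul, LinearMap.smul_apply]
  have e2 : ∀ (ξ : Plane) (m : ℤ × ℤ),
      inner ℝ (Matrix.toEuclideanLin (c⁻¹ • M.transpose)⁻¹ ξ) (latticePoint 1 1 m) =
      inner ℝ (Matrix.toEuclideanLin (M⁻¹).transpose ξ) (latticePoint c c m) := by
    intro ξ m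
    have : (c⁻¹ • M.transpose)⁻¹ = c • (M⁻¹).transpose := by
      refine Matrix.inv_eq_right_inv ?_
      rw [Matrix.smul_mul, Matrix.mul_smul, ← Matrix.transpose_mul,
        Matrix.nonsing_inv_mul _ hM.isUnit, Matrix.transpose_one, smul_smul,
        inv_mul_cancel₀ hc.ne', one_smul]
    have h' : latticePoint c c m = c • latticePoint 1 1 m := by
      ext i
      fin_cases i <;> simp [latticePoint]
    rw [this, h', map_smul, LinearMap.smul_apply, inner_smul_left, inner_smul_right]
    simp
  have e3 : |(c⁻¹ • M.transpose).det| = |M.det| * (c ^ 2)⁻¹ := by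
    rw [hdet, abs_mul, abs_of_pos (by positivity : 0 < (c ^ 2)⁻¹)]
  simp only [e1, e2, e3] at key
  exact key

end LatticeSums

/-! ### Estimates for a rational bump function -/

section Bump

/-- The rational bump `t ↦ 1 / (1 + t²)`. -/
noncomputable def bump (t : ℝ) : ℝ := (1 + t ^ 2)⁻¹

theorem bump_pos (t : ℝ) : 0 < bump t := by
  unfold bump
  positivity

theorem bump_le_one (t : ℝ) : bump t ≤ 1 :=
  inv_le_one_of_one_le₀ (by nlinarith [sq_nonneg t])

theorem continuous_bump : Continuous bump := by
  unfold bump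
  exact (by fun_prop : Continuous fun t : ℝ => 1 + t ^ 2).inv₀ fun t => by positivity

theorem sq_mul_bump_le_one (t : ℝ) : t ^ 2 * bump t ≤ 1 := by
  rw [bump, ← div_eq_mul_inv, div_le_one (by positivity)]
  linarith

/-- Peetre's inequality. -/
theorem bump_mul_bump_add_le (a ω : ℝ) : bump a * bump (a + ω) ≤ 2 * bump ω := by
  unfold bump
  rw [← mul_inv, ← div_eq_mul_inv, inv_eq_one_div, div_le_div_iff₀ (by positivity) (by positivity)]
  nlinarith [sq_nonneg (2 * a + ω), sq_nonneg (a * (a + ω))]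

theorem bump_sub_le (r k : ℝ) (hr : |r| ≤ 1) : bump (r - k) ≤ 4 * bump k := by
  have h1 := bump_mul_bump_add_le r (-k)
  have h2 : (1 : ℝ) / 2 ≤ bump r := by
    rw [bump, one_div]
    refine inv_anti₀ (by positivity) ?_
    have : r ^ 2 ≤ 1 := (sq_le_one_iff_abs_le_one r).2 hr
    linarith
  have h3 : bump (-k) = bump k := by simp [bump]
  rw [h3, ← sub_eq_add_neg] at h1
  nlinarith [bump_pos (r - k)]

theorem summable_bump_int : Summable fun n : ℤ => bump (n : ℝ) := by
  have h : Summable fun n : ℕ => bump (n : ℝ) := by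
    rw [← summable_nat_add_iff 1]
    refine ((summable_nat_add_iff 1).2 (Real.summable_one_div_nat_pow.2 one_lt_two)).of_nonneg_of_le
      (fun n => (bump_pos _).le) fun n => ?_
    rw [bump, one_div]
    exact inv_anti₀ (by positivity) (by linarith)
  refine Summable.of_nat_of_neg (by simpa using h) ?_
  simpa [bump] using h

/-- The constant `∑_{n ∈ ℤ} 1 / (1 + n²)`. -/
noncomputable def bumpSum : ℝ := ∑' n : ℤ, bump (n : ℝ)

theorem bumpSum_nonneg : 0 ≤ bumpSum := tsum_nonneg fun _ => (bump_pos _).le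

theorem tsum_ofReal_bump_int : ∑' n : ℤ, ENNReal.ofReal (bump n) = ENNReal.ofReal bumpSum :=
  (ENNReal.ofReal_tsum_of_nonneg (fun _ => (bump_pos _).le) summable_bump_int).symm

theorem tsum_bump_sub_int_le (x : ℝ) :
    ∑' k : ℤ, ENNReal.ofReal (bump (x - k)) ≤ ENNReal.ofReal (4 * bumpSum) := by
  rw [← (Equiv.addRight ⌊x⌋).tsum_eq, ENNReal.ofReal_mul (by norm_num), ← tsum_ofReal_bump_int,
    ← ENNReal.tsum_mul_left]
  refine ENNReal.tsum_le_tsum fun k => ?_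
  rw [← ENNReal.ofReal_mul (by norm_num)]
  refine ENNReal.ofReal_le_ofReal ?_
  have e : x - ((Equiv.addRight ⌊x⌋ k : ℤ) : ℝ) = Int.fract x - k := by
    rw [Equiv.coe_addRight, Int.fract]
    push_cast
    ring
  rw [e]
  refine bump_sub_le _ _ ?_
  rw [abs_of_nonneg (Int.fract_nonneg x)]
  exact (Int.fract_lt_one x).le

/-- Each term is at most `bump (u / t - k)`, because `t² (1 + (u/t - k)²) = t² + (u - k t)²`. The
factor `t²` pays for the many `k` that contribute when `t` is small, so the bound is uniform in both
`u` and `t`. -/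
theorem tsum_bump_sub_mul_le (u t : ℝ) :
    ∑' k : ℤ, ENNReal.ofReal (t ^ 2 * bump t * bump (u - k * t)) ≤
      ENNReal.ofReal (4 * bumpSum) := by
  rcases eq_or_ne t 0 with rfl | ht
  · simp
  refine le_trans (ENNReal.tsum_le_tsum fun k => ENNReal.ofReal_le_ofReal ?_)
    (tsum_bump_sub_int_le (u / t))
  unfold bump
  rw [mul_assoc, ← mul_inv, ← div_eq_mul_inv, inv_eq_one_div,
    div_le_div_iff₀ (by positivity) (by positivity), one_mul]
  have e : t ^ 2 * (1 + (u / t - k) ^ 2) = t ^ 2 + (u - k * t) ^ 2 := by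
    field_simp
  rw [e]
  nlinarith [sq_nonneg t, sq_nonneg (u - k * t), mul_nonneg (sq_nonneg t) (sq_nonneg (u - k * t))]

/-- `∑_{j ≥ 0} t_j² / (1 + t_j²)²` for `t_j = 2^{-j} t` is bounded uniformly in `t`. -/
theorem tsum_dyadic_le (t : ℝ) :
    ∑' j : ℕ, ENNReal.ofReal ((((2 : ℝ) ^ j)⁻¹ * t) ^ 2 * bump (((2 : ℝ) ^ j)⁻¹ * t) ^ 2) ≤
      ENNReal.ofReal (4 / 3) := by
  set f : ℕ → ℝ := fun j => 1 - bump (((2 : ℝ) ^ j)⁻¹ * t) with hf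
  -- Telescoping: `bump (y/2) - bump y` equals `3/4 · y² / ((1 + y²)(1 + y²/4))`, which is where the
  -- constant `4/3` comes from.
  have step : ∀ j, (((2 : ℝ) ^ j)⁻¹ * t) ^ 2 * bump (((2 : ℝ) ^ j)⁻¹ * t) ^ 2 ≤
      4 / 3 * (f j - f (j + 1)) := by
    intro j
    simp only [hf]
    have e : ((2 : ℝ) ^ (j + 1))⁻¹ * t = (((2 : ℝ) ^ j)⁻¹ * t) / 2 := by
      rw [pow_succ]
      field_simp
    rw [e]
    set y := ((2 : ℝ) ^ j)⁻¹ * t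
    unfold bump
    have h1 : (0 : ℝ) < 1 + y ^ 2 := by positivity
    have h2 : (0 : ℝ) < 1 + (y / 2) ^ 2 := by positivity
    have e2 : 4 / 3 * (1 - (1 + y ^ 2)⁻¹ - (1 - (1 + (y / 2) ^ 2)⁻¹)) =
        y ^ 2 / ((1 + y ^ 2) * (1 + (y / 2) ^ 2)) := by
      field_simp
      ring
    rw [e2, inv_pow, ← div_eq_mul_inv]
    refine div_le_div_of_nonneg_left (sq_nonneg y) (by positivity) ?_
    rw [sq (1 + y ^ 2)]
    refine mul_le_mul_of_nonneg_left ?_ h1.le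
    nlinarith [sq_nonneg y]
  refine ENNReal.tsum_le_of_sum_range_le fun n => ?_
  rw [← ENNReal.ofReal_sum_of_nonneg fun j _ => by positivity]
  refine ENNReal.ofReal_le_ofReal ((Finset.sum_le_sum fun j _ => step j).trans ?_)
  rw [← Finset.mul_sum, Finset.sum_range_sub']
  have h0 : f 0 ≤ 1 := by simp only [hf]; linarith [bump_pos (((2 : ℝ) ^ 0)⁻¹ * t)]
  have hn : 0 ≤ f n := by simp only [hf]; linarith [bump_le_one (((2 : ℝ) ^ n)⁻¹ * t)]
  linarith

theorem bump_inv_mul_le {c : ℝ} (hc : 0 < c) (hc1 : c ≤ 1) (n : ℤ) :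
    bump (c⁻¹ * n) ≤ bump n := by
  unfold bump
  refine inv_anti₀ (by positivity) ?_
  rw [mul_pow]
  have : 1 ≤ (c⁻¹) ^ 2 := one_le_pow₀ ((one_le_inv₀ hc).2 hc1)
  nlinarith [sq_nonneg (n : ℝ)]

/-- The source of the gain `c²` in all overlap estimates: a nonzero integer satisfies `n² ≥ 1`. -/
theorem bump_inv_mul_le_of_ne_zero {c : ℝ} (hc : 0 < c) {n : ℤ} (hn : n ≠ 0) :
    bump (c⁻¹ * n) ≤ 2 * c ^ 2 * bump n := by
  unfold bump
  have h1 : (1 : ℝ) ≤ (n : ℝ) ^ 2 := by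
    have : 0 < n ^ 2 := by positivity
    have : (1 : ℤ) ≤ n ^ 2 := this
    exact_mod_cast this
  rw [← div_eq_mul_inv, inv_eq_one_div, div_le_div_iff₀ (by positivity) (by positivity)]
  have e : 2 * c ^ 2 * (1 + (c⁻¹ * n) ^ 2) = 2 * c ^ 2 + 2 * n ^ 2 := by
    field_simp
  rw [e]
  nlinarith [sq_nonneg c]

/-- The product bump on the plane. -/
noncomputable def planeBump (η : Plane) : ℝ := bump (η 0) * bump (η 1)

theorem planeBump_pos (η : Plane) : 0 < planeBump η := mul_pos (bump_pos _) (bump_pos _)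

theorem planeBump_le_one (η : Plane) : planeBump η ≤ 1 :=
  mul_le_one₀ (bump_le_one _) (bump_pos _).le (bump_le_one _)

theorem planeBump_mul_add_le (η ω : Plane) :
    planeBump η * planeBump (η + ω) ≤ 4 * planeBump ω := by
  have h0 := bump_mul_bump_add_le (η 0) (ω 0)
  have h1 := bump_mul_bump_add_le (η 1) (ω 1)
  have := mul_le_mul h0 h1 (mul_pos (bump_pos _) (bump_pos _)).le
    (mul_pos two_pos (bump_pos _)).le
  simp only [planeBump, PiLp.add_apply]
  linarith

/-- A nonzero lattice vector has a nonzero coordinate, which yields the factor `c²`; in the other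
coordinate `c ≤ 1` is enough to compare with the unit lattice. -/
theorem tsum_planeBump_lattice_le {c : ℝ} (hc : 0 < c) (hc1 : c ≤ 1) :
    ∑' k : ℤ × ℤ, (if k = 0 then 0 else ENNReal.ofReal (planeBump (latticePoint c⁻¹ c⁻¹ k))) ≤
      ENNReal.ofReal (2 * c ^ 2 * bumpSum ^ 2) := by
  have h : ∀ k : ℤ × ℤ,
      (if k = 0 then 0 else ENNReal.ofReal (planeBump (latticePoint c⁻¹ c⁻¹ k))) ≤
      ENNReal.ofReal (2 * c ^ 2) * (ENNReal.ofReal (bump k.1) * ENNReal.ofReal (bump k.2)) := by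
    intro k
    split_ifs with hk
    · exact zero_le
    rw [← ENNReal.ofReal_mul (bump_pos _).le, ← ENNReal.ofReal_mul (by positivity)]
    refine ENNReal.ofReal_le_ofReal ?_
    have e0 : (latticePoint c⁻¹ c⁻¹ k) 0 = c⁻¹ * k.1 := by simp [latticePoint]
    have e1 : (latticePoint c⁻¹ c⁻¹ k) 1 = c⁻¹ * k.2 := by simp [latticePoint]
    rw [planeBump, e0, e1, ← mul_assoc]
    have hor : k.1 ≠ 0 ∨ k.2 ≠ 0 := by
      by_contra! hcon
      exact hk (Prod.ext hcon.1 hcon.2)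
    have b1 := bump_inv_mul_le hc hc1 k.1
    have b2 := bump_inv_mul_le hc hc1 k.2
    rcases hor with h1 | h1
    · exact mul_le_mul (bump_inv_mul_le_of_ne_zero hc h1) b2 (bump_pos _).le
        (mul_pos (by positivity) (bump_pos _)).le
    · have := mul_le_mul b1 (bump_inv_mul_le_of_ne_zero hc h1) (bump_pos _).le (bump_pos _).le
      linarith
  refine (ENNReal.tsum_le_tsum h).trans ?_
  rw [ENNReal.tsum_mul_left, ENNReal.tsum_prod']
  simp only [ENNReal.tsum_mul_left, ENNReal.tsum_mul_right, tsum_ofReal_bump_int]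
  rw [← ENNReal.ofReal_mul bumpSum_nonneg, ← ENNReal.ofReal_mul (by positivity), sq bumpSum]

end Bump

/-! ### Bounding the overlap terms -/

section Overlap

theorem mul_le_sq_add_sq (a b : ℝ≥0∞) : a * b ≤ a ^ 2 + b ^ 2 := by
  rcases le_total a b with h | h
  · calc a * b ≤ b * b := by gcongr
      _ = b ^ 2 := (sq b).symm
      _ ≤ _ := le_add_self
  · calc a * b ≤ a * a := by gcongr
      _ = a ^ 2 := (sq a).symm
      _ ≤ _ := le_self_add

variable {M : Matrix (Fin 2) (Fin 2) ℝ}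

theorem dual_shift (hM : M.det ≠ 0) (ξ v : Plane) :
    Matrix.toEuclideanLin (M⁻¹).transpose (ξ + Matrix.toEuclideanLin M.transpose v) =
      Matrix.toEuclideanLin (M⁻¹).transpose ξ + v := by
  rw [map_add, ← toEuclideanLin_mul_apply, ← Matrix.transpose_mul,
    Matrix.mul_nonsing_inv _ hM.isUnit]
  simp

theorem latticePoint_neg (a b : ℝ) (k : ℤ × ℤ) : latticePoint a b (-k) = -latticePoint a b k := by
  ext i
  fin_cases i <;> simp [latticePoint]

/-- A Schur-type argument. Bound `|G(ξ) G(ξ + v_k)|` by `|G(ξ)|² + |G(ξ + v_k)|²`; translating by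
`-v_k` turns the second contribution into the first one with `k` replaced by `-k`, so the two sums
agree. -/
theorem latticeOverlap_mul_le (c : ℝ) {q G : Plane → ℂ} (hq : Measurable q) (hG : Measurable G) :
    latticeOverlap M c (fun ξ => q ξ * G ξ) ≤
      2 * ∫⁻ ξ, ‖G ξ‖ₑ ^ 2 * ∑' k : ℤ × ℤ, (if k = 0 then 0 else ‖q ξ‖ₑ *
        ‖q (ξ + Matrix.toEuclideanLin M.transpose (latticePoint c⁻¹ c⁻¹ k))‖ₑ) := by
  set v : ℤ × ℤ → Plane := fun k =>
    Matrix.toEuclideanLin M.transpose (latticePoint c⁻¹ c⁻¹ k) with hv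
  have vneg : ∀ k, v (-k) = -v k := by
    intro k
    simp only [hv, latticePoint_neg, map_neg]
  set I : ℤ × ℤ → ℝ≥0∞ := fun k => ∫⁻ ξ, (if k = 0 then 0 else
    ‖G ξ‖ₑ ^ 2 * (‖q ξ‖ₑ * ‖q (ξ + v k)‖ₑ)) with hI
  have mI : ∀ k : ℤ × ℤ, Measurable fun ξ => (if k = 0 then 0 else
      ‖G ξ‖ₑ ^ 2 * (‖q ξ‖ₑ * ‖q (ξ + v k)‖ₑ)) := by
    intro k
    split_ifs
    · exact measurable_const
    · exact (hG.enorm.pow_const 2).mul (hq.enorm.mul (hq.comp (measurable_add_const _)).enorm)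
  have mI' : ∀ k : ℤ × ℤ, Measurable fun ξ => (if k = 0 then 0 else
      ‖G (ξ + v k)‖ₑ ^ 2 * (‖q ξ‖ₑ * ‖q (ξ + v k)‖ₑ)) := by
    intro k
    split_ifs
    · exact measurable_const
    · exact ((hG.comp (measurable_add_const _)).enorm.pow_const 2).mul
        (hq.enorm.mul (hq.comp (measurable_add_const _)).enorm)
  have swap : ∀ k, ∫⁻ ξ, (if k = 0 then 0 else
      ‖G (ξ + v k)‖ₑ ^ 2 * (‖q ξ‖ₑ * ‖q (ξ + v k)‖ₑ)) = I (-k) := by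
    intro k
    rw [← lintegral_add_right_eq_self _ (-v k)]
    simp only [hI, neg_add_cancel_right, vneg, neg_eq_zero]
    refine lintegral_congr fun ξ => ?_
    split_ifs
    · rfl
    · rw [mul_comm ‖q ξ‖ₑ]
  calc latticeOverlap M c (fun ξ => q ξ * G ξ)
      ≤ ∫⁻ ξ, ∑' k, ((if k = 0 then 0 else ‖G ξ‖ₑ ^ 2 * (‖q ξ‖ₑ * ‖q (ξ + v k)‖ₑ)) +
          (if k = 0 then 0 else ‖G (ξ + v k)‖ₑ ^ 2 * (‖q ξ‖ₑ * ‖q (ξ + v k)‖ₑ))) := by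
        refine lintegral_mono fun ξ => ENNReal.tsum_le_tsum fun k => ?_
        split_ifs
        · simp
        · rw [enorm_mul, enorm_mul, ← add_mul]
          calc _ = (‖G ξ‖ₑ * ‖G (ξ + v k)‖ₑ) * (‖q ξ‖ₑ * ‖q (ξ + v k)‖ₑ) := by ring
            _ ≤ _ := by
              gcongr
              exact mul_le_sq_add_sq _ _
    _ = ∑' k, (I k + I (-k)) := by
        have madd : ∀ k : ℤ × ℤ, AEMeasurable (fun ξ =>
            (if k = 0 then 0 else ‖G ξ‖ₑ ^ 2 * (‖q ξ‖ₑ * ‖q (ξ + v k)‖ₑ)) +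
            (if k = 0 then 0 else ‖G (ξ + v k)‖ₑ ^ 2 * (‖q ξ‖ₑ * ‖q (ξ + v k)‖ₑ))) volume :=
          fun k => ((mI k).add (mI' k)).aemeasurable
        rw [lintegral_tsum madd]
        congr 1
        ext k
        rw [lintegral_add_left (mI k), swap]
    _ = 2 * ∑' k, I k := by
        have e : ∑' k, I (-k) = ∑' k, I k := (Equiv.neg (ℤ × ℤ)).tsum_eq I
        rw [ENNReal.tsum_add, e, two_mul]
    _ = _ := by
        rw [hI, ← lintegral_tsum fun k => (mI k).aemeasurable]
        congr 1
        refine lintegral_congr fun ξ => ?_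
        rw [← ENNReal.tsum_mul_left]
        congr 1
        ext k
        rw [mul_ite, mul_zero]

/-- By Peetre's inequality the product of two translated bumps is at most `4 · planeBump ω`,
wherever it is based, so the lattice sum supplies `c²`. Of the two factors `Q`, one is discarded by
`Q ≤ 1` and the other is kept as the weight to be summed over the generators. -/
theorem latticeOverlap_le_of_bound (hM : M.det ≠ 0) {c : ℝ} (hc : 0 < c) (hc1 : c ≤ 1)
    {q G : Plane → ℂ} (hq : Measurable q) (hG : Measurable G) {C : ℝ} {Q : Plane → ℝ}
    (hQ0 : ∀ η, 0 ≤ Q η) (hQ1 : ∀ η, Q η ≤ 1)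
    (hb : ∀ ξ, ‖q ξ‖ ≤ C * (Q (Matrix.toEuclideanLin (M⁻¹).transpose ξ) *
      planeBump (Matrix.toEuclideanLin (M⁻¹).transpose ξ))) :
    latticeOverlap M c (fun ξ => q ξ * G ξ) ≤ ENNReal.ofReal (16 * C ^ 2 * bumpSum ^ 2 * c ^ 2) *
      ∫⁻ ξ, ‖G ξ‖ₑ ^ 2 * ENNReal.ofReal (Q (Matrix.toEuclideanLin (M⁻¹).transpose ξ)) := by
  have point : ∀ ξ, ∑' k : ℤ × ℤ, (if k = 0 then 0 else ‖q ξ‖ₑ *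
      ‖q (ξ + Matrix.toEuclideanLin M.transpose (latticePoint c⁻¹ c⁻¹ k))‖ₑ) ≤
      ENNReal.ofReal (8 * C ^ 2 * bumpSum ^ 2 * c ^ 2) *
        ENNReal.ofReal (Q (Matrix.toEuclideanLin (M⁻¹).transpose ξ)) := by
    intro ξ
    set η := Matrix.toEuclideanLin (M⁻¹).transpose ξ with hη
    calc _ ≤ ∑' k : ℤ × ℤ, ENNReal.ofReal (4 * C ^ 2 * Q η) *
          (if k = 0 then 0 else ENNReal.ofReal (planeBump (latticePoint c⁻¹ c⁻¹ k))) := by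
          refine ENNReal.tsum_le_tsum fun k => ?_
          split_ifs with hk
          · simp
          set ω := latticePoint c⁻¹ c⁻¹ k
          have h1 := hb ξ
          have h2 := hb (ξ + Matrix.toEuclideanLin M.transpose ω)
          rw [dual_shift hM, ← hη] at h2
          rw [← ofReal_norm, ← ofReal_norm, ← ENNReal.ofReal_mul (norm_nonneg _),
            ← ENNReal.ofReal_mul (by have := hQ0 η; positivity)]
          refine ENNReal.ofReal_le_ofReal ?_
          have h3 := mul_le_mul h1 h2 (norm_nonneg _) ((norm_nonneg _).trans h1)
          refine h3.trans ?_
          have h4 := planeBump_mul_add_le η ω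
          have h5 : Q (η + ω) * (planeBump η * planeBump (η + ω)) ≤ 4 * planeBump ω := by
            refine le_trans ?_ h4
            exact mul_le_of_le_one_left
              (mul_pos (planeBump_pos _) (planeBump_pos _)).le (hQ1 _)
          have h6 := mul_le_mul_of_nonneg_left h5 (mul_nonneg (sq_nonneg C) (hQ0 η))
          calc _ = C ^ 2 * Q η * (Q (η + ω) * (planeBump η * planeBump (η + ω))) := by ring
            _ ≤ _ := h6
            _ = _ := by ring
      _ ≤ ENNReal.ofReal (4 * C ^ 2 * Q η) * ENNReal.ofReal (2 * c ^ 2 * bumpSum ^ 2) := by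
          rw [ENNReal.tsum_mul_left]
          gcongr
          exact tsum_planeBump_lattice_le hc hc1
      _ = _ := by
          rw [← ENNReal.ofReal_mul (by have := hQ0 η; positivity),
            ← ENNReal.ofReal_mul (by positivity)]
          congr 1
          ring
  refine (latticeOverlap_mul_le c hq hG).trans ?_
  have e : ENNReal.ofReal (16 * C ^ 2 * bumpSum ^ 2 * c ^ 2) =
      2 * ENNReal.ofReal (8 * C ^ 2 * bumpSum ^ 2 * c ^ 2) := by
    rw [← ENNReal.ofReal_ofNat 2, ← ENNReal.ofReal_mul (by norm_num)]
    congr 1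
    ring
  rw [e, mul_assoc]
  gcongr
  rw [← lintegral_const_mul' _ _ ENNReal.ofReal_ne_top]
  refine lintegral_mono fun ξ => ?_
  calc _ ≤ ‖G ξ‖ₑ ^ 2 * (ENNReal.ofReal (8 * C ^ 2 * bumpSum ^ 2 * c ^ 2) *
        ENNReal.ofReal (Q (Matrix.toEuclideanLin (M⁻¹).transpose ξ))) := by
        gcongr
        exact point ξ
    _ = _ := by ring

end Overlap

/-! ### Generator indices and their dual frequency variables -/

section BaseIndex

/-- The indices `(j, k, ι)` of the shearlet generators, without the translation parameter. -/
structure BaseIndex where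
  j : ℕ
  k : ℤ
  ι : SignType
  abs_mul_j : |(ι : ℤ)| * (j : ℤ) = j
  abs_k_le : |k| ≤ |(ι : ℤ)| * ⌈(2 : ℝ) ^ ((j : ℝ) / 2)⌉

/-- The generator index underlying a shearlet index. -/
def Index.base (l : Index) : BaseIndex := ⟨l.j, l.k, l.ι, l.abs_mul_j, l.abs_k_le⟩

/-- Splitting off the translation parameter. -/
def indexEquiv : Index ≃ BaseIndex × (ℤ × ℤ) where
  toFun l := (l.base, l.m)
  invFun p := ⟨p.1.j, p.1.k, p.2, p.1.ι, p.1.abs_mul_j, p.1.abs_k_le⟩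
  left_inv _ := rfl
  right_inv _ := rfl

namespace BaseIndex

theorem ext_fields {b b' : BaseIndex} (h : (b.ι, b.j, b.k) = (b'.ι, b'.j, b'.k)) : b = b' := by
  cases b
  cases b'
  simp only [Prod.mk.injEq] at h
  obtain ⟨rfl, rfl, rfl⟩ := h
  rfl

variable (b : BaseIndex)

/-- The matrix `1`, `S_k A_j` or `S_kᵀ Ã_j` of a generator index. -/
noncomputable def mat : Matrix (Fin 2) (Fin 2) ℝ :=
  match b.ι with
  | SignType.zero => 1
  | SignType.pos => shear b.k * scaling b.j
  | SignType.neg => (shear b.k).transpose * scaling' b.j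

theorem det_mat_ne_zero : b.mat.det ≠ 0 := by
  unfold mat
  split
  · simp
  · exact det_shear_mul_scaling _ _
  · exact det_shear_transpose_mul_scaling' _ _

theorem j_eq_zero (h : b.ι = SignType.zero) : b.j = 0 := by
  have := b.abs_mul_j
  rw [h] at this
  simpa using this.symm

theorem k_eq_zero (h : b.ι = SignType.zero) : b.k = 0 := by
  have := b.abs_k_le
  rw [h] at this
  simpa using this

/-- The normalisation `2^{3j/4}`. -/
noncomputable def scale : ℝ := (2 : ℝ) ^ (3 * (b.j : ℝ) / 4)

theorem scale_pos : 0 < b.scale := Real.rpow_pos_of_pos two_pos _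

/-- The root `2^{j/2}`. -/
noncomputable def root : ℝ := (2 : ℝ) ^ ((b.j : ℝ) / 2)

theorem root_pos : 0 < b.root := Real.rpow_pos_of_pos two_pos _

theorem root_sq : b.root ^ 2 = (2 : ℝ) ^ b.j := by
  rw [root, ← Real.rpow_natCast, ← Real.rpow_mul two_pos.le, ← Real.rpow_natCast]
  congr 1
  push_cast
  ring

theorem one_le_root : 1 ≤ b.root := Real.one_le_rpow one_le_two (by positivity)

/-- Both sides are `2^{3j/2}`: the dilations are `L²`-normalized, so determinants cancel from all
later estimates. -/
theorem abs_det_mat : |b.mat.det| = b.scale ^ 2 := by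
  have h : (2 : ℝ) ^ b.j * (2 : ℝ) ^ ((b.j : ℝ) / 2) = b.scale ^ 2 := by
    rw [scale, ← Real.rpow_natCast, ← Real.rpow_natCast, ← Real.rpow_mul two_pos.le,
      ← Real.rpow_add two_pos]
    congr 1
    push_cast
    ring
  unfold mat
  split
  next h0 =>
    rw [← h, b.j_eq_zero h0]
    simp
  · rw [← h, abs_of_pos]
    · simp [shear, scaling, Matrix.det_fin_two]
    · simp [shear, scaling, Matrix.det_fin_two]
      positivity
  · rw [← h, abs_of_pos]
    · simp [shear, scaling', Matrix.det_fin_two, mul_comm]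
    · simp [shear, scaling', Matrix.det_fin_two]
      positivity

/-- The frequency variable `M⁻ᵀ ξ` of a generator. -/
noncomputable def dual (ξ : Plane) : Plane := Matrix.toEuclideanLin (b.mat⁻¹).transpose ξ

theorem dual_of_zero (h : b.ι = SignType.zero) (ξ : Plane) : b.dual ξ = ξ := by
  have : b.mat = 1 := by rw [mat, h]
  rw [dual, this]
  simp

theorem inv_mat_of_pos (h : b.ι = SignType.pos) :
    b.mat⁻¹ = !![((2 : ℝ) ^ b.j)⁻¹, -b.k * ((2 : ℝ) ^ b.j)⁻¹; 0, b.root⁻¹] := by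
  have hr := b.root_pos.ne'
  have : b.mat = !![(2 : ℝ) ^ b.j, b.k * b.root; 0, b.root] := by
    rw [mat, h]
    simp [shear, scaling, root]
  rw [this]
  refine Matrix.inv_eq_right_inv ?_
  ext i j
  fin_cases i <;> fin_cases j <;> simp [Matrix.mul_apply, Fin.sum_univ_two, hr]
  field_simp
  ring

theorem inv_mat_of_neg (h : b.ι = SignType.neg) :
    b.mat⁻¹ = !![b.root⁻¹, 0; -b.k * ((2 : ℝ) ^ b.j)⁻¹, ((2 : ℝ) ^ b.j)⁻¹] := by
  have hr := b.root_pos.ne'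
  have : b.mat = !![b.root, 0; b.k * b.root, (2 : ℝ) ^ b.j] := by
    rw [mat, h]
    ext i j
    fin_cases i <;> fin_cases j <;>
      simp [shear, scaling', root, Matrix.mul_apply, Fin.sum_univ_two]
  rw [this]
  refine Matrix.inv_eq_right_inv ?_
  ext i j
  fin_cases i <;> fin_cases j <;> simp [Matrix.mul_apply, Fin.sum_univ_two, hr]
  field_simp
  ring

theorem dual_of_pos (h : b.ι = SignType.pos) (ξ : Plane) :
    (b.dual ξ) 0 = ((2 : ℝ) ^ b.j)⁻¹ * ξ 0 ∧
      (b.dual ξ) 1 = b.root⁻¹ * ξ 1 - b.k * (((2 : ℝ) ^ b.j)⁻¹ * ξ 0) := by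
  simp only [dual, b.inv_mat_of_pos h, toEuclideanLin_apply_zero, toEuclideanLin_apply_one,
    Matrix.transpose_apply]
  simp
  ring

theorem dual_of_neg (h : b.ι = SignType.neg) (ξ : Plane) :
    (b.dual ξ) 0 = b.root⁻¹ * ξ 0 - b.k * (((2 : ℝ) ^ b.j)⁻¹ * ξ 1) ∧
      (b.dual ξ) 1 = ((2 : ℝ) ^ b.j)⁻¹ * ξ 1 := by
  simp only [dual, b.inv_mat_of_neg h, toEuclideanLin_apply_zero, toEuclideanLin_apply_one,
    Matrix.transpose_apply]
  simp
  ring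

theorem measurable_dual : Measurable b.dual := (continuous_toEuclideanLin _).measurable

theorem det_inv_transpose_ne_zero : (b.mat⁻¹).transpose.det ≠ 0 := by
  simpa [Matrix.det_nonsing_inv] using b.det_mat_ne_zero

theorem abs_k_le_two_mul_root : |(b.k : ℝ)| ≤ 2 * b.root := by
  have h1 : |b.k| ≤ ⌈b.root⌉ := by
    refine b.abs_k_le.trans ?_
    have h2 : |(b.ι : ℤ)| ≤ 1 := by cases b.ι <;> simp
    exact mul_le_of_le_one_left (Int.ceil_nonneg b.root_pos.le) h2
  have h3 : |(b.k : ℝ)| ≤ (⌈b.root⌉ : ℝ) := by exact_mod_cast h1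
  linarith [Int.ceil_lt_add_one b.root, b.one_le_root]

theorem root_le_two_pow : b.root ≤ (2 : ℝ) ^ b.j := by
  rw [← b.root_sq]
  nlinarith [b.one_le_root]

/-- The range of shears matters here: inverting the shear produces `k · 2^{j/2} t`, and `|k| ≤ 2 ·
2^{j/2}` keeps this within `2 · 2^j |t|`. -/
theorem abs_shear_le {x y t u : ℝ} (h0 : t = ((2 : ℝ) ^ b.j)⁻¹ * x)
    (h1 : u = b.root⁻¹ * y - b.k * (((2 : ℝ) ^ b.j)⁻¹ * x)) :
    |x| ≤ 2 * 2 ^ b.j * (|t| + |u|) ∧ |y| ≤ 2 * 2 ^ b.j * (|t| + |u|) := by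
  have hp : (0 : ℝ) < 2 ^ b.j := by positivity
  have hr := b.root_pos
  have ex : x = 2 ^ b.j * t := by rw [h0]; field_simp
  have ey : y = b.root * (u + b.k * t) := by rw [h1, ← h0]; field_simp; ring
  constructor
  · rw [ex, abs_mul, abs_of_pos hp]
    nlinarith [mul_nonneg hp.le (abs_nonneg t), mul_nonneg hp.le (abs_nonneg u)]
  · rw [ey, abs_mul, abs_of_pos hr]
    have h2 : |u + b.k * t| ≤ |u| + 2 * b.root * |t| := by
      refine (abs_add_le _ _).trans ?_
      rw [abs_mul]
      gcongr
      exact b.abs_k_le_two_mul_root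
    have h3 := mul_le_mul_of_nonneg_left h2 hr.le
    have h4 : b.root * (2 * b.root * |t|) = 2 * 2 ^ b.j * |t| := by rw [← b.root_sq]; ring
    have h5 := mul_le_mul_of_nonneg_right b.root_le_two_pow (abs_nonneg u)
    nlinarith [mul_nonneg hp.le (abs_nonneg u)]

theorem abs_coord_le (ξ : Plane) (i : Fin 2) :
    |ξ i| ≤ 2 * 2 ^ b.j * (|(b.dual ξ) 0| + |(b.dual ξ) 1|) := by
  have key : |ξ 0| ≤ 2 * 2 ^ b.j * (|(b.dual ξ) 0| + |(b.dual ξ) 1|) ∧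
      |ξ 1| ≤ 2 * 2 ^ b.j * (|(b.dual ξ) 0| + |(b.dual ξ) 1|) := by
    rcases h : b.ι with _ | _ | _
    · rw [b.dual_of_zero h, b.j_eq_zero h]
      constructor <;> nlinarith [abs_nonneg (ξ 0), abs_nonneg (ξ 1)]
    · obtain ⟨h0, h1⟩ := b.dual_of_neg h ξ
      have := b.abs_shear_le h1 h0
      rw [add_comm] at this
      exact this.symm
    · obtain ⟨h0, h1⟩ := b.dual_of_pos h ξ
      exact b.abs_shear_le h0 h1
  fin_cases i
  · exact key.1
  · exact key.2

end BaseIndex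

/-- The generators as a family indexed by `ι ∈ {-1, 0, 1}`. -/
noncomputable def generator (φ ψ ψ' : L2Plane) : SignType → L2Plane
  | SignType.zero => φ
  | SignType.pos => ψ
  | SignType.neg => ψ'

/-- For `ι = 0` the index set forces `j = 0`, so the normalization and the matrix are trivial and
all three cases share one formula. -/
theorem system_eq (φ ψ ψ' : L2Plane) (c : ℝ) (l : Index) :
    system φ ψ ψ' c c l = ((l.base.scale : ℝ) : ℂ) •
      affineComp l.base.mat l.base.det_mat_ne_zero (latticePoint c c l.m)
        (generator φ ψ ψ' l.ι) := by
  obtain ⟨j, k, m, ι, hj, hk⟩ := l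
  cases ι with
  | zero =>
    have h0 : (j : ℤ) = 0 := by simpa using hj.symm
    obtain rfl : j = 0 := by exact_mod_cast h0
    simp [system, Index.base, BaseIndex.scale, generator, BaseIndex.mat]
  | pos => rfl
  | neg => rfl

theorem fourier_system {φ ψ ψ' : L2Plane} {F : SignType → Plane → ℂ}
    (hF : ∀ ι, Integrable (F ι))
    (h : ∀ ι, (𝓕 (generator φ ψ ψ' ι) : L2Plane) =ᵐ[volume] F ι) (c : ℝ) (l : Index) :
    (𝓕 (system φ ψ ψ' c c l) : L2Plane) =ᵐ[volume] fun ξ =>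
      (l.base.scale⁻¹ : ℝ) *
        (Real.fourierChar (-inner ℝ (l.base.dual ξ) (latticePoint c c l.m)) : ℂ) *
        F l.ι (l.base.dual ξ) := by
  rw [system_eq, FourierTransform.fourier_smul]
  filter_upwards [Lp.coeFn_smul ((l.base.scale : ℝ) : ℂ) (𝓕 (affineComp l.base.mat
    l.base.det_mat_ne_zero (latticePoint c c l.m) (generator φ ψ ψ' l.ι)) : L2Plane),
    fourier_affineComp l.base.det_mat_ne_zero (latticePoint c c l.m) (hF l.ι) (h l.ι)] with ξ h1 h2
  rw [h1, Pi.smul_apply, h2, l.base.abs_det_mat, smul_eq_mul]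
  have hs : ((l.base.scale : ℝ) : ℂ) ≠ 0 := by exact_mod_cast l.base.scale_pos.ne'
  simp only [BaseIndex.dual]
  push_cast
  field_simp

end BaseIndex

/-! ### Summability of the majorant over scales and shears -/

section Majorant

/-- The majorant of the generators in frequency: decay in both variables, and vanishing moments in
the variable singled out by `ι`. -/
noncomputable def majorant (ι : SignType) (η : Plane) : ℝ :=
  match ι with
  | SignType.zero => planeBump η
  | SignType.pos => η 0 ^ 4 * bump (η 0) ^ 2 * planeBump η
  | SignType.neg => η 1 ^ 4 * bump (η 1) ^ 2 * planeBump η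

theorem majorant_nonneg (ι : SignType) (η : Plane) : 0 ≤ majorant ι η := by
  have := (planeBump_pos η).le
  cases ι
  · exact this
  · exact mul_nonneg (by positivity) this
  · exact mul_nonneg (by positivity) this

theorem majorant_le_one (ι : SignType) (η : Plane) : majorant ι η ≤ 1 := by
  have h : ∀ t : ℝ, t ^ 4 * bump t ^ 2 ≤ 1 := fun t => by
    have := pow_le_one₀ (n := 2) (mul_nonneg (sq_nonneg t) (bump_pos t).le) (sq_mul_bump_le_one t)
    calc _ = (t ^ 2 * bump t) ^ 2 := by ring
      _ ≤ 1 := this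
  cases ι
  · exact planeBump_le_one η
  · exact mul_le_one₀ (h _) (planeBump_pos _).le (planeBump_le_one η)
  · exact mul_le_one₀ (h _) (planeBump_pos _).le (planeBump_le_one η)

/-- With `t = 2^{-j} x`, split the term into `t² bump(t)²` and `t² bump(t) bump(y j - k t)`. The
second factor sums over `k` uniformly in `y` and `t`; the first then sums over the dyadic scales.
Each sum consumes two of the four vanishing moments. -/
theorem tsum_shear_majorant_le (x : ℝ) (y : ℕ → ℝ) :
    ∑' j : ℕ, ∑' k : ℤ, ENNReal.ofReal ((((2 : ℝ) ^ j)⁻¹ * x) ^ 4 * bump (((2 : ℝ) ^ j)⁻¹ * x) ^ 2 *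
      (bump (((2 : ℝ) ^ j)⁻¹ * x) * bump (y j - k * (((2 : ℝ) ^ j)⁻¹ * x)))) ≤
      ENNReal.ofReal (4 / 3) * ENNReal.ofReal (4 * bumpSum) := by
  refine le_trans (ENNReal.tsum_le_tsum fun j => ?_)
    ((ENNReal.tsum_mul_right).trans_le (mul_le_mul_left (tsum_dyadic_le x) _))
  set t := ((2 : ℝ) ^ j)⁻¹ * x
  calc _ = ∑' k : ℤ, ENNReal.ofReal (t ^ 2 * bump t ^ 2) *
        ENNReal.ofReal (t ^ 2 * bump t * bump (y j - k * t)) := by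
        congr 1
        ext k
        rw [← ENNReal.ofReal_mul (by positivity)]
        congr 1
        ring
    _ ≤ _ := by
        rw [ENNReal.tsum_mul_left]
        gcongr
        exact tsum_bump_sub_mul_le _ _

/-- The constant bounding `∑ majorant` over all generator indices. -/
noncomputable def majorantSum : ℝ := 1 + 2 * (4 / 3 * (4 * bumpSum))

theorem majorantSum_nonneg : 0 ≤ majorantSum := by
  have := bumpSum_nonneg
  unfold majorantSum
  positivity

theorem tsum_majorant_le (ξ : Plane) :
    ∑' b : BaseIndex, ENNReal.ofReal (majorant b.ι (b.dual ξ)) ≤ ENNReal.ofReal majorantSum := by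
  -- The constraint on `k` is dropped and the sum is enlarged to all of `SignType × ℕ × ℤ`; for `ι =
  -- 0` only the entry `(0, 0)` is kept.
  set f : SignType × ℕ × ℤ → ℝ≥0∞ := fun p =>
    match p.1 with
    | SignType.zero => if p.2 = 0 then 1 else 0
    | SignType.pos => ENNReal.ofReal ((((2 : ℝ) ^ p.2.1)⁻¹ * ξ 0) ^ 4 *
        bump (((2 : ℝ) ^ p.2.1)⁻¹ * ξ 0) ^ 2 * (bump (((2 : ℝ) ^ p.2.1)⁻¹ * ξ 0) *
        bump (((2 : ℝ) ^ ((p.2.1 : ℝ) / 2))⁻¹ * ξ 1 - p.2.2 * (((2 : ℝ) ^ p.2.1)⁻¹ * ξ 0))))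
    | SignType.neg => ENNReal.ofReal ((((2 : ℝ) ^ p.2.1)⁻¹ * ξ 1) ^ 4 *
        bump (((2 : ℝ) ^ p.2.1)⁻¹ * ξ 1) ^ 2 * (bump (((2 : ℝ) ^ p.2.1)⁻¹ * ξ 1) *
        bump (((2 : ℝ) ^ ((p.2.1 : ℝ) / 2))⁻¹ * ξ 0 - p.2.2 * (((2 : ℝ) ^ p.2.1)⁻¹ * ξ 1))))
    with hf
  have hle : ∀ b : BaseIndex, ENNReal.ofReal (majorant b.ι (b.dual ξ)) ≤ f (b.ι, b.j, b.k) := by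
    intro b
    rcases h : b.ι with _ | _ | _
    · have : ((b.j, b.k) : ℕ × ℤ) = 0 := by rw [b.j_eq_zero h, b.k_eq_zero h]; rfl
      simp only [hf, this, if_true]
      exact ENNReal.ofReal_le_one.2 (majorant_le_one _ _)
    · obtain ⟨h0, h1⟩ := b.dual_of_neg h ξ
      simp only [hf, majorant, planeBump, h0, h1, BaseIndex.root]
      rw [mul_comm (bump (_ - _))]
    · obtain ⟨h0, h1⟩ := b.dual_of_pos h ξ
      simp only [hf, majorant, planeBump, h0, h1, BaseIndex.root]
      exact le_rfl
  have hinj : Function.Injective fun b : BaseIndex => (b.ι, b.j, b.k) :=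
    fun b b' h => BaseIndex.ext_fields h
  refine (ENNReal.tsum_le_tsum hle).trans
    ((ENNReal.tsum_comp_le_tsum_of_injective hinj f).trans ?_)
  rw [ENNReal.tsum_prod', tsum_fintype]
  have huniv : (Finset.univ : Finset SignType) = {SignType.zero, SignType.neg, SignType.pos} := rfl
  rw [huniv, Finset.sum_insert (by decide), Finset.sum_insert (by decide), Finset.sum_singleton]
  have hb := bumpSum_nonneg
  have e : ENNReal.ofReal majorantSum = 1 + (ENNReal.ofReal (4 / 3) * ENNReal.ofReal (4 * bumpSum) +
      ENNReal.ofReal (4 / 3) * ENNReal.ofReal (4 * bumpSum)) := by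
    rw [← ENNReal.ofReal_mul (by positivity), ← ENNReal.ofReal_add (by positivity) (by positivity),
      ← ENNReal.ofReal_one, ← ENNReal.ofReal_add (by positivity) (by positivity), majorantSum]
    congr 1
    ring
  rw [e]
  refine add_le_add ?_ (add_le_add ?_ ?_)
  · simp [hf]
  · rw [ENNReal.tsum_prod']
    exact tsum_shear_majorant_le (ξ 1) fun j => ((2 : ℝ) ^ ((j : ℝ) / 2))⁻¹ * ξ 0
  · rw [ENNReal.tsum_prod']
    exact tsum_shear_majorant_le (ξ 0) fun j => ((2 : ℝ) ^ ((j : ℝ) / 2))⁻¹ * ξ 1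

end Majorant

/-! ### The Sobolev weight in dual variables -/

section Weight

theorem norm_derivSymbol (a₁ a₂ : ℕ) (ξ : Plane) :
    ‖derivSymbol a₁ a₂ ξ‖ = (2 * Real.pi * |ξ 0|) ^ a₁ * (2 * Real.pi * |ξ 1|) ^ a₂ := by
  simp [derivSymbol, abs_of_pos Real.pi_pos]

theorem continuous_derivSymbol (a₁ a₂ : ℕ) : Continuous (derivSymbol a₁ a₂) := by
  unfold derivSymbol
  fun_prop

/-- The Fourier weight `∑_{|a| ≤ s} |(2πiξ)^a|²` of the `H^s` inner product. -/
noncomputable def sobolevWeight (s : ℕ) (ξ : Plane) : ℝ :=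
  ∑ a : MultiIndex s, ‖derivSymbol a.1.1 a.1.2 ξ‖ ^ 2

theorem continuous_sobolevWeight (s : ℕ) : Continuous (sobolevWeight s) :=
  continuous_finsetSum _ fun _ _ => (continuous_derivSymbol _ _).norm.pow 2

theorem norm_derivSymbol_sq_le_sobolevWeight {s : ℕ} (a : MultiIndex s) (ξ : Plane) :
    ‖derivSymbol a.1.1 a.1.2 ξ‖ ^ 2 ≤ sobolevWeight s ξ :=
  Finset.single_le_sum (f := fun a : MultiIndex s => ‖derivSymbol a.1.1 a.1.2 ξ‖ ^ 2)
    (fun _ _ => sq_nonneg _) (Finset.mem_univ a)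

theorem one_le_sobolevWeight (s : ℕ) (ξ : Plane) : 1 ≤ sobolevWeight s ξ := by
  have := norm_derivSymbol_sq_le_sobolevWeight (MultiIndex.origin s) ξ
  simpa [norm_derivSymbol, MultiIndex.origin] using this

theorem abs_pow_sq_le_sobolevWeight (s : ℕ) (ξ : Plane) (i : Fin 2) :
    (|ξ i| ^ s) ^ 2 ≤ sobolevWeight s ξ := by
  have h2π : (1 : ℝ) ≤ 2 * Real.pi := by linarith [Real.pi_gt_three]
  have hle : |ξ i| ^ s ≤ (2 * Real.pi * |ξ i|) ^ s := by
    gcongr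
    exact le_mul_of_one_le_left (abs_nonneg _) h2π
  refine (pow_le_pow_left₀ (by positivity) hle 2).trans ?_
  fin_cases i
  · have := norm_derivSymbol_sq_le_sobolevWeight
      (⟨(Fin.last s, 0), by simp⟩ : MultiIndex s) ξ
    simpa [norm_derivSymbol] using this
  · have := norm_derivSymbol_sq_le_sobolevWeight
      (⟨(0, Fin.last s), by simp⟩ : MultiIndex s) ξ
    simpa [norm_derivSymbol] using this

/-- The product `(1 + |η₁|) (1 + |η₂|)`. -/
noncomputable def growth (η : Plane) : ℝ := (1 + |η 0|) * (1 + |η 1|)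

theorem abs_le_growth (η : Plane) (i : Fin 2) : |η i| ≤ growth η := by
  have h0 := abs_nonneg (η 0)
  have h1 := abs_nonneg (η 1)
  fin_cases i
  · show |η 0| ≤ (1 + |η 0|) * (1 + |η 1|)
    nlinarith [mul_nonneg h0 h1]
  · show |η 1| ≤ (1 + |η 0|) * (1 + |η 1|)
    nlinarith [mul_nonneg h0 h1]

theorem one_le_growth (η : Plane) : 1 ≤ growth η := by
  have h0 := abs_nonneg (η 0)
  have h1 := abs_nonneg (η 1)
  unfold growth
  nlinarith [mul_nonneg h0 h1]

/-- The comparison constant between the Sobolev weight and `growth`. -/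
noncomputable def weightConst (s : ℕ) : ℝ :=
  Real.sqrt (Fintype.card (MultiIndex s)) * (4 * Real.pi) ^ s

theorem weightConst_nonneg (s : ℕ) : 0 ≤ weightConst s := by
  have := Real.pi_pos
  unfold weightConst
  positivity

/-- The coordinates of `ξ` are at most a multiple of `2^j` times the growth of its dual variable, so
the weight costs `2^{js}`, which the normalization `2^{-js}` cancels, and `s` powers of `growth`. -/
theorem sqrt_sobolevWeight_le (s : ℕ) (b : BaseIndex) (ξ : Plane) :
    Real.sqrt (sobolevWeight s ξ) ≤ weightConst s * (2 ^ b.j) ^ s * growth (b.dual ξ) ^ s := by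
  have hπ := Real.pi_pos
  set X := growth (b.dual ξ) with hX
  have hX1 : 1 ≤ X := one_le_growth _
  have hp : (1 : ℝ) ≤ 2 ^ b.j := one_le_pow₀ one_le_two
  have hsum : |(b.dual ξ) 0| + |(b.dual ξ) 1| ≤ X := by
    have h0 := abs_nonneg ((b.dual ξ) 0)
    have h1 := abs_nonneg ((b.dual ξ) 1)
    rw [hX, growth]
    nlinarith [mul_nonneg h0 h1]
  set Y := 4 * Real.pi * 2 ^ b.j * X with hY
  have hY1 : 1 ≤ Y := by
    have h1 : (1 : ℝ) ≤ 4 * Real.pi := by linarith [Real.pi_gt_three]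
    exact one_le_mul_of_one_le_of_one_le (one_le_mul_of_one_le_of_one_le h1 hp) hX1
  have hcoord : ∀ i, 2 * Real.pi * |ξ i| ≤ Y := by
    intro i
    have h := b.abs_coord_le ξ i
    have h' : |ξ i| ≤ 2 * 2 ^ b.j * X := h.trans (by gcongr)
    calc 2 * Real.pi * |ξ i| ≤ 2 * Real.pi * (2 * 2 ^ b.j * X) := by gcongr
      _ = Y := by rw [hY]; ring
  have hterm : ∀ a : MultiIndex s, ‖derivSymbol a.1.1 a.1.2 ξ‖ ^ 2 ≤ (Y ^ s) ^ 2 := by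
    intro a
    refine pow_le_pow_left₀ (norm_nonneg _) ?_ 2
    rw [norm_derivSymbol]
    calc _ ≤ Y ^ (a.1.1 : ℕ) * Y ^ (a.1.2 : ℕ) := by
          gcongr
          · exact hcoord 0
          · exact hcoord 1
      _ = Y ^ ((a.1.1 : ℕ) + (a.1.2 : ℕ)) := (pow_add _ _ _).symm
      _ ≤ Y ^ s := pow_le_pow_right₀ hY1 a.2
  have hw : sobolevWeight s ξ ≤ Fintype.card (MultiIndex s) * (Y ^ s) ^ 2 := by
    refine (Finset.sum_le_sum fun a _ => hterm a).trans ?_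
    simp
  refine (Real.sqrt_le_sqrt hw).trans (le_of_eq ?_)
  rw [Real.sqrt_mul (by positivity), Real.sqrt_sq (by positivity), weightConst, hY, mul_pow,
    mul_pow]
  ring

end Weight

/-! ### The Sobolev space on the Fourier side -/

section SobolevFourier

theorem ofReal_norm_sq_eq_lintegral {X : Type*} [MeasurableSpace X] {ν : Measure X}
    (f : Lp ℂ 2 ν) : ENNReal.ofReal (‖f‖ ^ 2) = ∫⁻ x, ‖f x‖ₑ ^ 2 ∂ν := by
  rw [ENNReal.ofReal_pow (norm_nonneg _), ofReal_norm, Lp.enorm_def,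
    eLpNorm_eq_lintegral_rpow_enorm_toReal (by norm_num) (by norm_num)]
  simp only [ENNReal.toReal_ofNat, ENNReal.rpow_ofNat]
  rw [← ENNReal.rpow_natCast, ← ENNReal.rpow_mul]
  norm_num

variable {s : ℕ}

theorem SobolevSpace.fourier_apply (F : SobolevSpace s) (a : MultiIndex s) :
    (𝓕 ((F : PiLp 2 fun _ : MultiIndex s => L2Plane) a) : L2Plane) =ᵐ[volume]
      fun ξ => derivSymbol a.1.1 a.1.2 ξ * (𝓕 (SobolevSpace.toL2 F) : L2Plane) ξ :=
  (isWeakDerivPlane_iff _ _ _ _).1 (F.2 a)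

theorem SobolevSpace.ofReal_norm_sq (F : SobolevSpace s) :
    ENNReal.ofReal (‖F‖ ^ 2) =
      ∫⁻ ξ, ‖((Real.sqrt (sobolevWeight s ξ) : ℝ) : ℂ) * (𝓕 (SobolevSpace.toL2 F) : L2Plane) ξ‖ₑ ^ 2 := by
  have h1 : ‖F‖ ^ 2 = ∑ a, ‖(F : PiLp 2 fun _ : MultiIndex s => L2Plane) a‖ ^ 2 := by
    rw [Submodule.coe_norm, PiLp.norm_sq_eq_of_L2]
  rw [h1, ENNReal.ofReal_sum_of_nonneg fun _ _ => sq_nonneg _]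
  have h2 : ∀ a : MultiIndex s,
      ENNReal.ofReal (‖(F : PiLp 2 fun _ : MultiIndex s => L2Plane) a‖ ^ 2) =
      ∫⁻ ξ, ENNReal.ofReal (‖derivSymbol a.1.1 a.1.2 ξ‖ ^ 2) * ‖(𝓕 (SobolevSpace.toL2 F) : L2Plane) ξ‖ₑ ^ 2 := by
    intro a
    rw [← Lp.norm_fourier_eq, ofReal_norm_sq_eq_lintegral]
    refine lintegral_congr_ae ?_
    filter_upwards [SobolevSpace.fourier_apply F a] with ξ h
    rw [h, enorm_mul, mul_pow, ENNReal.ofReal_pow (norm_nonneg _), ofReal_norm]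
  have mF : Measurable fun ξ => ‖(𝓕 (SobolevSpace.toL2 F) : L2Plane) ξ‖ₑ ^ 2 :=
    (Lp.stronglyMeasurable _).measurable.enorm.pow_const 2
  have mterm : ∀ a ∈ (Finset.univ : Finset (MultiIndex s)), AEMeasurable (fun ξ =>
      ENNReal.ofReal (‖derivSymbol a.1.1 a.1.2 ξ‖ ^ 2) *
        ‖(𝓕 (SobolevSpace.toL2 F) : L2Plane) ξ‖ₑ ^ 2) volume := fun a _ =>
    ((ENNReal.measurable_ofReal.comp
      ((continuous_derivSymbol _ _).norm.pow 2).measurable).mul mF).aemeasurable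
  simp only [h2]
  rw [← lintegral_finsetSum' _ mterm]
  refine lintegral_congr fun ξ => ?_
  rw [← Finset.sum_mul, enorm_mul, mul_pow, ← ENNReal.ofReal_sum_of_nonneg fun _ _ => sq_nonneg _]
  congr 1
  rw [← ofReal_norm, Complex.norm_real, Real.norm_of_nonneg (Real.sqrt_nonneg _),
    ← ENNReal.ofReal_pow (Real.sqrt_nonneg _), Real.sq_sqrt]
  · rfl
  · linarith [one_le_sobolevWeight s ξ]

theorem SobolevSpace.inner_eq_integral (Φ F : SobolevSpace s) :
    inner ℂ Φ F = ∫ ξ, starRingEnd ℂ ((𝓕 (SobolevSpace.toL2 Φ) : L2Plane) ξ) *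
      ((sobolevWeight s ξ : ℝ) : ℂ) * (𝓕 (SobolevSpace.toL2 F) : L2Plane) ξ := by
  rw [Submodule.coe_inner, PiLp.inner_apply]
  have h2 : ∀ a : MultiIndex s,
      inner ℂ ((Φ : PiLp 2 fun _ : MultiIndex s => L2Plane) a)
        ((F : PiLp 2 fun _ : MultiIndex s => L2Plane) a) =
      ∫ ξ, inner ℂ ((𝓕 ((Φ : PiLp 2 fun _ : MultiIndex s => L2Plane) a) : L2Plane) ξ)
        ((𝓕 ((F : PiLp 2 fun _ : MultiIndex s => L2Plane) a) : L2Plane) ξ) := by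
    intro a
    rw [← Lp.inner_fourier_eq, L2.inner_def]
  simp only [h2]
  rw [← integral_finsetSum _ fun a _ => L2.integrable_inner _ _]
  refine integral_congr_ae ?_
  filter_upwards [ae_all_iff.2 (SobolevSpace.fourier_apply Φ), ae_all_iff.2 (SobolevSpace.fourier_apply F)] with ξ h h'
  simp only [h, h', RCLike.inner_apply, map_mul, sobolevWeight]
  push_cast
  rw [Finset.mul_sum, Finset.sum_mul]
  refine Finset.sum_congr rfl fun a _ => ?_
  have : ((‖derivSymbol a.1.1 a.1.2 ξ‖ : ℂ)) ^ 2 =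
      derivSymbol a.1.1 a.1.2 ξ * starRingEnd ℂ (derivSymbol a.1.1 a.1.2 ξ) :=
    (Complex.mul_conj' _).symm
  rw [this]
  ring

/-- The derivatives are defined by their transforms; at the multi-index `(0, 0)` the symbol is `1`,
so that component is `f` itself. -/
theorem SobolevSpace.exists_toL2_eq (f : L2Plane)
    (h : ∀ a : MultiIndex s,
      MemLp (fun ξ => derivSymbol a.1.1 a.1.2 ξ * (𝓕 f : L2Plane) ξ) 2 volume) :
    ∃ F : SobolevSpace s, (SobolevSpace.toL2 F) = f := by
  have h0 : (𝓕⁻ ((h (MultiIndex.origin s)).toLp _) : L2Plane) = f := by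
    have : (h (MultiIndex.origin s)).toLp _ = (𝓕 f : L2Plane) := by
      refine Lp.ext ((h _).coeFn_toLp.trans (ae_of_all _ fun ξ => ?_))
      simp [derivSymbol, MultiIndex.origin]
    rw [this, FourierTransform.fourierInv_fourier_eq]
  refine ⟨⟨WithLp.toLp 2 fun a => 𝓕⁻ ((h a).toLp _), fun a => ?_⟩, h0⟩
  rw [isWeakDerivPlane_iff]
  change (𝓕 (𝓕⁻ ((h a).toLp _) : L2Plane) : L2Plane) =ᵐ[volume] fun ξ =>
    derivSymbol a.1.1 a.1.2 ξ *
      (𝓕 (𝓕⁻ ((h (MultiIndex.origin s)).toLp _) : L2Plane) : L2Plane) ξ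
  rw [h0, FourierTransform.fourier_fourierInv_eq]
  exact (h a).coeFn_toLp

end SobolevFourier

/-! ### Coefficient sums of a single generator and of the whole system -/

section GeneratorEstimate

instance : Countable BaseIndex :=
  Function.Injective.countable (f := fun b : BaseIndex => (b.ι, b.j, b.k))
    fun _ _ h => BaseIndex.ext_fields h

theorem integrable_planeBump : Integrable planeBump := by
  have h : Integrable fun t : ℝ => ((bump t : ℝ) : ℂ) := by
    have := integrable_inv_one_add_sq
    exact this.ofReal
  have := integrable_plane_mul h h
  have e : (fun x : Plane => ((bump (x 0) : ℝ) : ℂ) * ((bump (x 1) : ℝ) : ℂ)) =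
      fun x => ((planeBump x : ℝ) : ℂ) := by
    ext x
    simp [planeBump]
  rw [e] at this
  simpa using this.re

theorem integrable_of_le_planeBump {q : Plane → ℂ} (hq : Measurable q) {C : ℝ}
    (h : ∀ η, ‖q η‖ ≤ C * planeBump η) : Integrable q :=
  (integrable_planeBump.const_mul C).mono' hq.aestronglyMeasurable (ae_of_all _ h)

theorem memLp_two_of_le_planeBump {q : Plane → ℂ} (hq : Measurable q) {C : ℝ}
    (h : ∀ η, ‖q η‖ ≤ C * planeBump η) : MemLp q 2 := by
  have hC : 0 ≤ C := by
    have := (norm_nonneg _).trans (h 0)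
    exact nonneg_of_mul_nonneg_left this (planeBump_pos 0)
  rw [memLp_two_iff_integrable_sq_norm hq.aestronglyMeasurable]
  refine (integrable_planeBump.const_mul (C ^ 2)).mono'
    (hq.norm.pow_const 2).aestronglyMeasurable (ae_of_all _ fun η => ?_)
  rw [norm_pow, norm_norm]
  calc ‖q η‖ ^ 2 ≤ (C * planeBump η) ^ 2 := pow_le_pow_left₀ (norm_nonneg _) (h η) 2
    _ = C ^ 2 * (planeBump η * planeBump η) := by ring
    _ ≤ C ^ 2 * planeBump η := by
      gcongr
      exact mul_le_of_le_one_left (planeBump_pos _).le (planeBump_le_one _)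

theorem memLp_two_of_le_planeBump_dual (b : BaseIndex) {q : Plane → ℂ} (hq : Measurable q) {C : ℝ}
    (h : ∀ ξ, ‖q ξ‖ ≤ C * planeBump (b.dual ξ)) : MemLp q 2 := by
  have h1 : MemLp (fun η : Plane => ((planeBump η : ℝ) : ℂ)) 2 := by
    refine memLp_two_of_le_planeBump (C := 1) ?_ fun η => ?_
    · have := continuous_bump
      exact Complex.measurable_ofReal.comp (by unfold planeBump; fun_prop : Continuous planeBump).measurable
    · rw [Complex.norm_real, Real.norm_of_nonneg (planeBump_pos _).le, one_mul]
  refine (memLp_comp_toEuclideanLin b.det_inv_transpose_ne_zero h1).of_le_mul (c := C)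
    hq.aestronglyMeasurable (ae_of_all _ fun ξ => ?_)
  rw [Complex.norm_real, Real.norm_of_nonneg (planeBump_pos _).le]
  exact h ξ

/-- Square sum over the translation parameter of the coefficients of `G` against a generator with
frequency profile `q`. -/
noncomputable def generatorSum (b : BaseIndex) (c : ℝ) (q G : Plane → ℂ) : ℝ≥0∞ :=
  ∑' m : ℤ × ℤ, ‖∫ ξ, (Real.fourierChar (inner ℝ (b.dual ξ) (latticePoint c c m)) : ℂ) *
    (((b.scale⁻¹ : ℝ) : ℂ) * q ξ * G ξ)‖ₑ ^ 2

/-- The constant controlling all the overlap terms. -/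
noncomputable def overlapConst (C : ℝ) : ℝ := 16 * C ^ 2 * bumpSum ^ 2

theorem ofReal_scale_sq_mul (b : BaseIndex) (c : ℝ) (x : ℝ≥0∞) :
    ENNReal.ofReal (|b.mat.det| * (c ^ 2)⁻¹) * (ENNReal.ofReal (b.scale⁻¹ ^ 2) * x) =
      ENNReal.ofReal (c ^ 2)⁻¹ * x := by
  have hs := b.scale_pos
  rw [← mul_assoc, ← ENNReal.ofReal_mul (by positivity), b.abs_det_mat]
  congr 2
  field_simp

theorem lintegral_scaled_sq (b : BaseIndex) (q G : Plane → ℂ) :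
    ∫⁻ ξ, ‖((b.scale⁻¹ : ℝ) : ℂ) * q ξ * G ξ‖ₑ ^ 2 =
      ENNReal.ofReal (b.scale⁻¹ ^ 2) * ∫⁻ ξ, ‖q ξ‖ₑ ^ 2 * ‖G ξ‖ₑ ^ 2 := by
  rw [← lintegral_const_mul' _ _ ENNReal.ofReal_ne_top]
  refine lintegral_congr fun ξ => ?_
  have : ‖((b.scale⁻¹ : ℝ) : ℂ)‖ₑ ^ 2 = ENNReal.ofReal (b.scale⁻¹ ^ 2) := by
    rw [← ofReal_norm, Complex.norm_real, ← ENNReal.ofReal_pow (norm_nonneg _), Real.norm_eq_abs,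
      sq_abs]
  rw [enorm_mul, enorm_mul, mul_pow, mul_pow, this, mul_assoc]

theorem generatorSum_sandwich (b : BaseIndex) {c : ℝ} (hc : 0 < c) {q G : Plane → ℂ}
    (hq : Measurable q) (hG : Measurable G) (hq2 : MemLp q 2) {C : ℝ} (hqC : ∀ ξ, ‖q ξ‖ ≤ C)
    (hG2 : MemLp G 2) :
    generatorSum b c q G ≤ ENNReal.ofReal (c ^ 2)⁻¹ * (∫⁻ ξ, ‖q ξ‖ₑ ^ 2 * ‖G ξ‖ₑ ^ 2) +
      ENNReal.ofReal (|b.mat.det| * (c ^ 2)⁻¹) *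
        latticeOverlap b.mat c (fun ξ => ((b.scale⁻¹ : ℝ) : ℂ) * q ξ * G ξ) ∧
    ENNReal.ofReal (c ^ 2)⁻¹ * (∫⁻ ξ, ‖q ξ‖ₑ ^ 2 * ‖G ξ‖ₑ ^ 2) ≤ generatorSum b c q G +
      ENNReal.ofReal (|b.mat.det| * (c ^ 2)⁻¹) *
        latticeOverlap b.mat c (fun ξ => ((b.scale⁻¹ : ℝ) : ℂ) * q ξ * G ξ) := by
  have hm : Measurable fun ξ => ((b.scale⁻¹ : ℝ) : ℂ) * q ξ * G ξ := (hq.const_mul _).mul hG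
  have h1 : Integrable fun ξ => ((b.scale⁻¹ : ℝ) : ℂ) * q ξ * G ξ := by
    simp only [mul_assoc]
    exact (hq2.integrable_mul hG2).const_mul _
  have h2 : ∫⁻ ξ, ‖((b.scale⁻¹ : ℝ) : ℂ) * q ξ * G ξ‖ₑ ^ 2 ≠ ∞ := by
    have hm2 : MemLp (fun ξ => ((b.scale⁻¹ : ℝ) : ℂ) * q ξ * G ξ) 2 := by
      refine hG2.of_le_mul (c := b.scale⁻¹ * C) hm.aestronglyMeasurable (ae_of_all _ fun ξ => ?_)
      rw [norm_mul, norm_mul, Complex.norm_real,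
        Real.norm_of_nonneg (inv_nonneg.2 b.scale_pos.le)]
      have := b.scale_pos
      gcongr
      exact hqC ξ
    have := (eLpNorm_lt_top_iff_lintegral_rpow_enorm_lt_top (by norm_num) (by norm_num)).1 hm2.2
    simpa only [ENNReal.toReal_ofNat, ENNReal.rpow_ofNat] using this.ne
  have key := lattice_parseval_sandwich b.det_mat_ne_zero hc hm h1 h2
  rw [lintegral_scaled_sq, mul_add, ofReal_scale_sq_mul] at key
  exact key

/-- The decisive cancellation: `|det M|` against `scale⁻²`, and the density `c⁻²` against the `c²`
gained in the overlap. The bound is therefore independent of `c`, while the diagonal term grows like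
`c⁻²`. -/
theorem overlap_le (b : BaseIndex) {c : ℝ} (hc : 0 < c) (hc1 : c ≤ 1) {q G : Plane → ℂ}
    (hq : Measurable q) (hG : Measurable G) {C : ℝ}
    (hb : ∀ ξ, ‖q ξ‖ ≤ C * (majorant b.ι (b.dual ξ) * planeBump (b.dual ξ))) :
    ENNReal.ofReal (|b.mat.det| * (c ^ 2)⁻¹) *
        latticeOverlap b.mat c (fun ξ => ((b.scale⁻¹ : ℝ) : ℂ) * q ξ * G ξ) ≤
      ENNReal.ofReal (overlapConst C) *
        ∫⁻ ξ, ‖G ξ‖ₑ ^ 2 * ENNReal.ofReal (majorant b.ι (b.dual ξ)) := by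
  have hs := b.scale_pos
  have := latticeOverlap_le_of_bound b.det_mat_ne_zero hc hc1 (hq.const_mul ((b.scale⁻¹ : ℝ) : ℂ))
    hG (C := b.scale⁻¹ * C) (majorant_nonneg b.ι) (majorant_le_one b.ι) (fun ξ => by
      rw [norm_mul, Complex.norm_real, Real.norm_of_nonneg (by positivity), mul_assoc]
      gcongr
      exact hb ξ)
  refine (mul_le_mul_right this _).trans (le_of_eq ?_)
  rw [← mul_assoc, ← ENNReal.ofReal_mul (by positivity), b.abs_det_mat]
  congr 2
  rw [overlapConst]
  field_simp

variable {C : ℝ} {q : BaseIndex → Plane → ℂ}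

theorem tsum_lintegral_majorant_le {G : Plane → ℂ} (hG : Measurable G) :
    ∑' b : BaseIndex, ∫⁻ ξ, ‖G ξ‖ₑ ^ 2 * ENNReal.ofReal (majorant b.ι (b.dual ξ)) ≤
      ENNReal.ofReal majorantSum * ∫⁻ ξ, ‖G ξ‖ₑ ^ 2 := by
  have hmaj : ∀ ι, Measurable (majorant ι) := by
    have := continuous_bump
    intro ι
    cases ι
    all_goals
      change Measurable fun η => majorant _ η
      simp only [majorant, planeBump]
      exact Continuous.measurable (by fun_prop)
  have hm : ∀ b : BaseIndex, AEMeasurable (fun ξ =>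
      ‖G ξ‖ₑ ^ 2 * ENNReal.ofReal (majorant b.ι (b.dual ξ))) volume := fun b =>
    ((hG.enorm.pow_const 2).mul (ENNReal.measurable_ofReal.comp
      ((hmaj b.ι).comp b.measurable_dual))).aemeasurable
  rw [← lintegral_tsum hm, ← lintegral_const_mul' _ _ ENNReal.ofReal_ne_top]
  refine lintegral_mono fun ξ => ?_
  dsimp only
  rw [ENNReal.tsum_mul_left, mul_comm]
  gcongr
  exact tsum_majorant_le ξ

theorem tsum_enorm_profile_sq_le (hb : ∀ b ξ, ‖q b ξ‖ ≤
    C * (majorant b.ι (b.dual ξ) * planeBump (b.dual ξ))) (ξ : Plane) :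
    ∑' b, ‖q b ξ‖ₑ ^ 2 ≤ ENNReal.ofReal (C ^ 2 * majorantSum) := by
  have h : ∀ b, ‖q b ξ‖ₑ ^ 2 ≤
      ENNReal.ofReal (C ^ 2) * ENNReal.ofReal (majorant b.ι (b.dual ξ)) := by
    intro b
    set x := majorant b.ι (b.dual ξ) with hx
    have hx0 : 0 ≤ x := majorant_nonneg _ _
    have hx1 : x ≤ 1 := majorant_le_one _ _
    have hp0 := (planeBump_pos (b.dual ξ)).le
    have hp1 := planeBump_le_one (b.dual ξ)
    rw [← ofReal_norm, ← ENNReal.ofReal_pow (norm_nonneg _), ← ENNReal.ofReal_mul (sq_nonneg _)]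
    refine ENNReal.ofReal_le_ofReal ?_
    calc ‖q b ξ‖ ^ 2 ≤ (C * (x * planeBump (b.dual ξ))) ^ 2 :=
          pow_le_pow_left₀ (norm_nonneg _) (hb b ξ) 2
      _ = C ^ 2 * (x * (x * planeBump (b.dual ξ) ^ 2)) := by ring
      _ ≤ C ^ 2 * (x * 1) := by
        gcongr
        exact mul_le_one₀ hx1 (by positivity) (pow_le_one₀ hp0 hp1)
      _ = C ^ 2 * x := by ring
  refine (ENNReal.tsum_le_tsum h).trans ?_
  rw [ENNReal.tsum_mul_left, ENNReal.ofReal_mul (sq_nonneg _)]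
  gcongr
  exact tsum_majorant_le ξ

/-- Frame inequalities in frequency: upper bound from the decay of the profiles, lower bound from
the Calderón-type condition `∑_b |q_b|² ≥ L`, once the sampling is fine enough. -/
theorem tsum_generatorSum_bounds (hq : ∀ b, Measurable (q b)) (hb : ∀ b ξ, ‖q b ξ‖ ≤
    C * (majorant b.ι (b.dual ξ) * planeBump (b.dual ξ))) {c : ℝ} (hc : 0 < c) (hc1 : c ≤ 1)
    {L : ℝ} (hL : ∀ᵐ ξ, ENNReal.ofReal L ≤ ∑' b, ‖q b ξ‖ₑ ^ 2)
    {G : Plane → ℂ} (hG : Measurable G) (hG2 : MemLp G 2) :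
    ∑' b, generatorSum b c (q b) G ≤
      ENNReal.ofReal ((c ^ 2)⁻¹ * (C ^ 2 * majorantSum) + overlapConst C * majorantSum) *
        ∫⁻ ξ, ‖G ξ‖ₑ ^ 2 ∧
    ENNReal.ofReal ((c ^ 2)⁻¹ * L) * (∫⁻ ξ, ‖G ξ‖ₑ ^ 2) ≤
      ∑' b, generatorSum b c (q b) G +
        ENNReal.ofReal (overlapConst C * majorantSum) * ∫⁻ ξ, ‖G ξ‖ₑ ^ 2 := by
  set N := ∫⁻ ξ, ‖G ξ‖ₑ ^ 2 with hN
  have hC0 : 0 ≤ overlapConst C := by unfold overlapConst; positivity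
  have hS0 := majorantSum_nonneg
  have hqb : ∀ b ξ, ‖q b ξ‖ ≤ |C| * planeBump (b.dual ξ) := by
    intro b ξ
    have hp := (planeBump_pos (b.dual ξ)).le
    have hm0 := majorant_nonneg b.ι (b.dual ξ)
    refine (hb b ξ).trans ((mul_le_mul_of_nonneg_right (le_abs_self C) (by positivity)).trans ?_)
    gcongr
    exact mul_le_of_le_one_left hp (majorant_le_one _ _)
  have hqC : ∀ b ξ, ‖q b ξ‖ ≤ |C| := fun b ξ => (hqb b ξ).trans
    (mul_le_of_le_one_right (abs_nonneg C) (planeBump_le_one _))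
  have hsand := fun b => generatorSum_sandwich b hc (hq b) hG
    (memLp_two_of_le_planeBump_dual b (hq b) (hqb b)) (hqC b) hG2
  have hov := fun b => overlap_le b hc hc1 (hq b) hG (hb b)
  have hovsum : ∑' b : BaseIndex, ENNReal.ofReal (overlapConst C) *
      ∫⁻ ξ, ‖G ξ‖ₑ ^ 2 * ENNReal.ofReal (majorant b.ι (b.dual ξ)) ≤
      ENNReal.ofReal (overlapConst C * majorantSum) * N := by
    rw [ENNReal.tsum_mul_left, ENNReal.ofReal_mul hC0, mul_assoc]
    gcongr
    exact tsum_lintegral_majorant_le hG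
  -- Summing the diagonal terms exposes the Calderón sum `∑_b |q_b|²` as a multiplier of `|G|²`.
  have hdiag : ∑' b, ENNReal.ofReal (c ^ 2)⁻¹ * (∫⁻ ξ, ‖q b ξ‖ₑ ^ 2 * ‖G ξ‖ₑ ^ 2) =
      ENNReal.ofReal (c ^ 2)⁻¹ * ∫⁻ ξ, (∑' b, ‖q b ξ‖ₑ ^ 2) * ‖G ξ‖ₑ ^ 2 := by
    have hm : ∀ b, AEMeasurable (fun ξ => ‖q b ξ‖ₑ ^ 2 * ‖G ξ‖ₑ ^ 2) volume := fun b =>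
      (((hq b).enorm.pow_const 2).mul (hG.enorm.pow_const 2)).aemeasurable
    rw [ENNReal.tsum_mul_left, ← lintegral_tsum hm]
    simp only [ENNReal.tsum_mul_right]
  constructor
  · calc ∑' b, generatorSum b c (q b) G
        ≤ ∑' b, (ENNReal.ofReal (c ^ 2)⁻¹ * (∫⁻ ξ, ‖q b ξ‖ₑ ^ 2 * ‖G ξ‖ₑ ^ 2) +
          ENNReal.ofReal (overlapConst C) *
            ∫⁻ ξ, ‖G ξ‖ₑ ^ 2 * ENNReal.ofReal (majorant b.ι (b.dual ξ))) :=
          ENNReal.tsum_le_tsum fun b => (hsand b).1.trans (add_le_add le_rfl (hov b))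
      _ ≤ ENNReal.ofReal (c ^ 2)⁻¹ * (ENNReal.ofReal (C ^ 2 * majorantSum) * N) +
          ENNReal.ofReal (overlapConst C * majorantSum) * N := by
          rw [ENNReal.tsum_add, hdiag]
          gcongr
          rw [hN, ← lintegral_const_mul' _ _ ENNReal.ofReal_ne_top]
          refine lintegral_mono fun ξ => ?_
          dsimp only
          gcongr
          exact tsum_enorm_profile_sq_le hb ξ
      _ = _ := by
          rw [← mul_assoc, ← ENNReal.ofReal_mul (by positivity), ← add_mul,
            ← ENNReal.ofReal_add (by positivity) (by positivity)]
  · calc ENNReal.ofReal ((c ^ 2)⁻¹ * L) * N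
        ≤ ENNReal.ofReal (c ^ 2)⁻¹ * ∫⁻ ξ, (∑' b, ‖q b ξ‖ₑ ^ 2) * ‖G ξ‖ₑ ^ 2 := by
          rw [ENNReal.ofReal_mul (by positivity), mul_assoc]
          gcongr
          rw [hN, ← lintegral_const_mul' _ _ ENNReal.ofReal_ne_top]
          refine lintegral_mono_ae ?_
          filter_upwards [hL] with ξ hξ
          gcongr
      _ ≤ ∑' b, (generatorSum b c (q b) G + ENNReal.ofReal (overlapConst C) *
            ∫⁻ ξ, ‖G ξ‖ₑ ^ 2 * ENNReal.ofReal (majorant b.ι (b.dual ξ))) := by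
          rw [← hdiag]
          exact ENNReal.tsum_le_tsum fun b => (hsand b).2.trans (add_le_add le_rfl (hov b))
      _ ≤ _ := by
          rw [ENNReal.tsum_add]
          gcongr

end GeneratorEstimate

/-! ### Frame coefficients as lattice Fourier coefficients -/

section Coefficients

theorem tsum_index_eq (f : Index → ℝ≥0∞) :
    ∑' l, f l = ∑' b : BaseIndex, ∑' m : ℤ × ℤ, f (indexEquiv.symm (b, m)) := by
  rw [← indexEquiv.symm.tsum_eq, ENNReal.tsum_prod']

theorem conj_fourierChar_neg (x : ℝ) :
    starRingEnd ℂ (Real.fourierChar (-x) : ℂ) = (Real.fourierChar x : ℂ) := by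
  rw [← Circle.coe_inv_eq_conj, AddChar.map_neg_eq_inv, inv_inv]

theorem tsum_coefficients_eq {a : Index → ℂ} {c : ℝ} {q : BaseIndex → Plane → ℂ} {G : Plane → ℂ}
    (h : ∀ l : Index, a l =
      ∫ ξ, (Real.fourierChar (inner ℝ (l.base.dual ξ) (latticePoint c c l.m)) : ℂ) *
        (((l.base.scale⁻¹ : ℝ) : ℂ) * q l.base ξ * G ξ)) :
    ∑' l, ENNReal.ofReal (‖a l‖ ^ 2) = ∑' b, generatorSum b c (q b) G := by
  rw [tsum_index_eq]
  congr 1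
  ext b
  rw [generatorSum]
  congr 1
  ext m
  rw [h, ENNReal.ofReal_pow (norm_nonneg _), ofReal_norm]
  rfl

variable {φ ψ ψ' : L2Plane} {F : SignType → Plane → ℂ}

theorem inner_system_eq (hF : ∀ ι, Integrable (F ι))
    (h : ∀ ι, (𝓕 (generator φ ψ ψ' ι) : L2Plane) =ᵐ[volume] F ι) (c : ℝ) {f : L2Plane}
    {G : Plane → ℂ} (hG : (𝓕 f : L2Plane) =ᵐ[volume] G) (l : Index) :
    inner ℂ (system φ ψ ψ' c c l) f =
      ∫ ξ, (Real.fourierChar (inner ℝ (l.base.dual ξ) (latticePoint c c l.m)) : ℂ) *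
        (((l.base.scale⁻¹ : ℝ) : ℂ) * starRingEnd ℂ (F l.base.ι (l.base.dual ξ)) * G ξ) := by
  rw [← Lp.inner_fourier_eq, L2.inner_def]
  refine integral_congr_ae ?_
  filter_upwards [hG, fourier_system hF h c l] with ξ h1 h2
  rw [h1, h2, RCLike.inner_apply, map_mul, map_mul, conj_fourierChar_neg, Complex.conj_ofReal]
  change _ = _ * (_ * starRingEnd ℂ (F l.ι (l.base.dual ξ)) * _)
  ring

/-- The weight is split as `√w · √w`: one root goes into the profile, the other into the isometric
image of `f`. -/
theorem sobolev_inner_eq {s : ℕ} (hF : ∀ ι, Integrable (F ι))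
    (h : ∀ ι, (𝓕 (generator φ ψ ψ' ι) : L2Plane) =ᵐ[volume] F ι) (c : ℝ) (l : Index)
    {Φ : SobolevSpace s} (hΦ : SobolevSpace.toL2 Φ =
      (((2 : ℝ) ^ (-((l.j : ℝ) * s)) : ℝ) : ℂ) • system φ ψ ψ' c c l) (f : SobolevSpace s) :
    inner ℂ Φ f =
      ∫ ξ, (Real.fourierChar (inner ℝ (l.base.dual ξ) (latticePoint c c l.m)) : ℂ) *
        (((l.base.scale⁻¹ : ℝ) : ℂ) *
          ((((2 : ℝ) ^ (-((l.base.j : ℝ) * s)) * Real.sqrt (sobolevWeight s ξ) : ℝ) : ℂ) *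
            starRingEnd ℂ (F l.base.ι (l.base.dual ξ))) *
          (((Real.sqrt (sobolevWeight s ξ) : ℝ) : ℂ) *
            (𝓕 (SobolevSpace.toL2 f) : L2Plane) ξ)) := by
  rw [SobolevSpace.inner_eq_integral, hΦ, FourierTransform.fourier_smul]
  refine integral_congr_ae ?_
  filter_upwards [Lp.coeFn_smul (((2 : ℝ) ^ (-((l.j : ℝ) * s)) : ℝ) : ℂ)
    (𝓕 (system φ ψ ψ' c c l) : L2Plane), fourier_system hF h c l] with ξ h1 h2
  have hw : ((sobolevWeight s ξ : ℝ) : ℂ) =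
      ((Real.sqrt (sobolevWeight s ξ) : ℝ) : ℂ) * ((Real.sqrt (sobolevWeight s ξ) : ℝ) : ℂ) := by
    rw [← Complex.ofReal_mul, Real.mul_self_sqrt]
    linarith [one_le_sobolevWeight s ξ]
  rw [h1, Pi.smul_apply, h2, smul_eq_mul, map_mul, map_mul, map_mul, conj_fourierChar_neg,
    Complex.conj_ofReal, Complex.conj_ofReal, hw, Complex.ofReal_mul]
  change _ = _ * (_ * (((((2 : ℝ) ^ (-((l.j : ℝ) * s)) : ℝ) : ℂ) * _) *
    starRingEnd ℂ (F l.ι (l.base.dual ξ))) * _)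
  ring

end Coefficients

/-! ### From a lower frame bound to a lower Calderón bound -/

section Calderon

/-- The matrices `M⁻ᵀ` are bounded uniformly in the index, by `2^{-j/2} + |k| 2^{-j} ≤ 1 + 2`. Hence
all the lattices `Mᵀ c⁻¹ ℤ²` are separated by a common distance. -/
theorem BaseIndex.abs_dual_le (b : BaseIndex) (v : Plane) (i : Fin 2) :
    |(b.dual v) i| ≤ 3 * ‖v‖ := by
  have hv : ∀ i, |v i| ≤ ‖v‖ := fun i => PiLp.norm_apply_le v i
  have h2 : ((2 : ℝ) ^ b.j)⁻¹ ≤ 1 := inv_le_one_of_one_le₀ (one_le_pow₀ one_le_two)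
  have h2' : (0 : ℝ) < ((2 : ℝ) ^ b.j)⁻¹ := by positivity
  have hr : b.root⁻¹ ≤ 1 := inv_le_one_of_one_le₀ b.one_le_root
  have hr' : 0 < b.root⁻¹ := inv_pos.2 b.root_pos
  have hk : |(b.k : ℝ)| * ((2 : ℝ) ^ b.j)⁻¹ ≤ 2 := by
    rw [← b.root_sq]
    have := b.abs_k_le_two_mul_root
    have hpos := b.root_pos
    rw [← div_eq_mul_inv, div_le_iff₀ (by positivity)]
    nlinarith [b.one_le_root]
  have low : ∀ x y : ℝ, |x| ≤ ‖v‖ → |y| ≤ ‖v‖ → |((2 : ℝ) ^ b.j)⁻¹ * x| ≤ 3 * ‖v‖ ∧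
      |b.root⁻¹ * y - b.k * (((2 : ℝ) ^ b.j)⁻¹ * x)| ≤ 3 * ‖v‖ := by
    intro x y hx hy
    have hx0 := abs_nonneg x
    have hy0 := abs_nonneg y
    constructor
    · rw [abs_mul, abs_of_pos h2']
      nlinarith
    · refine (abs_sub _ _).trans ?_
      rw [abs_mul, abs_mul, abs_mul, abs_of_pos h2', abs_of_pos hr', ← mul_assoc]
      nlinarith
  rcases h : b.ι with _ | _ | _
  · rw [b.dual_of_zero h]
    linarith [hv i, norm_nonneg v]
  · obtain ⟨h0, h1⟩ := b.dual_of_neg h v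
    fin_cases i
    · exact (congrArg abs h0).trans_le (low _ _ (hv 1) (hv 0)).2
    · exact (congrArg abs h1).trans_le (low _ _ (hv 1) (hv 0)).1
  · obtain ⟨h0, h1⟩ := b.dual_of_pos h v
    fin_cases i
    · exact (congrArg abs h0).trans_le (low _ _ (hv 0) (hv 1)).1
    · exact (congrArg abs h1).trans_le (low _ _ (hv 0) (hv 1)).2

/-- A function supported in a small ball does not meet its translates by the dual lattice. -/
theorem latticeOverlap_eq_zero (b : BaseIndex) {c : ℝ} (hc : 0 < c) {h : Plane → ℂ} (x : Plane)
    (hx : ∀ ξ, ξ ∉ Metric.ball x (c⁻¹ / 6) → h ξ = 0) : latticeOverlap b.mat c h = 0 := by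
  rw [latticeOverlap]
  refine (lintegral_congr fun ξ => ?_).trans lintegral_zero
  refine ENNReal.tsum_eq_zero.2 fun k => ?_
  split_ifs with hk
  · rfl
  by_contra hne
  rw [mul_eq_zero, not_or, enorm_eq_zero, enorm_eq_zero] at hne
  set v := Matrix.toEuclideanLin b.mat.transpose (latticePoint c⁻¹ c⁻¹ k) with hv
  have h1 : ξ ∈ Metric.ball x (c⁻¹ / 6) := by
    by_contra hcon
    exact hne.1 (hx _ hcon)
  have h2 : ξ + v ∈ Metric.ball x (c⁻¹ / 6) := by
    by_contra hcon
    exact hne.2 (hx _ hcon)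
  -- Radius `c⁻¹ / 6` makes two points of the ball differ by less than `c⁻¹ / 3`; the factor `3` of
  -- `BaseIndex.abs_dual_le` then leaves both lattice coordinates below `c⁻¹`, which forces `k = 0`.
  have hnorm : ‖v‖ < c⁻¹ / 3 := by
    have e : ‖v‖ = dist (ξ + v) ξ := by simp
    rw [e]
    calc dist (ξ + v) ξ ≤ dist (ξ + v) x + dist ξ x := dist_triangle_right _ _ _
      _ < c⁻¹ / 6 + c⁻¹ / 6 := add_lt_add h2 h1
      _ = c⁻¹ / 3 := by ring
  have hdual : b.dual v = latticePoint c⁻¹ c⁻¹ k := by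
    have := dual_shift b.det_mat_ne_zero 0 (latticePoint c⁻¹ c⁻¹ k)
    simpa [BaseIndex.dual, hv] using this
  have hz : ∀ n : ℤ, |c⁻¹ * (n : ℝ)| < c⁻¹ → n = 0 := by
    intro n hn
    rw [abs_mul, abs_of_pos (inv_pos.2 hc)] at hn
    have : |(n : ℝ)| < 1 := by
      by_contra! hcon
      have := mul_le_mul_of_nonneg_left hcon (inv_pos.2 hc).le
      linarith
    have : |n| < 1 := by exact_mod_cast this
    exact Int.abs_lt_one_iff.1 this
  have hcoord : ∀ i, |(latticePoint c⁻¹ c⁻¹ k) i| < c⁻¹ := by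
    intro i
    rw [← hdual]
    linarith [b.abs_dual_le v i]
  refine hk (Prod.ext (hz _ ?_) (hz _ ?_))
  · simpa [latticePoint] using hcoord 0
  · simpa [latticePoint] using hcoord 1

variable {φ ψ ψ' : L2Plane} {F : SignType → Plane → ℂ}

/-- Testing a lower frame bound on a function whose Fourier transform is the indicator of a small
set `E`. -/
theorem calderon_test_indicator (hFm : ∀ ι, Measurable (F ι)) {C : ℝ}
    (hFC : ∀ ι η, ‖F ι η‖ ≤ C * planeBump η)
    (h : ∀ ι, (𝓕 (generator φ ψ ψ' ι) : L2Plane) =ᵐ[volume] F ι) {c A B : ℝ} (hc : 0 < c)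
    (hA : 0 < A) (hfr : HasFrameBounds A B (system φ ψ ψ' c c)) {E : Set Plane}
    (mE : MeasurableSet E) (x : Plane) (hE : E ⊆ Metric.ball x (c⁻¹ / 6)) :
    ENNReal.ofReal (c ^ 2 * A) * volume E ≤
      ∫⁻ ξ in E, ∑' b : BaseIndex, ‖F b.ι (b.dual ξ)‖ₑ ^ 2 := by
  have mterm : ∀ b : BaseIndex, Measurable fun ξ => ‖F b.ι (b.dual ξ)‖ₑ ^ 2 := fun b =>
    ((hFm b.ι).comp b.measurable_dual).enorm.pow_const 2
  have Efin : volume E ≠ ∞ := ((measure_mono hE).trans_lt measure_ball_lt_top).ne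
  obtain ⟨G, hG⟩ : ∃ G : Plane → ℂ, G = E.indicator fun _ => 1 := ⟨_, rfl⟩
  have mG : Measurable G := hG ▸ measurable_const.indicator mE
  have G2 : MemLp G 2 := hG ▸ memLp_indicator_const 2 mE 1 (Or.inr Efin)
  have hGsq : ∀ ξ, ‖G ξ‖ₑ ^ 2 = E.indicator (fun _ => 1) ξ := by
    intro ξ
    by_cases hξ : ξ ∈ E <;> simp [hG, hξ]
  obtain ⟨f, hfG⟩ : ∃ f : L2Plane, (𝓕 f : L2Plane) =ᵐ[volume] G :=
    ⟨𝓕⁻ (G2.toLp G), by rw [FourierTransform.fourier_fourierInv_eq]; exact G2.coeFn_toLp⟩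
  have hnorm : ENNReal.ofReal (‖f‖ ^ 2) = volume E := by
    rw [← Lp.norm_fourier_eq, ofReal_norm_sq_eq_lintegral]
    calc _ = ∫⁻ ξ, ‖G ξ‖ₑ ^ 2 := by
          refine lintegral_congr_ae ?_
          filter_upwards [hfG] with ξ hξ
          rw [hξ]
      _ = volume E := by
          simp only [hGsq]
          rw [lintegral_indicator_const mE, one_mul]
  have hFint : ∀ ι, Integrable (F ι) := fun ι => integrable_of_le_planeBump (hFm ι) (hFC ι)
  have hlow := (hfr f).1
  have hcoef := tsum_coefficients_eq
    (q := fun b ξ => starRingEnd ℂ (F b.ι (b.dual ξ))) (inner_system_eq hFint h c hfG)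
  rw [hcoef, ENNReal.ofReal_mul hA.le, hnorm] at hlow
  -- Without overlap only the diagonal term is left, restricted to `E`.
  have hgen : ∀ b : BaseIndex,
      generatorSum b c (fun ξ => starRingEnd ℂ (F b.ι (b.dual ξ))) G ≤
        ENNReal.ofReal (c ^ 2)⁻¹ * ∫⁻ ξ in E, ‖F b.ι (b.dual ξ)‖ₑ ^ 2 := by
    intro b
    have hmq : Measurable fun ξ => starRingEnd ℂ (F b.ι (b.dual ξ)) :=
      Complex.continuous_conj.measurable.comp ((hFm b.ι).comp b.measurable_dual)
    have hC : ∀ ξ, ‖starRingEnd ℂ (F b.ι (b.dual ξ))‖ ≤ C * planeBump (b.dual ξ) := by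
      intro ξ
      rw [RCLike.norm_conj]
      exact hFC _ _
    have hC0 : 0 ≤ C := nonneg_of_mul_nonneg_left ((norm_nonneg _).trans (hC 0)) (planeBump_pos _)
    have hs := (generatorSum_sandwich b hc hmq mG (memLp_two_of_le_planeBump_dual b hmq hC)
      (fun ξ => (hC ξ).trans (mul_le_of_le_one_right hC0 (planeBump_le_one _))) G2).1
    rw [latticeOverlap_eq_zero b hc x (fun ξ hξ => by
      have : ξ ∉ E := fun hcon => hξ (hE hcon)
      simp [hG, this]), mul_zero, add_zero] at hs
    refine hs.trans (le_of_eq ?_)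
    congr 1
    rw [← lintegral_indicator mE]
    refine lintegral_congr fun ξ => ?_
    rw [hGsq]
    by_cases hξ : ξ ∈ E
    · simp only [Set.indicator_of_mem hξ, mul_one]
      rw [← ofReal_norm, RCLike.norm_conj, ofReal_norm]
    · simp only [Set.indicator_of_notMem hξ, mul_zero]
  have hsum : ENNReal.ofReal A * volume E ≤
      ENNReal.ofReal (c ^ 2)⁻¹ * ∫⁻ ξ in E, ∑' b : BaseIndex, ‖F b.ι (b.dual ξ)‖ₑ ^ 2 := by
    refine hlow.trans ((ENNReal.tsum_le_tsum hgen).trans (le_of_eq ?_))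
    rw [ENNReal.tsum_mul_left, ← lintegral_tsum fun b => (mterm b).aemeasurable]
  have hsum' := mul_le_mul_right hsum (ENNReal.ofReal (c ^ 2))
  rwa [← mul_assoc, ← mul_assoc, ← ENNReal.ofReal_mul (by positivity),
    ← ENNReal.ofReal_mul (by positivity), mul_inv_cancel₀ (by positivity), ENNReal.ofReal_one,
    one_mul] at hsum'

/-- If the set `{D < a}` met a small ball in positive measure, that intersection would be an
admissible `E` with `∫_E D < a · volume E`. Local nullity gives nullity; the ball keeps the
integrals finite, as the strict inequality requires. -/
theorem ae_le_of_forall_mul_measure_le {D : Plane → ℝ≥0∞} (mD : Measurable D) {a : ℝ≥0∞}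
    (ha : a ≠ ∞) {δ : ℝ} (hδ : 0 < δ) (h : ∀ (x : Plane) (E : Set Plane), MeasurableSet E →
      E ⊆ Metric.ball x δ → a * volume E ≤ ∫⁻ ξ in E, D ξ) : ∀ᵐ ξ, a ≤ D ξ := by
  have mbad : MeasurableSet {ξ | D ξ < a} := measurableSet_lt mD measurable_const
  have hnull : volume {ξ | D ξ < a} = 0 := by
    refine measure_null_of_locally_null _ fun x _ => ?_
    refine ⟨{ξ | D ξ < a} ∩ Metric.ball x δ,
      inter_mem_nhdsWithin _ (Metric.ball_mem_nhds x hδ), ?_⟩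
    have mE := mbad.inter (measurableSet_ball (x := x) (ε := δ))
    have hlt : ∀ ξ ∈ {ξ | D ξ < a} ∩ Metric.ball x δ, D ξ < a := fun ξ hξ => hξ.1
    have hsub : {ξ | D ξ < a} ∩ Metric.ball x δ ⊆ Metric.ball x δ := Set.inter_subset_right
    generalize {ξ | D ξ < a} ∩ Metric.ball x δ = E at mE hlt hsub
    have Efin : volume E ≠ ∞ := ((measure_mono hsub).trans_lt measure_ball_lt_top).ne
    by_contra hE0
    have hfin : ∫⁻ ξ in E, D ξ ≠ ∞ := by
      refine ((setLIntegral_mono' mE fun ξ hξ => (hlt ξ hξ).le).trans_lt ?_).ne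
      rw [setLIntegral_const]
      exact ENNReal.mul_lt_top ha.lt_top Efin.lt_top
    have hcon : ∫⁻ ξ in E, D ξ < ∫⁻ _ in E, a :=
      setLIntegral_strict_mono mE hE0 measurable_const hfin (ae_of_all _ hlt)
    rw [setLIntegral_const] at hcon
    exact absurd (h x E mE hsub) (not_le.2 hcon)
  filter_upwards [measure_eq_zero_iff_ae_notMem.1 hnull] with ξ hξ
  exact not_lt.1 hξ

/-- A lower frame bound forces a lower bound on the Calderón sum of the generators. -/
theorem calderon_lower_bound (hFm : ∀ ι, Measurable (F ι)) {C : ℝ}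
    (hFC : ∀ ι η, ‖F ι η‖ ≤ C * planeBump η)
    (h : ∀ ι, (𝓕 (generator φ ψ ψ' ι) : L2Plane) =ᵐ[volume] F ι) {c A B : ℝ} (hc : 0 < c)
    (hA : 0 < A) (hfr : HasFrameBounds A B (system φ ψ ψ' c c)) :
    ∀ᵐ ξ, ENNReal.ofReal (c ^ 2 * A) ≤ ∑' b : BaseIndex, ‖F b.ι (b.dual ξ)‖ₑ ^ 2 := by
  have mterm : ∀ b : BaseIndex, Measurable fun ξ => ‖F b.ι (b.dual ξ)‖ₑ ^ 2 := fun b =>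
    ((hFm b.ι).comp b.measurable_dual).enorm.pow_const 2
  have mD : Measurable fun ξ => ∑' b : BaseIndex, ‖F b.ι (b.dual ξ)‖ₑ ^ 2 := Measurable.tsum mterm
  have hδ : 0 < c⁻¹ / 6 := by positivity
  refine ae_le_of_forall_mul_measure_le mD ENNReal.ofReal_ne_top hδ fun x E mE hE => ?_
  exact calderon_test_indicator hFm hFC h hc hA hfr mE x hE

end Calderon

/-! ### Fourier bounds for the one-dimensional generators -/

section LineSymbols

theorem min_decay_le {β : ℝ} (hβ : 4 < β) (t : ℝ) : min 1 (|t| ^ (-β)) ≤ 4 * bump t ^ 2 := by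
  have h0 := bump_pos t
  rcases le_total |t| 1 with h | h
  · have h1 : (1 : ℝ) / 2 ≤ bump t := by
      rw [bump, one_div]
      refine inv_anti₀ (by positivity) ?_
      linarith [(sq_le_one_iff_abs_le_one t).2 h]
    refine (min_le_left _ _).trans ?_
    nlinarith
  · refine (min_le_right _ _).trans ?_
    have h1 : |t| ^ (-β) ≤ |t| ^ (-(4 : ℝ)) := Real.rpow_le_rpow_of_exponent_le h (by linarith)
    have ht : 1 ≤ t ^ 2 := (one_le_sq_iff_one_le_abs t).2 h
    have h2 : |t| ^ (-(4 : ℝ)) = ((t ^ 2) ^ 2)⁻¹ := by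
      rw [Real.rpow_neg (abs_nonneg t), ← pow_mul, ← Even.pow_abs (by decide : Even (2 * 2))]
      norm_cast
    rw [h2] at h1
    refine h1.trans ?_
    rw [bump, inv_pow, ← div_eq_mul_inv, inv_eq_one_div,
      div_le_div_iff₀ (by positivity) (by positivity)]
    nlinarith

/-- Near the origin `|t|^α ≤ t⁴` as `α > 4`; away from it `t² bump t ≥ 1/2`. The four moments are
those spent in `tsum_shear_majorant_le`. -/
theorem min_moment_le {α β : ℝ} (hα : 4 < α) (hβ : 4 < β) (t : ℝ) :
    min 1 (|t| ^ α) * min 1 (|t| ^ (-β)) ≤ 16 * (t ^ 4 * bump t ^ 4) := by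
  have h0 := bump_pos t
  have hdec := min_decay_le hβ t
  have hpos1 : 0 ≤ min 1 (|t| ^ α) := le_min zero_le_one (Real.rpow_nonneg (abs_nonneg t) _)
  have hpos2 : 0 ≤ min 1 (|t| ^ (-β)) := le_min zero_le_one (Real.rpow_nonneg (abs_nonneg t) _)
  have hmom : min 1 (|t| ^ α) ≤ 4 * (t ^ 4 * bump t ^ 2) := by
    rcases le_total |t| 1 with h | h
    · have h1 : (1 : ℝ) / 2 ≤ bump t := by
        rw [bump, one_div]
        refine inv_anti₀ (by positivity) ?_
        linarith [(sq_le_one_iff_abs_le_one t).2 h]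
      refine (min_le_right _ _).trans ?_
      have h2 : |t| ^ α ≤ t ^ 4 := by
        rw [← Even.pow_abs (by decide : Even 4)]
        calc |t| ^ α ≤ |t| ^ ((4 : ℕ) : ℝ) :=
              Real.rpow_le_rpow_of_exponent_ge' (abs_nonneg t) h (by norm_num) (by norm_num; linarith)
          _ = |t| ^ 4 := Real.rpow_natCast _ _
      have h3 : (1 : ℝ) ≤ 4 * bump t ^ 2 := by nlinarith
      have h4 : 0 ≤ t ^ 4 := by positivity
      nlinarith
    · refine (min_le_left _ _).trans ?_
      have ht : 1 ≤ t ^ 2 := (one_le_sq_iff_one_le_abs t).2 h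
      have h1 : (1 : ℝ) / 2 ≤ t ^ 2 * bump t := by
        rw [bump, ← div_eq_mul_inv, div_le_div_iff₀ (by positivity) (by positivity)]
        linarith
      nlinarith
  calc _ ≤ (4 * (t ^ 4 * bump t ^ 2)) * (4 * bump t ^ 2) :=
        mul_le_mul hmom hdec hpos2 (by positivity)
    _ = _ := by ring

/-- A function whose derivatives of order `0` and `s` have Fourier transforms dominated by `κ` has
a Fourier transform with an everywhere dominated measurable representative. -/
theorem exists_line_symbol {f : L2Line} {s : ℕ} {κ : ℝ → ℝ} (hκ : Measurable κ)
    (hκ0 : ∀ t, 0 ≤ κ t)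
    (h : ∀ r ≤ 2 * s, ∃ g : L2Line, IsWeakDerivLine r f g ∧
      ∃ C : ℝ, ∀ᵐ ξ : ℝ, ‖(𝓕 g : L2Line) ξ‖ ≤ C * κ ξ) :
    ∃ p : ℝ → ℂ, Measurable p ∧ (𝓕 f : L2Line) =ᵐ[volume] p ∧
      ∃ C, 0 ≤ C ∧ ∀ t, (1 + |t|) ^ s * ‖p t‖ ≤ C * κ t := by
  obtain ⟨g₀, hg₀, C₀, hC₀⟩ := h 0 (Nat.zero_le _)
  obtain ⟨g₁, hg₁, C₁, hC₁⟩ := h s (by omega)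
  have e₀ := (isWeakDerivLine_iff _ _ _).1 hg₀
  have e₁ := (isWeakDerivLine_iff _ _ _).1 hg₁
  -- The factor comes from `(1 + x)^s ≤ 2^{s-1} (1 + x^s)`, which also holds for `s = 0`, with the
  -- truncated exponent `0`. The two summands are controlled by the derivatives of orders `0` and
  -- `s`.
  set C := 2 ^ (s - 1) * (|C₀| + |C₁|) with hC
  have mF : Measurable (𝓕 f : L2Line) := (Lp.stronglyMeasurable _).measurable
  -- Setting the transform to zero off this set of full measure makes the bound hold at every point,
  -- as the lattice estimates require.
  set S : Set ℝ := {t | (1 + |t|) ^ s * ‖(𝓕 f : L2Line) t‖ ≤ C * κ t} with hS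
  have mS : MeasurableSet S := measurableSet_le
    (((by fun_prop : Continuous fun t : ℝ => (1 + |t|) ^ s).measurable).mul mF.norm)
    (hκ.const_mul _)
  have hae : ∀ᵐ t, t ∈ S := by
    filter_upwards [e₀, e₁, hC₀, hC₁] with t h0 h1 b0 b1
    rw [h0] at b0
    rw [h1] at b1
    simp only [pow_zero, one_mul] at b0
    have hπ : (1 : ℝ) ≤ 2 * Real.pi := by linarith [Real.pi_gt_three]
    have hn : ‖(2 * Real.pi * Complex.I * (t : ℂ)) ^ s * (𝓕 f : L2Line) t‖ =
        (2 * Real.pi * |t|) ^ s * ‖(𝓕 f : L2Line) t‖ := by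
      simp [abs_of_pos Real.pi_pos]
    rw [hn] at b1
    have b1' : |t| ^ s * ‖(𝓕 f : L2Line) t‖ ≤ |C₁| * κ t := by
      refine le_trans ?_ (b1.trans (mul_le_mul_of_nonneg_right (le_abs_self _) (hκ0 t)))
      gcongr
      exact le_mul_of_one_le_left (abs_nonneg _) hπ
    have b0' := b0.trans (mul_le_mul_of_nonneg_right (le_abs_self C₀) (hκ0 t))
    have hadd : (1 + |t|) ^ s ≤ 2 ^ (s - 1) * (1 + |t| ^ s) := by
      simpa using add_pow_le zero_le_one (abs_nonneg t) s
    calc (1 + |t|) ^ s * ‖(𝓕 f : L2Line) t‖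
        ≤ 2 ^ (s - 1) * (1 + |t| ^ s) * ‖(𝓕 f : L2Line) t‖ := by gcongr
      _ = 2 ^ (s - 1) * (‖(𝓕 f : L2Line) t‖ + |t| ^ s * ‖(𝓕 f : L2Line) t‖) := by ring
      _ ≤ 2 ^ (s - 1) * (|C₀| * κ t + |C₁| * κ t) := by gcongr
      _ = C * κ t := by rw [hC]; ring
  refine ⟨S.indicator (𝓕 f : L2Line), mF.indicator mS, ?_, C, by positivity, fun t => ?_⟩
  · filter_upwards [hae] with t ht
    rw [Set.indicator_of_mem ht]
  · by_cases ht : t ∈ S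
    · rw [Set.indicator_of_mem ht]
      exact ht
    · rw [Set.indicator_of_notMem ht, norm_zero, mul_zero]
      have := hκ0 t
      positivity

theorem integrable_of_le_bump {p : ℝ → ℂ} (hp : Measurable p) {C : ℝ}
    (h : ∀ t, ‖p t‖ ≤ C * bump t) : Integrable p :=
  (integrable_inv_one_add_sq.const_mul C).mono' hp.aestronglyMeasurable (ae_of_all _ h)

end LineSymbols

/-! ### Fourier symbols of the planar generators -/

section PlaneSymbols

/-- The Fourier transforms of the generators `φ¹ ⊗ φ¹`, `ψ¹ ⊗ φ¹` and its swap, in terms of the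
Fourier transforms `u` of `φ¹` and `v` of `ψ¹`. -/
noncomputable def planeSymbol (u v : ℝ → ℂ) (ι : SignType) (η : Plane) : ℂ :=
  match ι with
  | SignType.zero => u (η 0) * u (η 1)
  | SignType.pos => v (η 0) * u (η 1)
  | SignType.neg => v (η 1) * u (η 0)

/-- The frequency variable carrying the moment condition. -/
noncomputable def momentVar (ι : SignType) (η : Plane) : ℝ :=
  match ι with
  | SignType.zero => 1
  | SignType.pos => η 0
  | SignType.neg => η 1

theorem measurable_planeSymbol {u v : ℝ → ℂ} (hu : Measurable u) (hv : Measurable v)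
    (ι : SignType) : Measurable (planeSymbol u v ι) := by
  have h0 : Measurable fun η : Plane => η 0 := (by fun_prop : Continuous _).measurable
  have h1 : Measurable fun η : Plane => η 1 := (by fun_prop : Continuous _).measurable
  cases ι
  · exact (hu.comp h0).mul (hu.comp h1)
  · exact (hv.comp h1).mul (hu.comp h0)
  · exact (hv.comp h0).mul (hu.comp h1)

theorem measurable_momentVar (ι : SignType) : Measurable (momentVar ι) := by
  cases ι
  · exact measurable_const
  · exact (by fun_prop : Continuous fun η : Plane => η 1).measurable
  · exact (by fun_prop : Continuous fun η : Plane => η 0).measurable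

theorem abs_momentVar_le_growth (ι : SignType) (η : Plane) : |momentVar ι η| ≤ growth η := by
  cases ι
  · simpa [momentVar] using one_le_growth η
  · exact abs_le_growth η 1
  · exact abs_le_growth η 0

/-- `growth` is a product over the coordinates, so each one-dimensional factor absorbs its own `(1 +
|t|)^s`. The remaining bumps are shared between `majorant` and a spare `planeBump`, the latter for
Peetre's inequality. -/
theorem growth_pow_mul_planeSymbol_le {u v : ℝ → ℂ} {s : ℕ} {C₁ C₂ : ℝ} (h1 : 0 ≤ C₁) (h2 : 0 ≤ C₂)
    (hu : ∀ t, (1 + |t|) ^ s * ‖u t‖ ≤ C₁ * bump t ^ 2)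
    (hv : ∀ t, (1 + |t|) ^ s * ‖v t‖ ≤ C₂ * (t ^ 4 * bump t ^ 4)) (ι : SignType) (η : Plane) :
    growth η ^ s * ‖planeSymbol u v ι η‖ ≤
      ((C₁ + C₂) * C₁) * (majorant ι η * planeBump η) := by
  have hb := fun t => (bump_pos t).le
  have hm := majorant_nonneg ι η
  have hp := (planeBump_pos η).le
  have base : growth η ^ s * ‖planeSymbol u v ι η‖ ≤
      ((if ι = 0 then C₁ else C₂) * C₁) * (majorant ι η * planeBump η) := by
    rcases ι with _ | _ | _
    · calc _ = ((1 + |η 0|) ^ s * ‖u (η 0)‖) * ((1 + |η 1|) ^ s * ‖u (η 1)‖) := by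
            simp only [growth, planeSymbol, norm_mul, mul_pow]; ring
        _ ≤ (C₁ * bump (η 0) ^ 2) * (C₁ * bump (η 1) ^ 2) :=
            mul_le_mul (hu _) (hu _) (by positivity) (by have := hb (η 0); positivity)
        _ = _ := by
            have : SignType.zero = 0 := rfl
            simp only [majorant, planeBump, this, if_true]; ring
    · calc _ = ((1 + |η 1|) ^ s * ‖v (η 1)‖) * ((1 + |η 0|) ^ s * ‖u (η 0)‖) := by
            simp only [growth, planeSymbol, norm_mul, mul_pow]; ring
        _ ≤ (C₂ * (η 1 ^ 4 * bump (η 1) ^ 4)) * (C₁ * bump (η 0) ^ 2) :=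
            mul_le_mul (hv _) (hu _) (by positivity) (by have := hb (η 1); positivity)
        _ = _ := by
            have : SignType.neg ≠ 0 := by decide
            simp only [majorant, planeBump, this, if_false]; ring
    · calc _ = ((1 + |η 0|) ^ s * ‖v (η 0)‖) * ((1 + |η 1|) ^ s * ‖u (η 1)‖) := by
            simp only [growth, planeSymbol, norm_mul, mul_pow]; ring
        _ ≤ (C₂ * (η 0 ^ 4 * bump (η 0) ^ 4)) * (C₁ * bump (η 1) ^ 2) :=
            mul_le_mul (hv _) (hu _) (by positivity) (by have := hb (η 0); positivity)
        _ = _ := by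
            have : SignType.pos ≠ 0 := by decide
            simp only [majorant, planeBump, this, if_false]; ring
  refine base.trans ?_
  gcongr
  split_ifs <;> linarith

theorem fourier_swap {f : L2Plane} {F : Plane → ℂ} (hF : Integrable F)
    (hf : (𝓕 f : L2Plane) =ᵐ[volume] F) :
    (𝓕 (swap f) : L2Plane) =ᵐ[volume] fun ξ => F !₂[ξ 1, ξ 0] := by
  have hdet : (!![0, 1; 1, 0] : Matrix (Fin 2) (Fin 2) ℝ).det ≠ 0 := by
    simp [Matrix.det_fin_two]
  have hinv : (!![0, 1; 1, 0] : Matrix (Fin 2) (Fin 2) ℝ)⁻¹ = !![0, 1; 1, 0] := by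
    refine Matrix.inv_eq_right_inv ?_
    ext i j
    fin_cases i <;> fin_cases j <;> simp [Matrix.mul_apply, Fin.sum_univ_two]
  filter_upwards [fourier_affineComp hdet 0 hF hf] with ξ h
  have e : Matrix.toEuclideanLin (!![0, 1; 1, 0] : Matrix (Fin 2) (Fin 2) ℝ).transpose ξ =
      !₂[ξ 1, ξ 0] := by
    ext i
    fin_cases i
    · exact (toEuclideanLin_apply_zero _ _).trans (by simp)
    · exact (toEuclideanLin_apply_one _ _).trans (by simp)
  rw [swap, h, hinv, e]
  simp [Matrix.det_fin_two]

theorem fourier_generator {φ₁ ψ₁ : L2Line} {u v : ℝ → ℂ} (hu : Integrable u) (hv : Integrable v)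
    (hφ : (𝓕 φ₁ : L2Line) =ᵐ[volume] u) (hψ : (𝓕 ψ₁ : L2Line) =ᵐ[volume] v) (ι : SignType) :
    (𝓕 (generator (tensor φ₁ φ₁) (tensor ψ₁ φ₁) (swap (tensor ψ₁ φ₁)) ι) : L2Plane) =ᵐ[volume]
      planeSymbol u v ι := by
  cases ι
  · exact fourier_tensor hu hu hφ hφ
  · refine (fourier_swap (integrable_plane_mul hv hu) (fourier_tensor hv hu hψ hφ)).trans
      (ae_of_all _ fun ξ => ?_)
    simp [planeSymbol]
  · exact fourier_tensor hv hu hψ hφ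

end PlaneSymbols

/-! ### Sobolev profiles and the frame criterion -/

section SobolevProfile

theorem two_rpow_neg_mul (j s : ℕ) : (2 : ℝ) ^ (-((j : ℝ) * s)) = ((2 ^ j) ^ s)⁻¹ := by
  rw [Real.rpow_neg two_pos.le, ← pow_mul]
  norm_cast

/-- The frequency profile of the rescaled generators with respect to the `H^s` inner product. -/
noncomputable def sobolevProfile (s : ℕ) (F : SignType → Plane → ℂ) (b : BaseIndex) (ξ : Plane) :
    ℂ :=
  (((2 : ℝ) ^ (-((b.j : ℝ) * s)) * Real.sqrt (sobolevWeight s ξ) : ℝ) : ℂ) *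
    starRingEnd ℂ (F b.ι (b.dual ξ))

variable {s : ℕ} {F : SignType → Plane → ℂ}

theorem norm_sobolevProfile (s : ℕ) (F : SignType → Plane → ℂ) (b : BaseIndex) (ξ : Plane) :
    ‖sobolevProfile s F b ξ‖ =
      ((2 ^ b.j) ^ s)⁻¹ * Real.sqrt (sobolevWeight s ξ) * ‖F b.ι (b.dual ξ)‖ := by
  rw [sobolevProfile, norm_mul, RCLike.norm_conj, Complex.norm_real, two_rpow_neg_mul,
    Real.norm_of_nonneg (by positivity)]

theorem measurable_sobolevProfile (hFm : ∀ ι, Measurable (F ι)) (b : BaseIndex) :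
    Measurable (sobolevProfile s F b) := by
  have hw : Measurable fun ξ => (((2 : ℝ) ^ (-((b.j : ℝ) * s)) *
      Real.sqrt (sobolevWeight s ξ) : ℝ) : ℂ) :=
    Complex.measurable_ofReal.comp
      ((continuous_sobolevWeight s).sqrt.measurable.const_mul _)
  exact hw.mul (Complex.continuous_conj.measurable.comp ((hFm b.ι).comp b.measurable_dual))

theorem norm_sobolevProfile_le {C : ℝ}
    (hF : ∀ ι η, growth η ^ s * ‖F ι η‖ ≤ C * (majorant ι η * planeBump η)) (b : BaseIndex)
    (ξ : Plane) : ‖sobolevProfile s F b ξ‖ ≤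
      weightConst s * C * (majorant b.ι (b.dual ξ) * planeBump (b.dual ξ)) := by
  rw [norm_sobolevProfile]
  have hp : (0 : ℝ) < (2 ^ b.j) ^ s := by positivity
  calc _ ≤ ((2 ^ b.j) ^ s)⁻¹ * (weightConst s * (2 ^ b.j) ^ s * growth (b.dual ξ) ^ s) *
        ‖F b.ι (b.dual ξ)‖ := by
        gcongr
        exact sqrt_sobolevWeight_le s b ξ
    _ = weightConst s * (growth (b.dual ξ) ^ s * ‖F b.ι (b.dual ξ)‖) := by field_simp
    _ ≤ weightConst s * (C * (majorant b.ι (b.dual ξ) * planeBump (b.dual ξ))) :=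
        mul_le_mul_of_nonneg_left (hF _ _) (weightConst_nonneg s)
    _ = _ := by ring

/-- For `ι = ±1` the moment variable is exactly `2^{-j} ξ_i`, unaffected by the shear, and `|ξ_i|^s
≤ √w(ξ)`. For `ι = 0` it is `1`, and `w ≥ 1`. -/
theorem abs_momentVar_pow_le (s : ℕ) (b : BaseIndex) (ξ : Plane) :
    |momentVar b.ι (b.dual ξ)| ^ s ≤ ((2 ^ b.j) ^ s)⁻¹ * Real.sqrt (sobolevWeight s ξ) := by
  have hp : (0 : ℝ) < 2 ^ b.j := by positivity
  have hcoord : ∀ i, |((2 : ℝ) ^ b.j)⁻¹ * ξ i| ^ s ≤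
      ((2 ^ b.j) ^ s)⁻¹ * Real.sqrt (sobolevWeight s ξ) := by
    intro i
    rw [abs_mul, abs_of_pos (inv_pos.2 hp), mul_pow, inv_pow]
    gcongr
    exact Real.le_sqrt_of_sq_le (abs_pow_sq_le_sobolevWeight s ξ i)
  rcases h : b.ι with _ | _ | _
  · rw [b.j_eq_zero h]
    simpa [momentVar] using one_le_sobolevWeight s ξ
  · simp only [momentVar, (b.dual_of_neg h ξ).2]
    exact hcoord 1
  · simp only [momentVar, (b.dual_of_pos h ξ).1]
    exact hcoord 0

/-- Each symbol `(2πiξ)^a` is at most `√w`, hence at most a multiple of `growth^s` in the dual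
variable, which the decay of `F` absorbs while leaving a square integrable bump. -/
theorem exists_sobolev_system {φ ψ ψ' : L2Plane} {C : ℝ} (hFm : ∀ ι, Measurable (F ι))
    (hFint : ∀ ι, Integrable (F ι))
    (hF : ∀ ι η, growth η ^ s * ‖F ι η‖ ≤ C * planeBump η)
    (h : ∀ ι, (𝓕 (generator φ ψ ψ' ι) : L2Plane) =ᵐ[volume] F ι) (c : ℝ) (l : Index) (z : ℂ) :
    ∃ Φ : SobolevSpace s, SobolevSpace.toL2 Φ = z • system φ ψ ψ' c c l := by
  refine SobolevSpace.exists_toL2_eq _ fun a => ?_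
  have hs := l.base.scale_pos
  set b := l.base with hb
  set q : Plane → ℂ := fun ξ => derivSymbol a.1.1 a.1.2 ξ * (z * (((b.scale⁻¹ : ℝ) : ℂ) *
    (Real.fourierChar (-inner ℝ (b.dual ξ) (latticePoint c c l.m)) : ℂ) *
      F l.ι (b.dual ξ))) with hq
  have mchar : Measurable fun ξ =>
      (Real.fourierChar (-inner ℝ (b.dual ξ) (latticePoint c c l.m)) : ℂ) := by
    have h1 : Continuous fun η : Plane =>
        (Real.fourierChar (-inner ℝ η (latticePoint c c l.m)) : ℂ) :=
      Continuous.comp (g := fun x : ℝ => (Real.fourierChar x : ℂ))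
        (continuous_induced_dom.comp Real.continuous_fourierChar) (by fun_prop)
    exact h1.measurable.comp b.measurable_dual
  have mq : Measurable q := (continuous_derivSymbol _ _).measurable.mul
    (((mchar.const_mul _).mul ((hFm l.ι).comp b.measurable_dual)).const_mul z)
  have hle : ∀ ξ, ‖q ξ‖ ≤
      (weightConst s * (2 ^ b.j) ^ s * ‖z‖ * b.scale⁻¹ * C) * planeBump (b.dual ξ) := by
    intro ξ
    have hd : ‖derivSymbol a.1.1 a.1.2 ξ‖ ≤
        weightConst s * (2 ^ b.j) ^ s * growth (b.dual ξ) ^ s :=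
      (Real.le_sqrt_of_sq_le (norm_derivSymbol_sq_le_sobolevWeight a ξ)).trans
        (sqrt_sobolevWeight_le s b ξ)
    have hw := weightConst_nonneg s
    calc ‖q ξ‖ = ‖derivSymbol a.1.1 a.1.2 ξ‖ * (‖z‖ * b.scale⁻¹ * ‖F l.ι (b.dual ξ)‖) := by
          simp only [hq, norm_mul, Complex.norm_real, Circle.norm_coe,
            Real.norm_of_nonneg (inv_pos.2 hs).le]
          ring
      _ ≤ weightConst s * (2 ^ b.j) ^ s * growth (b.dual ξ) ^ s *
            (‖z‖ * b.scale⁻¹ * ‖F l.ι (b.dual ξ)‖) := by gcongr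
      _ = weightConst s * (2 ^ b.j) ^ s * ‖z‖ * b.scale⁻¹ *
            (growth (b.dual ξ) ^ s * ‖F l.ι (b.dual ξ)‖) := by ring
      _ ≤ weightConst s * (2 ^ b.j) ^ s * ‖z‖ * b.scale⁻¹ * (C * planeBump (b.dual ξ)) :=
          mul_le_mul_of_nonneg_left (hF _ _) (by positivity)
      _ = _ := by ring
  refine (memLp_congr_ae ?_).1 (memLp_two_of_le_planeBump_dual b mq hle)
  rw [FourierTransform.fourier_smul]
  filter_upwards [Lp.coeFn_smul z (𝓕 (system φ ψ ψ' c c l) : L2Plane),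
    fourier_system hFint h c l] with ξ h1 h2
  rw [h1, Pi.smul_apply, h2, smul_eq_mul]

/-- A lower bound on the Calderón sum of the profiles yields a frame for `H^s` for all small
sampling constants. -/
theorem exists_isFrame_of_profile_bounds {φ ψ ψ' : L2Plane} {C L : ℝ}
    (hFm : ∀ ι, Measurable (F ι)) (hFint : ∀ ι, Integrable (F ι))
    (h : ∀ ι, (𝓕 (generator φ ψ ψ' ι) : L2Plane) =ᵐ[volume] F ι)
    (hb : ∀ b ξ, ‖sobolevProfile s F b ξ‖ ≤
      C * (majorant b.ι (b.dual ξ) * planeBump (b.dual ξ)))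
    (hL0 : 0 < L)
    (hL : ∀ᵐ ξ, ENNReal.ofReal L ≤ ∑' b : BaseIndex, ‖sobolevProfile s F b ξ‖ₑ ^ 2) :
    ∃ ctilde : ℝ, 0 < ctilde ∧ ∀ c : ℝ, 0 < c → c ≤ ctilde → ∀ Ψ : Index → SobolevSpace s,
      (∀ l : Index, SobolevSpace.toL2 (Ψ l) =
        (((2 : ℝ) ^ (-((l.j : ℝ) * s)) : ℝ) : ℂ) • system φ ψ ψ' c c l) → IsFrame Ψ := by
  have hS0 := majorantSum_nonneg
  have hO0 : 0 ≤ overlapConst C := by unfold overlapConst; positivity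
  obtain ⟨E, hE⟩ : ∃ E, E = overlapConst C * majorantSum := ⟨_, rfl⟩
  have hE0 : 0 ≤ E := by rw [hE]; positivity
  -- With `c ≤ 1` one has `c² ≤ c`, so the second entry gives `c² E ≤ L / 2`: the overlap takes at
  -- most half of the diagonal term `c⁻² L`. Using `E + 1` avoids dividing by zero.
  refine ⟨min 1 (L / (2 * (E + 1))), by positivity, fun c hc hcle Ψ hΨ => ?_⟩
  have hc1 : c ≤ 1 := hcle.trans (min_le_left _ _)
  have hc2 : c ^ 2 * E ≤ L / 2 := by
    have h1 : c * (2 * (E + 1)) ≤ L :=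
      (le_div_iff₀ (by positivity)).1 (hcle.trans (min_le_right _ _))
    have h2 : c ^ 2 ≤ c := by nlinarith
    nlinarith [mul_le_mul_of_nonneg_right h2 hE0]
  have hsplit : (c ^ 2)⁻¹ * L / 2 + E ≤ (c ^ 2)⁻¹ * L := by
    have : E ≤ (c ^ 2)⁻¹ * (L / 2) := by
      rw [inv_mul_eq_div, le_div_iff₀ (by positivity)]
      linarith
    linarith
  have hbounds : HasFrameBounds ((c ^ 2)⁻¹ * L / 2)
      ((c ^ 2)⁻¹ * (C ^ 2 * majorantSum) + E) Ψ := by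
    intro f
    obtain ⟨G, hG⟩ : ∃ G : Plane → ℂ, G = fun ξ => ((Real.sqrt (sobolevWeight s ξ) : ℝ) : ℂ) *
      (𝓕 (SobolevSpace.toL2 f) : L2Plane) ξ := ⟨_, rfl⟩
    have mG : Measurable G := by
      rw [hG]
      exact (Complex.measurable_ofReal.comp (continuous_sobolevWeight s).sqrt.measurable).mul
        (Lp.stronglyMeasurable _).measurable
    have hN : ENNReal.ofReal (‖f‖ ^ 2) = ∫⁻ ξ, ‖G ξ‖ₑ ^ 2 := by
      rw [SobolevSpace.ofReal_norm_sq, hG]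
    have G2 : MemLp G 2 := by
      refine ⟨mG.aestronglyMeasurable, ?_⟩
      rw [eLpNorm_lt_top_iff_lintegral_rpow_enorm_lt_top (by norm_num) (by norm_num)]
      simp only [ENNReal.toReal_ofNat, ENNReal.rpow_ofNat]
      rw [← hN]
      exact ENNReal.ofReal_lt_top
    have hcoef : ∑' l, ENNReal.ofReal (‖inner ℂ (Ψ l) f‖ ^ 2) =
        ∑' b, generatorSum b c (sobolevProfile s F b) G := by
      refine tsum_coefficients_eq (q := sobolevProfile s F) fun l => ?_
      rw [sobolev_inner_eq hFint h c l (hΨ l) f, hG]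
      rfl
    obtain ⟨hup, hlow⟩ := tsum_generatorSum_bounds (measurable_sobolevProfile hFm) hb hc hc1 hL
      mG G2
    rw [← hcoef, ← hE, ← hN] at hup hlow
    have hA0 : 0 ≤ (c ^ 2)⁻¹ * L / 2 := by positivity
    constructor
    -- The overlap term is added to both sides and then cancelled, which is legitimate in `[0, ∞]`
    -- because it is finite.
    · have hfin : ENNReal.ofReal E * ENNReal.ofReal (‖f‖ ^ 2) ≠ ∞ :=
        ENNReal.mul_ne_top ENNReal.ofReal_ne_top ENNReal.ofReal_ne_top
      refine (ENNReal.add_le_add_iff_right hfin).1 (le_trans ?_ hlow)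
      rw [ENNReal.ofReal_mul hA0, ← add_mul, ← ENNReal.ofReal_add hA0 hE0]
      gcongr
    · rw [ENNReal.ofReal_mul (by positivity)]
      exact hup
  refine ⟨(c ^ 2)⁻¹ * L / 2, max ((c ^ 2)⁻¹ * L / 2) ((c ^ 2)⁻¹ * (C ^ 2 * majorantSum) + E),
    by positivity, le_max_left _ _, fun f => ⟨(hbounds f).1, (hbounds f).2.trans ?_⟩⟩
  gcongr
  exact le_max_right _ _

/-- The Calderón sum of the generators with moments is dominated by that of the profiles. -/
theorem enorm_moment_le_enorm_sobolevProfile (b : BaseIndex) (ξ : Plane) :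
    ‖((momentVar b.ι (b.dual ξ) : ℝ) : ℂ) ^ s * F b.ι (b.dual ξ)‖ₑ ≤
      ‖sobolevProfile s F b ξ‖ₑ := by
  rw [enorm_le_iff_norm_le, norm_sobolevProfile, norm_mul, norm_pow, Complex.norm_real,
    Real.norm_eq_abs]
  gcongr
  exact abs_momentVar_pow_le s b ξ

end SobolevProfile

/-! ### Assembling the frame theorem -/

section Main

theorem exists_weakDeriv_bound_mono {f : L2Line} {s : ℕ} {κ κ' : ℝ → ℝ} {K : ℝ}
    (hκ : ∀ t, 0 ≤ κ t) (hK : ∀ t, κ t ≤ K * κ' t)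
    (hf : ∀ r ≤ 2 * s, ∃ g : L2Line, IsWeakDerivLine r f g ∧
      ∃ C : ℝ, ∀ᵐ ξ : ℝ, ‖(𝓕 g : L2Line) ξ‖ ≤ C * κ ξ) :
    ∀ r ≤ 2 * s, ∃ g : L2Line, IsWeakDerivLine r f g ∧
      ∃ C : ℝ, ∀ᵐ ξ : ℝ, ‖(𝓕 g : L2Line) ξ‖ ≤ C * κ' ξ := by
  intro r hr
  obtain ⟨g, hg, C, hC⟩ := hf r hr
  refine ⟨g, hg, |C| * K, hC.mono fun t ht => ht.trans ?_⟩
  rw [mul_assoc]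
  exact mul_le_mul (le_abs_self C) (hK t) (hκ t) (abs_nonneg C)

theorem min_one_rpow_nonneg (t γ : ℝ) : 0 ≤ min 1 (|t| ^ γ) :=
  le_min zero_le_one (Real.rpow_nonneg (abs_nonneg t) _)

theorem exists_line_symbol_of_decay {β : ℝ} (hβ : 4 < β) {f : L2Line} {s : ℕ}
    (hf : ∀ r ≤ 2 * s, ∃ g : L2Line, IsWeakDerivLine r f g ∧
      ∃ C : ℝ, ∀ᵐ ξ : ℝ, ‖(𝓕 g : L2Line) ξ‖ ≤ C * min 1 (|ξ| ^ (-β))) :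
    ∃ p : ℝ → ℂ, Measurable p ∧ (𝓕 f : L2Line) =ᵐ[volume] p ∧
      ∃ C, 0 ≤ C ∧ ∀ t, (1 + |t|) ^ s * ‖p t‖ ≤ C * bump t ^ 2 :=
  exists_line_symbol (continuous_bump.measurable.pow_const 2) (fun _ => sq_nonneg _)
    (exists_weakDeriv_bound_mono (fun t => min_one_rpow_nonneg t _) (min_decay_le hβ) hf)

theorem exists_line_symbol_of_moments {α β : ℝ} (hα : 4 < α) (hβ : 4 < β) {f : L2Line} {s : ℕ}
    (hf : ∀ r ≤ 2 * s, ∃ g : L2Line, IsWeakDerivLine r f g ∧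
      ∃ C : ℝ, ∀ᵐ ξ : ℝ,
        ‖(𝓕 g : L2Line) ξ‖ ≤ C * (min 1 (|ξ| ^ α) * min 1 (|ξ| ^ (-β)))) :
    ∃ p : ℝ → ℂ, Measurable p ∧ (𝓕 f : L2Line) =ᵐ[volume] p ∧
      ∃ C, 0 ≤ C ∧ ∀ t, (1 + |t|) ^ s * ‖p t‖ ≤ C * (t ^ 4 * bump t ^ 4) :=
  exists_line_symbol
    ((measurable_id.pow_const 4).mul (continuous_bump.measurable.pow_const 4))
    (fun t => by have := bump_pos t; positivity)
    (exists_weakDeriv_bound_mono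
      (fun t => mul_nonneg (min_one_rpow_nonneg t _) (min_one_rpow_nonneg t _))
      (min_moment_le hα hβ) hf)

theorem pow_four_mul_bump_le (t : ℝ) : t ^ 4 * bump t ^ 4 ≤ bump t := by
  have hb := bump_pos t
  have h1 := pow_le_one₀ (n := 2) (mul_nonneg (sq_nonneg t) hb.le) (sq_mul_bump_le_one t)
  have h2 : bump t ^ 2 ≤ bump t := by nlinarith [bump_le_one t]
  calc t ^ 4 * bump t ^ 4 = (t ^ 2 * bump t) ^ 2 * bump t ^ 2 := by ring
    _ ≤ 1 * bump t := mul_le_mul h1 h2 (by positivity) zero_le_one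
    _ = bump t := one_mul _

/-- A frame for `L²` generated by the symbols with moments gives a frame for `H^s` for all small
sampling constants. -/
theorem exists_sobolev_frame {φ₁ ψ₁ : L2Line} {u v : ℝ → ℂ} {s : ℕ} {C₁ C₂ : ℝ}
    (mu : Measurable u) (mv : Measurable v)
    (hu : (𝓕 φ₁ : L2Line) =ᵐ[volume] u) (hv : (𝓕 ψ₁ : L2Line) =ᵐ[volume] v)
    (hC₁ : 0 ≤ C₁) (hC₂ : 0 ≤ C₂)
    (hub : ∀ t, (1 + |t|) ^ s * ‖u t‖ ≤ C₁ * bump t ^ 2)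
    (hvb : ∀ t, (1 + |t|) ^ s * ‖v t‖ ≤ C₂ * (t ^ 4 * bump t ^ 4))
    {φ ψ ψ' μ θ θ' : L2Plane}
    (hφ : φ = tensor φ₁ φ₁) (hψ : ψ = tensor ψ₁ φ₁) (hψ' : ψ' = swap ψ)
    (hμ : (𝓕 μ : L2Plane) = 𝓕 φ)
    (hθ : (𝓕 θ : L2Plane) =ᵐ[volume] fun ξ => ((ξ 0 : ℝ) : ℂ) ^ s * (𝓕 ψ : L2Plane) ξ)
    (hθ' : (𝓕 θ' : L2Plane) =ᵐ[volume] fun ξ => ((ξ 1 : ℝ) : ℂ) ^ s * (𝓕 ψ' : L2Plane) ξ)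
    {cbar A B : ℝ} (hcbar : 0 < cbar) (hA : 0 < A)
    (hB : HasFrameBounds A B (system μ θ θ' cbar cbar)) :
    ∃ ctilde : ℝ, 0 < ctilde ∧ ∀ c : ℝ, 0 < c → c ≤ ctilde →
      ∃ Ψ : Index → SobolevSpace s,
        (∀ l : Index, SobolevSpace.toL2 (Ψ l) =
          (((2 : ℝ) ^ (-((l.j : ℝ) * s)) : ℝ) : ℂ) • system φ ψ ψ' c c l) ∧
        IsFrame Ψ := by
  have hone : ∀ (p : ℝ → ℂ) (t : ℝ), ‖p t‖ ≤ (1 + |t|) ^ s * ‖p t‖ := fun p t =>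
    le_mul_of_one_le_left (norm_nonneg _) (one_le_pow₀ (by linarith [abs_nonneg t]))
  have iu : Integrable u := integrable_of_le_bump mu (C := C₁) fun t => by
    refine ((hone u t).trans (hub t)).trans (mul_le_mul_of_nonneg_left ?_ hC₁)
    nlinarith [bump_pos t, bump_le_one t]
  have iv : Integrable v := integrable_of_le_bump mv (C := C₂) fun t =>
    ((hone v t).trans (hvb t)).trans (mul_le_mul_of_nonneg_left (pow_four_mul_bump_le t) hC₂)
  obtain ⟨C, hC⟩ : ∃ C, C = (C₁ + C₂) * C₁ := ⟨_, rfl⟩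
  have hC0 : 0 ≤ C := by rw [hC]; positivity
  obtain ⟨F, hFdef⟩ : ∃ F, F = planeSymbol u v := ⟨_, rfl⟩
  have hFm : ∀ ι, Measurable (F ι) := hFdef ▸ measurable_planeSymbol mu mv
  have hFgen : ∀ ι, (𝓕 (generator φ ψ ψ' ι) : L2Plane) =ᵐ[volume] F ι := by
    rw [hψ', hψ, hφ, hFdef]
    exact fourier_generator iu iv hu hv
  have hFb : ∀ ι η, growth η ^ s * ‖F ι η‖ ≤ C * (majorant ι η * planeBump η) := by
    rw [hFdef, hC]
    exact growth_pow_mul_planeSymbol_le hC₁ hC₂ hub hvb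
  have hFb' : ∀ ι η, growth η ^ s * ‖F ι η‖ ≤ C * planeBump η := fun ι η =>
    (hFb ι η).trans (mul_le_mul_of_nonneg_left
      (mul_le_of_le_one_left (planeBump_pos η).le (majorant_le_one ι η)) hC0)
  have hFint : ∀ ι, Integrable (F ι) := fun ι => integrable_of_le_planeBump (hFm ι) fun η =>
    (le_mul_of_one_le_left (norm_nonneg _) (one_le_pow₀ (one_le_growth η))).trans (hFb' ι η)
  have hθgen : ∀ ι, (𝓕 (generator μ θ θ' ι) : L2Plane) =ᵐ[volume]
      fun η => ((momentVar ι η : ℝ) : ℂ) ^ s * F ι η := by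
    intro ι
    cases ι
    · change (𝓕 μ : L2Plane) =ᵐ[volume] _
      rw [hμ]
      filter_upwards [hFgen SignType.zero] with η hη
      simpa [momentVar, generator] using hη
    · filter_upwards [hθ', hFgen SignType.neg] with η h1 h2
      exact h1.trans (congrArg _ h2)
    · filter_upwards [hθ, hFgen SignType.pos] with η h1 h2
      exact h1.trans (congrArg _ h2)
  -- The factor `|momentVar|^s` is at most `growth^s`, so the symbols of `μ, θ, θ'` still decay like
  -- `planeBump`.
  have hcal := calderon_lower_bound (C := C)
    (fun ι => ((Complex.measurable_ofReal.comp (measurable_momentVar ι)).pow_const s).mul (hFm ι))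
    (fun ι η => by
      change ‖((momentVar ι η : ℝ) : ℂ) ^ s * F ι η‖ ≤ _
      rw [norm_mul, norm_pow, Complex.norm_real, Real.norm_eq_abs]
      refine le_trans ?_ (hFb' ι η)
      gcongr
      exact abs_momentVar_le_growth ι η) hθgen hcbar hA hB
  have hL : ∀ᵐ ξ, ENNReal.ofReal (cbar ^ 2 * A) ≤
      ∑' b : BaseIndex, ‖sobolevProfile s F b ξ‖ₑ ^ 2 := by
    filter_upwards [hcal] with ξ hξ
    refine hξ.trans (ENNReal.tsum_le_tsum fun b => ?_)
    gcongr
    exact enorm_moment_le_enorm_sobolevProfile b ξ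
  obtain ⟨ctilde, hct, hmain⟩ := exists_isFrame_of_profile_bounds hFm hFint hFgen
    (norm_sobolevProfile_le hFb) (by positivity) hL
  refine ⟨ctilde, hct, fun c hc hcle => ?_⟩
  choose Ψ hΨ using fun l : Index => exists_sobolev_system (s := s) hFm hFint hFb' hFgen c l
    (((2 : ℝ) ^ (-((l.j : ℝ) * s)) : ℝ) : ℂ)
  exact ⟨Ψ, hΨ, hmain c hc hcle Ψ hΨ⟩

end Main

end Shearlet

theorem theorem3p1 (s : ℕ) (α β : ℝ) (hαβ : β < α - s) (hβ : 4 < β)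
    (φ₁ ψ₁ : Shearlet.L2Line)
    -- the derivatives of the generators up to order `2s` have Fourier decay
    (hφ₁ : ∀ r ≤ 2 * s, ∃ g : Shearlet.L2Line, Shearlet.IsWeakDerivLine r φ₁ g ∧
      ∃ C : ℝ, ∀ᵐ ξ : ℝ, ‖(𝓕 g : Shearlet.L2Line) ξ‖ ≤ C * min 1 (|ξ| ^ (-β)))
    (hψ₁ : ∀ r ≤ 2 * s, ∃ g : Shearlet.L2Line, Shearlet.IsWeakDerivLine r ψ₁ g ∧
      ∃ C : ℝ, ∀ᵐ ξ : ℝ,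
        ‖(𝓕 g : Shearlet.L2Line) ξ‖ ≤ C * (min 1 (|ξ| ^ α) * min 1 (|ξ| ^ (-β))))
    -- the tensor product generators
    (φ ψ ψ' : Shearlet.L2Plane)
    (hφ : φ = Shearlet.tensor φ₁ φ₁) (hψ : ψ = Shearlet.tensor ψ₁ φ₁) (hψ' : ψ' = Shearlet.swap ψ)
    -- the auxiliary generators `μ, θ, θ'`
    (μ θ θ' : Shearlet.L2Plane)
    (hμ : (𝓕 μ : Shearlet.L2Plane) = 𝓕 φ)
    (hθ : (𝓕 θ : Shearlet.L2Plane) =ᵐ[volume]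
      fun ξ => ((ξ 0 : ℝ) : ℂ) ^ s * (𝓕 ψ : Shearlet.L2Plane) ξ)
    (hθ' : (𝓕 θ' : Shearlet.L2Plane) =ᵐ[volume]
      fun ξ => ((ξ 1 : ℝ) : ℂ) ^ s * (𝓕 ψ' : Shearlet.L2Plane) ξ)
    -- the auxiliary systems are frames with a lower bound independent of the sampling constants
    (hframe : ∃ cbar : ℝ, 0 < cbar ∧ ∃ A : ℝ, 0 < A ∧
      ∀ c₁ c₂ : ℝ, 0 < c₁ → c₁ ≤ cbar → 0 < c₂ → c₂ ≤ cbar →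
        ∃ B : ℝ, A ≤ B ∧ Shearlet.HasFrameBounds A B (Shearlet.system μ θ θ' c₁ c₂)) :
    ∃ ctilde : ℝ, 0 < ctilde ∧ ∀ c : ℝ, 0 < c → c ≤ ctilde →
      ∃ Ψ : Shearlet.Index → Shearlet.SobolevSpace s,
        (∀ l : Shearlet.Index, Shearlet.SobolevSpace.toL2 (Ψ l) =
          (((2 : ℝ) ^ (-((l.j : ℝ) * s)) : ℝ) : ℂ) • Shearlet.system φ ψ ψ' c c l) ∧
        Shearlet.IsFrame Ψ := by
  have hα : 4 < α := by
    have : (0 : ℝ) ≤ s := s.cast_nonneg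
    linarith
  obtain ⟨u, mu, hu, C₁, hC₁, hub⟩ := Shearlet.exists_line_symbol_of_decay hβ hφ₁
  obtain ⟨v, mv, hv, C₂, hC₂, hvb⟩ := Shearlet.exists_line_symbol_of_moments hα hβ hψ₁
  obtain ⟨cbar, hcbar, A, hA, hfr⟩ := hframe
  -- One isotropic lattice is enough: the Calderón sum it bounds from below does not depend on the
  -- sampling constants.
  obtain ⟨B, -, hB⟩ := hfr cbar cbar hcbar le_rfl hcbar le_rfl
  exact Shearlet.exists_sobolev_frame mu mv hu hv hC₁ hC₂ hub hvb hφ hψ hψ' hμ hθ hθ' hcbar hA hB
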